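/- Setting. Let $n,p\ge 1$. A network of $n$ agents communicates at times $t=1,2,\dots$ over digraphs $\mathcal G_t=([n],\mathcal E_t)$, where $(j,i)\in\mathcal E_t$ means that $i$ receives from $j$, with mixing matrices $W_t\in\mathbb R^{n\times n}$. Agent $i$ has losses $f_{i,t}:\mathbb X\to\mathbb R$ (possibly nonconvex) and componentwise convex constraint functions $g_{i,t}:\mathbb X\to\mathbb R^{m_i}$ on a set $\mathbb X\subseteq\mathbb R^p$. Put $f_t=\frac1n\sum_j f_{j,t}$, $g_t=\mathrm{col}(g_{1,t},\dots,g_{n,t})$ and $\mathcal X_T=\{x\in\mathbb X: g_t(x)\le 0,\ 1\le t\le T\}$, assumed nonempty for every $T\ge1$. Norms are Euclidean (operator norm for Jacobians), and $[\cdot]_+$ is the componentwise positive part. Assumptions (for all $i\in[n]$, $t\ge1$, $x,y\in\mathbb X$, with constants $r,R,F_2>0$, $F_1,G_1,G_2,L$, $w\in(0,1)$, an integer $B\ge1$, and $C\ge0$). (1) $\mathbb X$ is closed and convex and $r\mathbb B^p\subseteq\mathbb X\subseteq R\,\mathbb B^p$, where $\mathbb B^p$ is the closed unit ball. (2) $|f_{i,t}(x)|\le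 F_1$ and $\|g_{i,t}(x)\|\le F_2$. (3) $f_{i,t}$ is differentiable on $\mathbb X$ with $\|\nabla f_{i,t}(x)\|\le G_1$, and $g_{i,t}$ has at $x$ a (componentwise) subgradient relative to $\mathbb X$ of norm at most $G_2$. (4) $\|\nabla f_{i,t}(x)-\nabla f_{i,t}(y)\|\le L\|x-y\|$. (5) $[W_t]_{ij}\ge w$ if $(j,i)\in\mathcal E_t$ or $i=j$, and $[W_t]_{ij}=0$ otherwise; $W_t$ is doubly stochastic; and $([n],\bigcup_{l=0}^{B-1}\mathcal E_{t+l})$ is strongly connected. (6) The random compressor $\mathcal C:\mathbb Y\to\mathbb Y$, $\mathbb Y\subseteq\mathbb R^p$, satisfies $\mathbf E_{\mathcal C}\|\mathcal C(y)-y\|^2\le C$ for all $y\in\mathbb Y$; its uses (for different agents and times) have independent internal randomness. (7) (Slater) There are $x_s\in\mathbb X$ and $\varsigma_s>0$ with $g_t(x_s)\le-\varsigma_s\mathbf 1$ for all $t\ge1$. Algorithm. Let $\hat z_{j,0}=0$ and $z_{i,1}\in(1-\xi_1)\mathbb X$. For $t\ge1$ and all $i,j\in[n]$: $$\hat z_{j,t}=\hat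 z_{j,t-1}+s_t\,\mathcal C\big((z_{j,t}-\hat z_{j,t-1})/s_t\big),\qquad x_{i,t}=\sum_{j=1}^n[W_t]_{ij}\hat z_{j,t};$$ draw $u_{i,t}$ uniformly on the unit sphere of $\mathbb R^p$ (all draws independent of each other and of the compressor's randomness), put $e_{i,t}=x_{i,t}+\delta_tu_{i,t}$, and set $$v_{i,t+1}=\gamma_t[g_{i,t}(e_{i,t})]_+,\qquad a_{i,t+1}=\tfrac p{\delta_t}f_{i,t}(e_{i,t})u_{i,t}+\tfrac p{\delta_t}\big(u_{i,t}\,g_{i,t}(e_{i,t})^{T}\big)v_{i,t+1},\qquad z_{i,t+1}=\mathcal P_{(1-\xi_{t+1})\mathbb X}(x_{i,t}-\alpha_ta_{i,t+1}),$$ where $\mathcal P$ is the Euclidean projection. The algorithm is assumed to be well defined: almost surely every query point $e_{i,t}$ lies in $\mathbb X$ (where the functions are defined) and every compressed vector $(z_{j,t}-\hat z_{j,t-1})/s_t$ lies in $\mathbb Y$. The performance measures are $$\mathrm{Reg}(T)=\frac1n\sum_{i=1}^n\Big(\sum_{t=1}^T\langle\nabla f_t(x_{i,t}),x_{i,t}\rangle-\inf_{x\in\mathcal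 X_T}\Big\langle\sum_{t=1}^T\nabla f_t(x_{i,t}),x\Big\rangle\Big),\qquad \mathrm{CCV}(T)=\frac1n\sum_{i=1}^n\sum_{t=1}^T\big\|[g_t(x_{i,t})]_+\big\|.$$ Theorem. Suppose (1)–(6) hold and $$\alpha_t=\frac{\alpha_0}{t^{\theta_1}},\quad\gamma_t=\gamma_0t^{\theta_2},\quad\xi_t=\frac1{t^{\theta_3}},\quad\delta_t=\frac r{t^{\theta_3}},\quad s_t=\frac{s_0}{t^{\theta_4}},$$ where $\alpha_0,s_0>0$, $\theta_1\in(0,1)$, $\gamma_0\in(0,r^2/(2p^2F_2^2)]$, $\theta_2\in(0,\theta_1/3)$, $\theta_3\in(\theta_2,(\theta_1-\theta_2)/2]$, $\theta_4\ge1$, and, in the borderline case $\theta_3=(\theta_1-\theta_2)/2$ only, also $\alpha_0\gamma_0\le r^2/(2p^2F_2^2)$. Then for all $T\ge1$ $$\mathbf E[\mathrm{Reg}(T)]=\mathcal O\big(T^{\max\{\theta_1,\,1-\theta_1+2\theta_3,\,1+\theta_2-\theta_3\}}\big),\qquad \mathbf E[\mathrm{CCV}(T)]=\mathcal O\big(T^{1-\theta_2/2}\big),$$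 and if (7) also holds, then $\mathbf E[\mathrm{CCV}(T)]=\mathcal O(T^{1-\theta_2})$. In particular, for $\theta_1\in(3/4,5/6]$, $\theta_2=2\theta_1-3/2$ and $\theta_3=\theta_1-1/2$ (the choice that makes the three exponents in the maximum equal; the borderline case is $\theta_1=5/6$), the three bounds are $\mathcal O(T^{\theta_1})$, $\mathcal O(T^{7/4-\theta_1})$ and $\mathcal O(T^{5/2-2\theta_1})$. Here $a_T=\mathcal O(b_T)$ means $a_T\le Kb_T$ for all $T\ge1$, with $K>0$ depending only on $n$, $p$, the constants in (1)–(6), the schedule constants $\alpha_0,\gamma_0,s_0,\theta_1,\dots,\theta_4$ and, for the last bound, $\varsigma_s$. The expectations exist. -/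

import Mathlib

open MeasureTheory ProbabilityTheory
open scoped Pointwise

universe u v

noncomputable section

namespace BanditOpt

/-- Euclidean space `ℝ^d`. -/
abbrev Vec (d : ℕ) := EuclideanSpace ℝ (Fin d)

/-- The componentwise positive part `[v]_+`. -/
def posPart {ι : Type*} (v : EuclideanSpace ℝ ι) : EuclideanSpace ℝ ι :=
  WithLp.toLp 2 (fun k => max (v k) 0)

/-- `y` is the Euclidean projection of `x` onto `K`. -/
def IsProj {d : ℕ} (K : Set (Vec d)) (x y : Vec d) : Prop :=
  y ∈ K ∧ ∀ y' ∈ K, ‖x - y‖ ≤ ‖x - y'‖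

/-- The uniform probability distribution on the unit sphere of `ℝ^p`: the surface measure
induced by Lebesgue measure, normalized. -/
def uniformSphere (p : ℕ) : Measure (Vec p) :=
  ((volume : Measure (Vec p)).toSphere Set.univ)⁻¹ •
    Measure.map Subtype.val (volume : Measure (Vec p)).toSphere

/-- The constants in the standing assumptions. -/
structure Constants where
  /-- inner radius of the decision set -/
  r : ℝ
  /-- outer radius of the decision set -/
  R : ℝ
  /-- bound on the losses -/
  F₁ : ℝ
  /-- bound on the constraint functions -/
  F₂ : ℝ
  /-- bound on the gradients of the losses -/
  G₁ : ℝ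
  /-- bound on the subgradients of the constraint functions -/
  G₂ : ℝ
  /-- Lipschitz constant of the gradients of the losses -/
  L : ℝ
  /-- lower bound on the positive mixing weights -/
  w : ℝ
  /-- length of the windows over which the graphs are jointly strongly connected -/
  B : ℕ
  /-- bound on the mean square compression error -/
  C : ℝ

/-- The ranges of the constants. -/
structure Constants.Valid (c : Constants) : Prop where
  r_pos : 0 < c.r
  R_pos : 0 < c.R
  F₂_pos : 0 < c.F₂
  w_mem : c.w ∈ Set.Ioo (0 : ℝ) 1
  B_pos : 0 < c.B
  C_nonneg : 0 ≤ c.C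

/-- The constants of the polynomial parameter schedules. -/
structure Schedule where
  α₀ : ℝ
  γ₀ : ℝ
  s₀ : ℝ
  θ₁ : ℝ
  θ₂ : ℝ
  θ₃ : ℝ
  θ₄ : ℝ

namespace Schedule

/-- The stepsize. -/
def α (S : Schedule) (t : ℕ) : ℝ := S.α₀ / (t : ℝ) ^ S.θ₁

/-- The regularization parameter. -/
def γ (S : Schedule) (t : ℕ) : ℝ := S.γ₀ * (t : ℝ) ^ S.θ₂

/-- The shrinkage coefficient. -/
def ξ (S : Schedule) (t : ℕ) : ℝ := 1 / (t : ℝ) ^ S.θ₃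

/-- The exploration parameter; `r` is the inner radius of the decision set. -/
def δ (S : Schedule) (r : ℝ) (t : ℕ) : ℝ := r / (t : ℝ) ^ S.θ₃

/-- The scaling parameter of the compression. -/
def s (S : Schedule) (t : ℕ) : ℝ := S.s₀ / (t : ℝ) ^ S.θ₄

/-- The admissible constants of the schedules. The last field only concerns the borderline
exponent `θ₃ = (θ₁ - θ₂) / 2`: it says `α_t γ_t ≤ δ_t² / (2 p² F₂²)` there. -/
structure Admissible (S : Schedule) (p : ℕ) (c : Constants) : Prop where
  α₀_pos : 0 < S.α₀
  θ₁_mem : S.θ₁ ∈ Set.Ioo (0 : ℝ) 1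
  γ₀_mem : S.γ₀ ∈ Set.Ioc (0 : ℝ) (c.r ^ 2 / (2 * (p : ℝ) ^ 2 * c.F₂ ^ 2))
  θ₂_mem : S.θ₂ ∈ Set.Ioo (0 : ℝ) (S.θ₁ / 3)
  θ₃_mem : S.θ₃ ∈ Set.Ioc S.θ₂ ((S.θ₁ - S.θ₂) / 2)
  s₀_pos : 0 < S.s₀
  θ₄_ge : 1 ≤ S.θ₄
  borderline : S.θ₃ = (S.θ₁ - S.θ₂) / 2 →
    S.α₀ * S.γ₀ ≤ c.r ^ 2 / (2 * (p : ℝ) ^ 2 * c.F₂ ^ 2)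

end Schedule

/-- The data of a distributed online problem with `n` agents and decisions in `ℝ^p`. Times are
`t = 1, 2, …`; the values at `t = 0` are not used. The functions are only used on `X`. -/
structure Problem (n p : ℕ) where
  /-- the decision set -/
  X : Set (Vec p)
  /-- the numbers of local constraints -/
  m : Fin n → ℕ
  /-- the local losses `f_{i,t}` -/
  f : Fin n → ℕ → Vec p → ℝ
  /-- the local constraint functions `g_{i,t}` -/
  g : (i : Fin n) → ℕ → Vec p → Vec (m i)
  /-- the communication graphs; `(graph t).Adj j i` means that `i` receives from `j` -/
  graph : ℕ → Digraph (Fin n)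
  /-- the mixing matrices -/
  W : ℕ → Matrix (Fin n) (Fin n) ℝ

namespace Problem

variable {n p : ℕ}

/-- The global loss `f_t`. -/
def globalLoss (M : Problem n p) (t : ℕ) (x : Vec p) : ℝ :=
  (1 / (n : ℝ)) * ∑ j, M.f j t x

/-- The gradient of the global loss, relative to the decision set. -/
def gradLoss (M : Problem n p) (t : ℕ) (x : Vec p) : Vec p :=
  gradientWithin (M.globalLoss t) M.X x

/-- The global constraint function `g_t = col(g_{1,t}, …, g_{n,t})`. -/
def globalConstraint (M : Problem n p) (t : ℕ) (x : Vec p) :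
    EuclideanSpace ℝ ((i : Fin n) × Fin (M.m i)) :=
  WithLp.toLp 2 (fun ik => M.g ik.1 t x ik.2)

/-- The feasible set `𝒳_T`. -/
def feasible (M : Problem n p) (T : ℕ) : Set (Vec p) :=
  {x | x ∈ M.X ∧ ∀ t ∈ Finset.Icc 1 T, ∀ ik, M.globalConstraint t x ik ≤ 0}

/-- The network regret of the decisions `x t i`. -/
def netReg (M : Problem n p) (T : ℕ) (x : ℕ → Fin n → Vec p) : ℝ :=
  (1 / (n : ℝ)) * ∑ i,
    ((∑ t ∈ Finset.Icc 1 T, inner ℝ (M.gradLoss t (x t i)) (x t i)) -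
      sInf ((fun y => inner ℝ (∑ t ∈ Finset.Icc 1 T, M.gradLoss t (x t i)) y) '' M.feasible T))

/-- The network cumulative constraint violation of the decisions `x t i`. -/
def netCCV (M : Problem n p) (T : ℕ) (x : ℕ → Fin n → Vec p) : ℝ :=
  (1 / (n : ℝ)) * ∑ i, ∑ t ∈ Finset.Icc 1 T, ‖posPart (M.globalConstraint t (x t i))‖

/-- The assumptions on the decision set, the functions, the graphs and the mixing matrices. -/
structure Standing (M : Problem n p) (c : Constants) : Prop where
  closed : IsClosed M.X
  convex : Convex ℝ M.X
  ball_subset : Metric.closedBall 0 c.r ⊆ M.X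
  subset_ball : M.X ⊆ Metric.closedBall 0 c.R
  feasible_nonempty : ∀ T, 1 ≤ T → (M.feasible T).Nonempty
  g_convex : ∀ i t, 1 ≤ t → ∀ k, ConvexOn ℝ M.X (fun x => M.g i t x k)
  f_bound : ∀ i t, 1 ≤ t → ∀ x ∈ M.X, |M.f i t x| ≤ c.F₁
  g_bound : ∀ i t, 1 ≤ t → ∀ x ∈ M.X, ‖M.g i t x‖ ≤ c.F₂
  f_diff : ∀ i t, 1 ≤ t → DifferentiableOn ℝ (M.f i t) M.X
  f_grad_bound : ∀ i t, 1 ≤ t → ∀ x ∈ M.X, ‖gradientWithin (M.f i t) M.X x‖ ≤ c.G₁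
  /-- `J` is a subgradient of `g_{i,t}` at `x`, componentwise, bounded in operator norm -/
  g_subgrad : ∀ i t, 1 ≤ t → ∀ x ∈ M.X, ∃ J : Vec p →L[ℝ] Vec (M.m i),
    ‖J‖ ≤ c.G₂ ∧ ∀ y ∈ M.X, ∀ k, M.g i t x k + J (y - x) k ≤ M.g i t y k
  f_grad_lipschitz : ∀ i t, 1 ≤ t → ∀ x ∈ M.X, ∀ y ∈ M.X,
    ‖gradientWithin (M.f i t) M.X x - gradientWithin (M.f i t) M.X y‖ ≤ c.L * ‖x - y‖
  weight_ge : ∀ t, 1 ≤ t → ∀ i j, ((M.graph t).Adj j i ∨ i = j) → c.w ≤ M.W t i j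
  weight_zero : ∀ t, 1 ≤ t → ∀ i j, ¬ ((M.graph t).Adj j i ∨ i = j) → M.W t i j = 0
  row_sum : ∀ t, 1 ≤ t → ∀ i, ∑ j, M.W t i j = 1
  col_sum : ∀ t, 1 ≤ t → ∀ j, ∑ i, M.W t i j = 1
  connected : ∀ t, 1 ≤ t → ∀ i j,
    Relation.ReflTransGen (fun a b => ∃ l < c.B, (M.graph (t + l)).Adj a b) i j

/-- Slater's condition with margin `ς`. -/
def Slater (M : Problem n p) (ς : ℝ) : Prop :=
  ∃ xs ∈ M.X, ∀ t, 1 ≤ t → ∀ ik, M.globalConstraint t xs ik ≤ -ς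

end Problem

/-- The one-point gradient estimator of a scalar function. -/
def onePointGrad {p : ℕ} (δ : ℝ) (f : Vec p → ℝ) (x u : Vec p) : Vec p :=
  ((p : ℝ) / δ * f (x + δ • u)) • u

/-- The one-point estimator of the (transposed) Jacobian of a vector-valued function, a `p × d`
matrix. -/
def onePointJac {p d : ℕ} (δ : ℝ) (g : Vec p → Vec d) (x u : Vec p) :
    Matrix (Fin p) (Fin d) ℝ :=
  ((p : ℝ) / δ) • Matrix.vecMulVec u (g (x + δ • u))

/-- A run of the compressed online primal-dual method with one-point bandit feedback, along one
realization `u` of the directions and `ζ` of the seeds of the compressor `Q`. -/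
structure IsRun {n p : ℕ} {Z : Type*} (M : Problem n p) (c : Constants) (S : Schedule)
    (Q : Vec p → Z → Vec p) (u : ℕ → Fin n → Vec p) (ζ : ℕ → Fin n → Z)
    (x z zhat a : ℕ → Fin n → Vec p) (v : ℕ → (i : Fin n) → Vec (M.m i)) : Prop where
  zhat_zero : ∀ j, zhat 0 j = 0
  z_one : ∀ i, z 1 i ∈ (1 - S.ξ 1) • M.X
  zhat_eq : ∀ t, 1 ≤ t → ∀ j, zhat t j =
    zhat (t - 1) j + S.s t • Q ((S.s t)⁻¹ • (z t j - zhat (t - 1) j)) (ζ t j)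
  x_eq : ∀ t, 1 ≤ t → ∀ i, x t i = ∑ j, M.W t i j • zhat t j
  v_eq : ∀ t, 1 ≤ t → ∀ i, v (t + 1) i =
    S.γ t • posPart (M.g i t (x t i + S.δ c.r t • u t i))
  a_eq : ∀ t, 1 ≤ t → ∀ i, a (t + 1) i =
    onePointGrad (S.δ c.r t) (M.f i t) (x t i) (u t i) +
      WithLp.toLp 2 ((onePointJac (S.δ c.r t) (M.g i t) (x t i) (u t i)).mulVec (v (t + 1) i))
  z_eq : ∀ t, 1 ≤ t → ∀ i,
    IsProj ((1 - S.ξ (t + 1)) • M.X) (x t i - S.α t • a (t + 1) i) (z (t + 1) i)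

/-- The randomness: independent uniform directions `u t i`, and fresh independent seeds `ζ t i`
of law `ν` for the uses of the compressor, independent of the directions. -/
structure Randomness {n p : ℕ} {Ω : Type*} [MeasurableSpace Ω] {Z : Type*} [MeasurableSpace Z]
    (P : Measure Ω) (ν : Measure Z) (u : ℕ → Fin n → Ω → Vec p) (ζ : ℕ → Fin n → Ω → Z) :
    Prop where
  law_u : ∀ t i, HasLaw (u t i) (uniformSphere p) P
  law_ζ : ∀ t i, HasLaw (ζ t i) ν P
  indep_u : iIndepFun (fun (k : ℕ × Fin n) => u k.1 k.2) P
  indep_ζ : iIndepFun (fun (k : ℕ × Fin n) => ζ k.1 k.2) P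
  indep : IndepFun (fun ω (k : ℕ × Fin n) => u k.1 k.2 ω) (fun ω (k : ℕ × Fin n) => ζ k.1 k.2 ω) P

/-- `Q` is a (possibly random, possibly biased) compressor on `Y` with mean square error at most
`C`; `ν` is the law of its internal randomness. -/
structure IsCompressor {p : ℕ} {Z : Type*} [MeasurableSpace Z] (ν : Measure Z)
    (Q : Vec p → Z → Vec p) (Y : Set (Vec p)) (C : ℝ) : Prop where
  measurable : Measurable (fun yc : Vec p × Z => Q yc.1 yc.2)
  maps : ∀ y ∈ Y, ∀ c, Q y c ∈ Y
  error : ∀ y ∈ Y, ∫⁻ c, ENNReal.ofReal (‖Q y c - y‖ ^ 2) ∂ν ≤ ENNReal.ofReal C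

/-- The expectation of `metric M T`, along the runs of the method, is `O(T ^ e)`, for all problems
that satisfy the standing assumptions and `Extra`. The implied constant depends only on `n`, `p`,
`c` and `S` (and on `Extra`, `metric`, `e`). -/
def ExpectedRate {n p : ℕ} (c : Constants) (S : Schedule) (Extra : Problem n p → Prop)
    (metric : Problem n p → ℕ → (ℕ → Fin n → Vec p) → ℝ) (e : ℝ) : Prop :=
  ∃ K : ℝ, 0 < K ∧
    ∀ (M : Problem n p), M.Standing c → Extra M →
    ∀ (Ω : Type u) [MeasurableSpace Ω] (P : Measure Ω) [IsProbabilityMeasure P]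
      (Z : Type v) [MeasurableSpace Z] (ν : Measure Z) (Q : Vec p → Z → Vec p) (Y : Set (Vec p))
      (u : ℕ → Fin n → Ω → Vec p) (ζ : ℕ → Fin n → Ω → Z)
      (x z zhat a : Ω → ℕ → Fin n → Vec p) (v : Ω → ℕ → (i : Fin n) → Vec (M.m i)),
      IsCompressor ν Q Y c.C →
      Randomness P ν u ζ →
      (∀ ω, IsRun M c S Q (fun t i => u t i ω) (fun t i => ζ t i ω)
        (x ω) (z ω) (zhat ω) (a ω) (v ω)) →
      -- the method is well defined: functions are queried, and vectors compressed, where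
      -- the functions and the compressor are given
      (∀ t, 1 ≤ t → ∀ i, ∀ᵐ ω ∂P,
        x ω t i + S.δ c.r t • u t i ω ∈ M.X ∧
        (S.s t)⁻¹ • (z ω t i - zhat ω (t - 1) i) ∈ Y) →
      ∀ T : ℕ, 1 ≤ T →
        Integrable (fun ω => metric M T (x ω)) P ∧
        ∫ ω, metric M T (x ω) ∂P ≤ K * (T : ℝ) ^ e

end BanditOpt

end

/-!
The vector `a_{i,t+1}` followed by the method is the one-point gradient estimate of the *penalized
loss* `f_{i,t} + γ_t ‖[g_{i,t}]_+‖²` at `x_{i,t}` (`Problem.onePoint_eq`). So the method is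
projected stochastic gradient descent on these functions, run in parallel by agents that average
their compressed states. Four observations turn this into the bounds.

*The penalty.* The penalty is convex but not smooth. Averaged over the direction, the one-point
estimate gives the slope of the penalty smoothed over balls, and this slope towards a comparator
is bounded by difference quotients of the penalty over the exploration ball (`onePoint_slope_le`).
All that is needed of the divergence theorem is a one-sided first-order inequality on the sphere,
`sphere_integral_le`, obtained from Lipschitz cutoffs of the ball. Towards a shrunk feasible
comparator the penalty decreases at a rate of at least the squared violation, up to errors of
order `ξ_t` (`Problem.Standing.violSlope_le`); towards a shrunk Slater point it decreases at a
rate proportional to the violation itself (`Problem.Standing.violSlope_le_of_margin`). The loss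
contributes its gradient up to a bias of order `δ_t` (`abs_onePoint_sub_gradient_le`).

*The variance.* The squared estimate is of order `δ_t⁻²` times a constant plus `γ_t²` times the
squared violation. Since `2 p² F₂² α_t γ_t ≤ δ_t²` eventually, which in the borderline case is the
assumption on `α₀ γ₀`, the violation part of the squared step is at most the decrease of the
penalty (`Schedule.Admissible.exists_varianceBound`); only a term of order `α_t / δ_t²` remains.

*Disagreement and compression.* Joint connectivity makes the averaging contract over windows
(`exists_averagingBound`), so that the total disagreement is of the order of the total step length
plus the compression error, whose mean is of order `s_t` because the seeds of time `t` are
independent of the vectors they compress (`Execution.lintegral_compErr_sq_le`). This independence,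
and that of the directions, is tracked through `Depends`: everything computed before a draw is, up
to a null event, a measurable function of finitely many earlier draws. That the query points lie
in the decision set almost surely puts the whole exploration ball there
(`closedBall_subset_of_ae`).

*Telescoping.* The energy `∑ ‖z_{i,t} - (1 - ξ_t) y‖² + 4 n R² ξ_t` decreases by the linearized
gap (`IsRun.gap_step`), and dividing by the stepsizes and summing gives bounds
(`sum_le_of_energy`). For the violation the comparator is deterministic and the noise averages
out: the expected squared violations sum to `O(T^{1-θ₂})`, hence the violations to `O(T^{1-θ₂/2})`
(`Execution.integral_netCCV_le_ccvBound`), and under Slater's condition the violations themselves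
sum to `O(T^{1-θ₂})` (`Execution.integral_netCCV_le_slaterBound`). For the regret the best
comparator depends on the noise. The noise correlated with the comparator is controlled uniformly
by the norm of a martingale, `Execution.noiseSum`, whose second moment is at most `n` times the
sum of those of the estimates; its contribution is at most that of the squared steps, and the
penalty still pays for both (`Execution.integral_netReg_le`).
-/

noncomputable section

namespace BanditOpt

/-! ### A one-sided divergence theorem on the unit sphere -/

section SphereDivergence

open Filter Topology Metric Set

set_option linter.unusedSectionVars false

section Sphere

section Polar

variable {E : Type*} [NormedAddCommGroup E] [InnerProductSpace ℝ E] [FiniteDimensional ℝ E]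
  [MeasurableSpace E] [BorelSpace E] [Nontrivial E]

/-- Integration in polar coordinates. -/
theorem integral_polar (f : E → ℝ) :
    ∫ x, f x = ∫ q : sphere (0 : E) 1 × Ioi (0 : ℝ), f ((q.2 : ℝ) • (q.1 : E))
      ∂((volume : Measure E).toSphere.prod (Measure.volumeIoiPow (Module.finrank ℝ E - 1))) := by
  have h := (volume : Measure E).measurePreserving_homeomorphUnitSphereProd.integral_comp
      (Homeomorph.measurableEmbedding _)
      (fun q : sphere (0 : E) 1 × Ioi (0 : ℝ) => f ((q.2 : ℝ) • (q.1 : E)))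
  rw [← h]
  calc ∫ x, f x = ∫ x in ({(0 : E)}ᶜ : Set E), f x := by rw [restrict_compl_singleton]
    _ = ∫ x : ({(0 : E)}ᶜ : Set E), f x.1 ∂((volume : Measure E).comap (↑)) :=
      (integral_subtype_comap (measurableSet_singleton _).compl f).symm
    _ = _ := by
      congr 1 with x
      congr 1
      have hx : ‖(x : E)‖ ≠ 0 := norm_ne_zero_iff.2 x.2
      simp [homeomorphUnitSphereProd, smul_smul, hx]

theorem integral_volumeIoiPow (m : ℕ) (f : ℝ → ℝ) :
    ∫ r : Ioi (0 : ℝ), f r ∂(Measure.volumeIoiPow m) = ∫ r in Ioi (0 : ℝ), r ^ m * f r := by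
  simp only [Measure.volumeIoiPow, ENNReal.ofReal]
  rw [integral_withDensity_eq_integral_smul,
    integral_subtype_comap measurableSet_Ioi fun a : ℝ ↦ Real.toNNReal (a ^ m) • f a,
    setIntegral_congr_fun measurableSet_Ioi fun x hx ↦ ?_]
  · simp [NNReal.smul_def, Real.coe_toNNReal _ (pow_nonneg (le_of_lt hx) _)]
  · exact (measurable_subtype_coe.pow_const _).real_toNNReal

end Polar

section Cutoff

variable {E : Type*} [NormedAddCommGroup E]

/-- The radial cutoff that equals `1` on the ball of radius `1 - ε` and `0` off the unit ball, and
is affine in the norm in between. -/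
def cutoff (ε : ℝ) (v : E) : ℝ := min 1 (max 0 ((1 - ‖v‖) / ε))

theorem cutoff_nonneg (ε : ℝ) (v : E) : 0 ≤ cutoff ε v := by simp [cutoff]

theorem cutoff_le_one (ε : ℝ) (v : E) : cutoff ε v ≤ 1 := by simp [cutoff]

theorem cutoff_eq_zero {ε : ℝ} (hε : 0 < ε) {v : E} (hv : 1 ≤ ‖v‖) : cutoff ε v = 0 := by
  have : (1 - ‖v‖) / ε ≤ 0 := div_nonpos_of_nonpos_of_nonneg (by linarith) hε.le
  simp [cutoff, this]

theorem cutoff_eq_one {ε : ℝ} (hε : 0 < ε) {v : E} (hv : ‖v‖ ≤ 1 - ε) : cutoff ε v = 1 := by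
  have : 1 ≤ (1 - ‖v‖) / ε := by rw [le_div_iff₀ hε]; linarith
  simp [cutoff, this]

theorem cutoff_eq_div {ε : ℝ} (hε : 0 < ε) {v : E} (h1 : 1 - ε ≤ ‖v‖) (h2 : ‖v‖ ≤ 1) :
    cutoff ε v = (1 - ‖v‖) / ε := by
  have h3 : (1 - ‖v‖) / ε ≤ 1 := by rw [div_le_iff₀ hε]; linarith
  have h4 : 0 ≤ (1 - ‖v‖) / ε := div_nonneg (by linarith) hε.le
  simp [cutoff, h3, h4]

theorem lipschitzWith_cutoff {ε : ℝ} (hε : 0 < ε) :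
    LipschitzWith (Real.toNNReal ε⁻¹) (cutoff ε : E → ℝ) := by
  have h : LipschitzWith (Real.toNNReal ε⁻¹) (fun v : E => (1 - ‖v‖) / ε) := by
    refine LipschitzWith.of_dist_le_mul fun x y => ?_
    rw [Real.coe_toNNReal _ (inv_nonneg.2 hε.le), Real.dist_eq, ← sub_div, abs_div, abs_of_pos hε,
      div_eq_inv_mul]
    gcongr
    rw [show 1 - ‖x‖ - (1 - ‖y‖) = ‖y‖ - ‖x‖ by ring, dist_comm, dist_eq_norm]
    exact abs_norm_sub_norm_le y x
  exact (h.const_max 0).const_min 1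

end Cutoff

variable {E : Type*} [NormedAddCommGroup E] [InnerProductSpace ℝ E] [FiniteDimensional ℝ E]

theorem hasCompactSupport_cutoff {ε : ℝ} (hε : 0 < ε) :
    HasCompactSupport (cutoff ε : E → ℝ) := by
  refine HasCompactSupport.intro (isCompact_closedBall (0 : E) 1) fun x hx => ?_
  refine cutoff_eq_zero hε ?_
  simp only [mem_closedBall, dist_zero_right, not_le] at hx
  exact hx.le

variable [MeasurableSpace E] [BorelSpace E] [Nontrivial E]

/-- The derivative of the cutoff against `d` is the outward radial component of `d`, concentrated
on the shell. It is stated almost everywhere, as the cutoff has kinks on the two bounding spheres.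
-/
theorem lineDeriv_cutoff {ε : ℝ} (hε : 0 < ε) (hε1 : ε < 1) (d : E) :
    ∀ᵐ w : E, lineDeriv ℝ (cutoff ε) w (-d) =
      (ball (0 : E) 1 \ closedBall 0 (1 - ε)).indicator
        (fun w => ε⁻¹ * (inner ℝ w d / ‖w‖)) w := by
  have hs : ∀ r : ℝ, r ≠ 0 → ∀ᵐ w : E, ‖w‖ ≠ r := by
    intro r hr
    have := Measure.addHaar_sphere_of_ne_zero (volume : Measure E) (0 : E) hr
    rw [measure_eq_zero_iff_ae_notMem] at this
    filter_upwards [this] with w hw h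
    exact hw (by simp [h])
  filter_upwards [hs 1 one_ne_zero, hs (1 - ε) (by linarith)] with w h1 h2
  rcases lt_or_gt_of_ne h1 with h1 | h1
  · rcases lt_or_gt_of_ne h2 with h2 | h2
    · rw [indicator_of_notMem (by simp [h2.le])]
      have : (cutoff ε : E → ℝ) =ᶠ[𝓝 w] fun _ => 1 := by
        filter_upwards [continuous_norm.continuousAt.eventually_lt continuousAt_const h2] with y hy
        exact cutoff_eq_one hε hy.le
      rw [this.lineDeriv_eq]
      simp [lineDeriv]
    · rw [indicator_of_mem (by simp [h1, h2])]
      have hw : w ≠ 0 := by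
        rintro rfl
        rw [norm_zero] at h2
        linarith
      have : (cutoff ε : E → ℝ) =ᶠ[𝓝 w] fun y => (1 - ‖y‖) / ε := by
        filter_upwards [continuous_norm.continuousAt.eventually_lt continuousAt_const h1,
          continuousAt_const.eventually_lt continuous_norm.continuousAt h2] with y hy hy'
        exact cutoff_eq_div hε hy'.le hy.le
      rw [this.lineDeriv_eq, lineDeriv]
      have hd : HasDerivAt (fun t : ℝ => w + t • (-d)) (-d) 0 := by
        simpa using ((hasDerivAt_id (0 : ℝ)).smul_const (-d)).const_add w
      have hn := hd.norm_sq
      have hq := (hn.sqrt (by simpa using hw)).const_sub 1 |>.div_const ε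
      simp only [Real.sqrt_sq (norm_nonneg _)] at hq
      rw [hq.deriv]
      simp only [zero_smul, add_zero, inner_neg_right]
      field_simp
  · rw [indicator_of_notMem (by simp [h1.le])]
    have : (cutoff ε : E → ℝ) =ᶠ[𝓝 w] fun _ => 0 := by
      filter_upwards [continuousAt_const.eventually_lt continuous_norm.continuousAt h1] with y hy
      exact cutoff_eq_zero hε hy.le
    rw [this.lineDeriv_eq]
    simp [lineDeriv]

/-- The weak form of the divergence theorem for the cutoffs of the unit ball, combined with
convexity of `k` along the segments from `v` to `v + d`. -/
theorem shell_integral_le {k : E → ℝ} {K : NNReal} (hk : LipschitzWith K k) {d : E}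
    (hconv : ∀ v ∈ ball (0 : E) 1, ∀ s ∈ Ioc (0 : ℝ) 1,
      k (v + s • d) - k v ≤ s * (k (v + d) - k v)) {ε : ℝ} (hε : 0 < ε) (hε1 : ε < 1) :
    ∫ w in ball (0 : E) 1 \ closedBall 0 (1 - ε), ε⁻¹ * (inner ℝ w d / ‖w‖) * k w ≤
      ∫ v, cutoff ε v * (k (v + d) - k v) := by
  have hkc := hk.continuous
  have hφ := (lipschitzWith_cutoff (E := E) hε).continuous
  have hφs := hasCompactSupport_cutoff (E := E) hε
  have hlim :=
    (lipschitzWith_cutoff (E := E) hε).integral_inv_smul_sub_mul_tendsto_integral_lineDeriv_mul' hφs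
    hkc (-d) (μ := volume)
  have hL : ∫ w, lineDeriv ℝ (cutoff ε) w (-d) * k w =
      ∫ w in ball (0 : E) 1 \ closedBall 0 (1 - ε), ε⁻¹ * (inner ℝ w d / ‖w‖) * k w := by
    rw [← integral_indicator (measurableSet_ball.diff measurableSet_closedBall)]
    refine integral_congr_ae ?_
    filter_upwards [lineDeriv_cutoff hε hε1 d] with w hw
    rw [hw]
    by_cases h : w ∈ ball (0 : E) 1 \ closedBall 0 (1 - ε) <;> simp [h]
  rw [← hL]
  refine le_of_tendsto hlim ?_
  filter_upwards [Ioc_mem_nhdsGT (zero_lt_one' ℝ)] with s hs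
  have int1 : Integrable fun v : E => cutoff ε v * k (v + s • d) :=
    (hφ.mul (by fun_prop)).integrable_of_hasCompactSupport hφs.mul_right
  have int2 : Integrable fun v : E => cutoff ε v * k v :=
    (hφ.mul (by fun_prop)).integrable_of_hasCompactSupport hφs.mul_right
  have hshift : ∫ w, cutoff ε (w + s • (-d)) * k w = ∫ v, cutoff ε v * k (v + s • d) := by
    rw [← integral_add_right_eq_self _ (s • d)]
    congr 1 with v
    simp
  have int3 : Integrable fun w : E => cutoff ε (w + s • (-d)) * k w := by
    refine Continuous.integrable_of_hasCompactSupport (by fun_prop) ?_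
    exact (hφs.comp_homeomorph (Homeomorph.addRight (s • (-d)))).mul_right
  calc ∫ w, s⁻¹ • (cutoff ε (w + s • (-d)) - cutoff ε w) * k w
      = s⁻¹ * ((∫ w, cutoff ε (w + s • (-d)) * k w) - ∫ w, cutoff ε w * k w) := by
        rw [← integral_sub int3 int2, ← integral_const_mul]
        congr 1 with w
        simp only [smul_eq_mul]
        ring
    _ = ∫ v, s⁻¹ * (cutoff ε v * k (v + s • d) - cutoff ε v * k v) := by
        rw [hshift, ← integral_sub int1 int2, ← integral_const_mul]
    _ ≤ ∫ v, cutoff ε v * (k (v + d) - k v) := by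
        refine integral_mono ((int1.sub int2).const_mul _) ?_ fun v => ?_
        · exact (hφ.mul (by fun_prop)).integrable_of_hasCompactSupport hφs.mul_right
        · show s⁻¹ * (cutoff ε v * k (v + s • d) - cutoff ε v * k v) ≤
            cutoff ε v * (k (v + d) - k v)
          by_cases hv : ‖v‖ < 1
          · have := hconv v (by simpa using hv) s hs
            have h0 := hs.1
            rw [← mul_sub, mul_left_comm]
            refine mul_le_mul_of_nonneg_left ?_ (cutoff_nonneg _ _)
            rw [inv_mul_le_iff₀ hs.1]
            exact this
          · rw [cutoff_eq_zero hε (not_lt.1 hv)]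
            simp

/-- The one-dimensional mass of the polar shell, relative to its thickness. -/
theorem integral_shell_radius (m : ℕ) {ε : ℝ} (hε : 0 < ε) (hε1 : ε < 1) :
    ∫ r : Ioi (0 : ℝ), (Ioo (1 - ε) 1).indicator (fun _ => ε⁻¹) (r : ℝ)
      ∂(Measure.volumeIoiPow m) = ε⁻¹ * ((1 - (1 - ε) ^ (m + 1)) / (m + 1)) := by
  rw [integral_volumeIoiPow m ((Ioo (1 - ε) 1).indicator (fun _ => ε⁻¹))]
  have : ∀ r : ℝ, r ^ m * (Ioo (1 - ε) 1).indicator (fun _ => ε⁻¹) r =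
      (Ioo (1 - ε) 1).indicator (fun r => ε⁻¹ * r ^ m) r := by
    intro r
    by_cases h : r ∈ Ioo (1 - ε) 1 <;> simp [h, mul_comm]
  simp_rw [this]
  rw [setIntegral_indicator measurableSet_Ioo,
    inter_eq_self_of_subset_right (s := Ioi (0 : ℝ)) (t := Ioo (1 - ε) 1)
      (fun r hr => lt_trans (by linarith) hr.1),
    ← integral_Ioc_eq_integral_Ioo, ← intervalIntegral.integral_of_le (by linarith),
    intervalIntegral.integral_const_mul, integral_pow]
  simp

/-- In the limit of thin shells the radial mass is that of the unit sphere. -/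
theorem tendsto_shell_mass (m : ℕ) :
    Tendsto (fun ε : ℝ => ε⁻¹ * ((1 - (1 - ε) ^ (m + 1)) / (m + 1))) (𝓝[>] 0) (𝓝 1) := by
  have h : HasDerivAt (fun ε : ℝ => -((1 - ε) ^ (m + 1) / (m + 1))) 1 0 := by
    have h1 := (((hasDerivAt_id (0 : ℝ)).const_sub 1).pow (m + 1)).div_const ((m : ℝ) + 1)
    have h2 := h1.neg
    refine h2.congr_deriv ?_
    have : (m : ℝ) + 1 ≠ 0 := by positivity
    simp
    field_simp
    ring
  refine (h.tendsto_slope_zero_right).congr fun ε => ?_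
  simp only [zero_add, smul_eq_mul, sub_zero, one_pow]
  ring

theorem integrable_toSphere {f : sphere (0 : E) 1 → ℝ} (hf : Continuous f) :
    Integrable f (volume : Measure E).toSphere :=
  hf.integrable_of_hasCompactSupport (HasCompactSupport.of_compactSpace f)

/-- In polar coordinates the shell integral is the surface integral times the radial mass, up to
the oscillation of `k` along a ray, which is at most `K * ε`. -/
theorem shell_integral_ge {k : E → ℝ} {K : NNReal} (hk : LipschitzWith K k) (d : E)
    {ε : ℝ} (hε : 0 < ε) (hε1 : ε < 1) :
    ((∫ u : sphere (0 : E) 1, k u * inner ℝ (u : E) d ∂(volume : Measure E).toSphere) -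
      K * ε * ‖d‖ * (volume : Measure E).toSphere.real univ) *
      (ε⁻¹ * ((1 - (1 - ε) ^ ((Module.finrank ℝ E - 1) + 1)) /
        (((Module.finrank ℝ E - 1 : ℕ) : ℝ) + 1))) ≤
    ∫ w in ball (0 : E) 1 \ closedBall 0 (1 - ε), ε⁻¹ * (inner ℝ w d / ‖w‖) * k w := by
  have hkc := hk.continuous
  set σ := (volume : Measure E).toSphere
  set ρ := Measure.volumeIoiPow (Module.finrank ℝ E - 1)
  set χ : Ioi (0 : ℝ) → ℝ := fun r => (Ioo (1 - ε) 1).indicator (fun _ => ε⁻¹) (r : ℝ) with hχ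
  have hχm : Measurable χ :=
    (measurable_const.indicator measurableSet_Ioo).comp measurable_subtype_coe
  have hχ0 : ∀ r, 0 ≤ χ r := fun r => indicator_nonneg (fun _ _ => by positivity) _
  have hχi : Integrable χ ρ := by
    have hfin : ρ (Iio ⟨1, mem_Ioi.2 one_pos⟩) ≠ ⊤ := by
      simp [ρ, Measure.volumeIoiPow_apply_Iio]
    have : IntegrableOn (fun _ : Ioi (0 : ℝ) => ε⁻¹) (Iio ⟨1, mem_Ioi.2 one_pos⟩) ρ :=
      integrableOn_const hfin
    rw [← integrable_indicator_iff measurableSet_Iio] at this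
    refine this.mono' hχm.aestronglyMeasurable (ae_of_all _ fun r => ?_)
    rw [Real.norm_of_nonneg (hχ0 r)]
    by_cases h : (r : ℝ) ∈ Ioo (1 - ε) 1
    · have h' : r ∈ Iio (⟨1, mem_Ioi.2 one_pos⟩ : Ioi (0 : ℝ)) := h.2
      simp [χ, h, h']
    · simp only [χ, indicator_of_notMem h]
      exact indicator_nonneg (fun _ _ => by positivity) _
  have hcu : Continuous fun u : sphere (0 : E) 1 => k u * inner ℝ (u : E) d := by fun_prop
  have hint : Integrable (fun u : sphere (0 : E) 1 => k u * inner ℝ (u : E) d - K * ε * ‖d‖) σ :=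
    integrable_toSphere (by fun_prop)
  have hM : ∀ u : sphere (0 : E) 1, |inner ℝ (u : E) d| ≤ ‖d‖ := fun u => by
    simpa using abs_real_inner_le_norm (u : E) d
  rw [← integral_indicator (measurableSet_ball.diff measurableSet_closedBall), integral_polar]
  have hpt : ∀ q : sphere (0 : E) 1 × Ioi (0 : ℝ),
      (ball (0 : E) 1 \ closedBall 0 (1 - ε)).indicator
        (fun w => ε⁻¹ * (inner ℝ w d / ‖w‖) * k w) ((q.2 : ℝ) • (q.1 : E)) =
      (inner ℝ (q.1 : E) d * k ((q.2 : ℝ) • (q.1 : E))) * χ q.2 := by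
    rintro ⟨u, r⟩
    have hr : (0 : ℝ) < r := r.2
    have hn : ‖(r : ℝ) • (u : E)‖ = r := by simp [norm_smul, abs_of_pos hr]
    by_cases h : (r : ℝ) ∈ Ioo (1 - ε) 1
    · rw [indicator_of_mem (by simpa [hn] using ⟨h.2, h.1⟩), hn]
      simp only [χ, indicator_of_mem h, inner_smul_left]
      simp
      field_simp
    · rw [indicator_of_notMem]
      · simp [χ, indicator_of_notMem h]
      · intro h'
        apply h
        simp only [Set.mem_sdiff, mem_ball, mem_closedBall, dist_zero_right, hn, not_le] at h'
        exact ⟨h'.2, h'.1⟩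
  simp_rw [hpt]
  have hlow : ((∫ u : sphere (0 : E) 1, k u * inner ℝ (u : E) d ∂σ) -
      K * ε * ‖d‖ * σ.real univ) * (∫ r, χ r ∂ρ) =
      ∫ q : sphere (0 : E) 1 × Ioi (0 : ℝ),
        (k q.1 * inner ℝ (q.1 : E) d - K * ε * ‖d‖) * χ q.2 ∂(σ.prod ρ) := by
    rw [integral_prod_mul (fun u : sphere (0 : E) 1 => k u * inner ℝ (u : E) d - K * ε * ‖d‖) χ,
      integral_sub (integrable_toSphere hcu) (integrable_const _),
      integral_const, smul_eq_mul, mul_comm (σ.real univ)]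
  rw [← integral_shell_radius _ hε hε1, hlow]
  obtain ⟨D, hD⟩ := (isCompact_closedBall (0 : E) 1).exists_bound_of_continuousOn hkc.continuousOn
  refine integral_mono (hint.mul_prod hχi) ?_ ?_
  · have hbd : Integrable (fun q : sphere (0 : E) 1 × Ioi (0 : ℝ) => (‖d‖ * D) * χ q.2)
        (σ.prod ρ) := (integrable_const (‖d‖ * D)).mul_prod hχi
    refine hbd.mono' ?_ (ae_of_all _ fun q => ?_)
    · refine Measurable.aestronglyMeasurable ?_
      refine Measurable.mul ?_ (hχm.comp measurable_snd)
      exact Continuous.measurable (by fun_prop)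
    · by_cases h : (q.2 : ℝ) ∈ Ioo (1 - ε) 1
      · rw [norm_mul, Real.norm_of_nonneg (hχ0 q.2)]
        refine mul_le_mul_of_nonneg_right ?_ (hχ0 _)
        rw [norm_mul]
        have hq : (0 : ℝ) < q.2 := q.2.2
        refine mul_le_mul (hM _) (hD _ ?_) (norm_nonneg _) (norm_nonneg _)
        simpa [norm_smul, abs_of_pos hq] using h.2.le
      · simp [χ, indicator_of_notMem h]
  · intro q
    by_cases h : (q.2 : ℝ) ∈ Ioo (1 - ε) 1
    · refine mul_le_mul_of_nonneg_right ?_ (hχ0 _)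
      have h1 : |k q.1 - k ((q.2 : ℝ) • (q.1 : E))| ≤ K * ε := by
        refine (hk.dist_le_mul _ _).trans ?_
        gcongr
        rw [dist_eq_norm, show (q.1 : E) - (q.2 : ℝ) • (q.1 : E) = (1 - (q.2 : ℝ)) • (q.1 : E) by
          rw [sub_smul, one_smul], norm_smul]
        simp only [norm_eq_of_mem_sphere, mul_one, Real.norm_eq_abs]
        rw [abs_of_pos (by linarith [h.2])]
        linarith [h.1]
      have h2 : |(k q.1 - k ((q.2 : ℝ) • (q.1 : E))) * inner ℝ (q.1 : E) d| ≤ K * ε * ‖d‖ := by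
        rw [abs_mul]
        exact mul_le_mul h1 (hM _) (abs_nonneg _) (by positivity)
      have := (abs_le.1 h2).2
      simp only
      linarith [this, sub_mul (k q.1) (k ((q.2 : ℝ) • (q.1 : E))) (inner ℝ (q.1 : E) d),
        mul_comm (k ((q.2 : ℝ) • (q.1 : E))) (inner ℝ (q.1 : E) d)]
    · simp [χ, indicator_of_notMem h]

/-- The first-order inequality that replaces the divergence theorem: the flux of `k • d` through
the unit sphere is at most the increment of the ball integral of `k` under translation by `d`, when
`k` is convex along the segments that are swept. -/
theorem sphere_integral_le {k : E → ℝ} {K : NNReal} (hk : LipschitzWith K k) {d : E}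
    (hconv : ∀ v ∈ ball (0 : E) 1, ∀ s ∈ Ioc (0 : ℝ) 1,
      k (v + s • d) - k v ≤ s * (k (v + d) - k v)) :
    ∫ u : sphere (0 : E) 1, k u * inner ℝ (u : E) d ∂(volume : Measure E).toSphere ≤
      ∫ v in ball (0 : E) 1, (k (v + d) - k v) := by
  have hkc := hk.continuous
  have hR : Tendsto (fun ε : ℝ => ∫ v, cutoff ε v * (k (v + d) - k v)) (𝓝[>] 0)
      (𝓝 (∫ v in ball (0 : E) 1, (k (v + d) - k v))) := by
    rw [← integral_indicator measurableSet_ball]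
    have hbd : Integrable ((closedBall (0 : E) 1).indicator fun v => |k (v + d) - k v|) := by
      rw [integrable_indicator_iff measurableSet_closedBall]
      exact ContinuousOn.integrableOn_compact (isCompact_closedBall _ _) (by fun_prop)
    refine tendsto_integral_filter_of_dominated_convergence _ ?_ ?_ hbd ?_
    · filter_upwards [self_mem_nhdsWithin] with ε hε
      have := (lipschitzWith_cutoff (E := E) hε).continuous
      exact Continuous.aestronglyMeasurable (by fun_prop)
    · filter_upwards [self_mem_nhdsWithin] with ε hε
      refine ae_of_all _ fun v => ?_
      by_cases hv : v ∈ closedBall (0 : E) 1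
      · rw [indicator_of_mem hv, norm_mul, Real.norm_of_nonneg (cutoff_nonneg _ _),
          Real.norm_eq_abs]
        exact mul_le_of_le_one_left (abs_nonneg _) (cutoff_le_one _ _)
      · simp only [mem_closedBall, dist_zero_right, not_le] at hv
        rw [cutoff_eq_zero hε hv.le]
        simp only [zero_mul, norm_zero]
        exact indicator_nonneg (fun _ _ => abs_nonneg _) _
    · refine ae_of_all _ fun v => ?_
      by_cases hv : v ∈ ball (0 : E) 1
      · rw [indicator_of_mem hv]
        refine tendsto_const_nhds.congr' ?_
        simp only [mem_ball, dist_zero_right] at hv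
        filter_upwards [Ioo_mem_nhdsGT (show (0 : ℝ) < 1 - ‖v‖ by linarith)] with ε hε
        rw [cutoff_eq_one hε.1 (by linarith [hε.2]), one_mul]
      · rw [indicator_of_notMem hv]
        refine tendsto_const_nhds.congr' ?_
        filter_upwards [self_mem_nhdsWithin] with ε hε
        rw [cutoff_eq_zero hε (by simpa using hv), zero_mul]
  have hL1 : Tendsto (fun ε : ℝ =>
      (∫ u : sphere (0 : E) 1, k u * inner ℝ (u : E) d ∂(volume : Measure E).toSphere) -
      K * ε * ‖d‖ * (volume : Measure E).toSphere.real univ) (𝓝[>] 0)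
      (𝓝 (∫ u : sphere (0 : E) 1, k u * inner ℝ (u : E) d ∂(volume : Measure E).toSphere)) := by
    refine Tendsto.mono_left ?_ nhdsWithin_le_nhds
    refine Continuous.tendsto' (by fun_prop) _ _ (by simp)
  have hL := hL1.mul (tendsto_shell_mass (Module.finrank ℝ E - 1))
  rw [mul_one] at hL
  refine le_of_tendsto_of_tendsto hL hR ?_
  filter_upwards [Ioo_mem_nhdsGT (zero_lt_one' ℝ)] with ε hε
  exact (shell_integral_ge hk d hε.1 hε.2).trans (shell_integral_le hk hconv hε.1 hε.2)

end Sphere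

end SphereDivergence

/-! ### One-point estimates under the uniform law on the sphere -/

section OnePoint

open Filter Topology Metric Set

section UniformSphere

variable {p : ℕ}

theorem measurableEmbedding_sphere_coe :
    MeasurableEmbedding (Subtype.val : sphere (0 : Vec p) 1 → Vec p) :=
  MeasurableEmbedding.subtype_coe isClosed_sphere.measurableSet

theorem toSphere_univ_ne_zero (hp : 0 < p) : (volume : Measure (Vec p)).toSphere univ ≠ 0 := by
  have : NeZero p := ⟨hp.ne'⟩
  exact Measure.measure_univ_ne_zero.2 (Measure.toSphere_ne_zero _)

theorem isProbabilityMeasure_uniformSphere (hp : 0 < p) :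
    IsProbabilityMeasure (uniformSphere p) := by
  constructor
  rw [uniformSphere, Measure.smul_apply, measurableEmbedding_sphere_coe.map_apply, preimage_univ,
    smul_eq_mul, ENNReal.inv_mul_cancel (toSphere_univ_ne_zero hp) (measure_ne_top _ _)]

theorem integral_uniformSphere (F : Vec p → ℝ) :
    ∫ u, F u ∂(uniformSphere p) = ((volume : Measure (Vec p)).toSphere.real univ)⁻¹ *
      ∫ u : sphere (0 : Vec p) 1, F u ∂(volume : Measure (Vec p)).toSphere := by
  rw [uniformSphere, integral_smul_measure, measurableEmbedding_sphere_coe.integral_map,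
    ENNReal.toReal_inv]
  rfl

theorem integrable_uniformSphere (hp : 0 < p) {F : Vec p → ℝ}
    (hF : ContinuousOn F (sphere 0 1)) : Integrable F (uniformSphere p) := by
  have : NeZero p := ⟨hp.ne'⟩
  refine Integrable.smul_measure ?_ (ENNReal.inv_ne_top.2 (toSphere_univ_ne_zero hp))
  rw [measurableEmbedding_sphere_coe.integrable_map_iff]
  exact integrable_toSphere (continuousOn_iff_continuous_domRestrict.1 hF)

theorem ae_uniformSphere_mem_sphere : ∀ᵐ u ∂(uniformSphere p), u ∈ sphere (0 : Vec p) 1 := by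
  refine Measure.ae_smul_measure ?_ _
  rw [measurableEmbedding_sphere_coe.ae_map_iff]
  exact ae_of_all _ fun u => u.2

/-- A closed set that contains almost every direction contains every direction, since the surface
measure charges all nonempty open subsets of the sphere. -/
theorem forall_sphere_of_ae {F : Set (Vec p)} (hF : IsClosed F)
    (h : ∀ᵐ u ∂(uniformSphere p), u ∈ F) {u : Vec p} (hu : u ∈ sphere (0 : Vec p) 1) :
    u ∈ F := by
  have h0 : ((volume : Measure (Vec p)).toSphere univ)⁻¹ ≠ 0 :=
    ENNReal.inv_ne_zero.2 (measure_ne_top _ _)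
  rw [uniformSphere, Measure.ae_ennreal_smul_measure_iff h0,
    measurableEmbedding_sphere_coe.ae_map_iff] at h
  have hF' : IsClosed ((↑) ⁻¹' F : Set (sphere (0 : Vec p) 1)) :=
    hF.preimage continuous_subtype_val
  have := (hF'.ae_eq_univ_iff_eq (μ := (volume : Measure (Vec p)).toSphere)).1
    (eventuallyEq_univ.2 h)
  exact (this ▸ mem_univ (⟨u, hu⟩ : sphere (0 : Vec p) 1) :
    (⟨u, hu⟩ : sphere (0 : Vec p) 1) ∈ ((↑) ⁻¹' F : Set (sphere (0 : Vec p) 1)))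

/-- If almost every query point `x + δ u` lies in a closed convex set, so does the whole ball. -/
theorem closedBall_subset_of_ae (hp : 0 < p) {X : Set (Vec p)} (hX : IsClosed X)
    (hc : Convex ℝ X) {x : Vec p} {δ : ℝ} (hδ : 0 < δ)
    (h : ∀ᵐ u ∂(uniformSphere p), x + δ • u ∈ X) : closedBall x δ ⊆ X := by
  have : NeZero p := ⟨hp.ne'⟩
  rw [← convexHull_sphere_eq_closedBall x hδ.le]
  refine convexHull_min (fun y hy => ?_) hc
  have hu : δ⁻¹ • (y - x) ∈ sphere (0 : Vec p) 1 := by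
    rw [mem_sphere, dist_eq_norm] at hy
    simp [norm_smul, hy, abs_of_pos hδ, hδ.ne']
  have := forall_sphere_of_ae (hX.preimage (f := fun u : Vec p => x + δ • u) (by fun_prop)) h hu
  simpa [smul_smul, hδ.ne'] using this

/-- One-point estimates of convex functions: `c` bounds the estimated slope in the direction
`y - x` as soon as it bounds the difference quotients of `H` in that direction over the ball of
radius `δ`. This is where the smoothing of `H` over balls enters. -/
theorem onePoint_slope_le (hp : 0 < p) {X : Set (Vec p)} {H : Vec p → ℝ} {K : NNReal}
    (hX : Convex ℝ X) (hL : LipschitzOnWith K H X) (hH : ConvexOn ℝ X H) {x y : Vec p} {δ t c : ℝ}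
    (hδ : 0 < δ) (hx : closedBall x δ ⊆ X) (hy : closedBall y δ ⊆ X) (ht : t ∈ Ioc (0 : ℝ) 1)
    (hc : ∀ v ∈ ball (0 : Vec p) 1,
      H ((1 - t) • (x + δ • v) + t • (y + δ • v)) - H (x + δ • v) ≤ t * c) :
    (p : ℝ) / δ * ∫ u, H (x + δ • u) * inner ℝ u (y - x) ∂(uniformSphere p) ≤ c := by
  have : NeZero p := ⟨hp.ne'⟩
  obtain ⟨G, hG, hGH⟩ := hL.extend_real
  set σ := (volume : Measure (Vec p)).toSphere
  have ht0 := ht.1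
  have hmem : ∀ z : Vec p, closedBall z δ ⊆ X → ∀ v ∈ closedBall (0 : Vec p) 1, z + δ • v ∈ X := by
    intro z hz v hv
    refine hz ?_
    simp only [mem_closedBall, dist_zero_right] at hv
    simp only [mem_closedBall, dist_self_add_left, norm_smul, Real.norm_eq_abs, abs_of_pos hδ]
    exact mul_le_of_le_one_right hδ.le hv
  set d : Vec p := (t / δ) • (y - x) with hd
  have hpt : ∀ (v : Vec p) (s : ℝ), x + δ • (v + s • d) =
      (1 - s * t) • (x + δ • v) + (s * t) • (y + δ • v) := by
    intro v s
    rw [hd, smul_add, smul_smul, smul_smul, show δ * s * (t / δ) = s * t by field_simp]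
    module
  have hk : LipschitzWith (K * Real.toNNReal δ) (fun v : Vec p => G (x + δ • v)) := by
    refine hG.comp (LipschitzWith.of_dist_le_mul fun a b => ?_)
    rw [dist_add_left, dist_smul₀, Real.norm_of_nonneg hδ.le, Real.coe_toNNReal _ hδ.le]
  have hconv : ∀ v ∈ ball (0 : Vec p) 1, ∀ s ∈ Ioc (0 : ℝ) 1,
      G (x + δ • (v + s • d)) - G (x + δ • v) ≤ s * (G (x + δ • (v + d)) - G (x + δ • v)) := by
    intro v hv s hs
    have hv' := ball_subset_closedBall hv
    have h1 := hmem x hx v hv'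
    have h2 : x + δ • (v + d) ∈ X := by
      have := hpt v 1
      rw [one_smul, one_mul] at this
      rw [this]
      exact hX h1 (hmem y hy v hv') (by linarith [ht.2]) ht0.le (by ring)
    have h3 : x + δ • (v + s • d) = (1 - s) • (x + δ • v) + s • (x + δ • (v + d)) := by module
    have h4 : x + δ • (v + s • d) ∈ X := by
      rw [h3]
      exact hX h1 h2 (by linarith [hs.2]) hs.1.le (by ring)
    rw [← hGH h1, ← hGH h2, ← hGH h4, h3]
    have := hH.2 h1 h2 (show 0 ≤ 1 - s by linarith [hs.2]) hs.1.le (by ring)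
    simp only [smul_eq_mul] at this
    linarith
  have key := sphere_integral_le hk hconv
  have hV : 0 < (volume : Measure (Vec p)).real (ball 0 1) :=
    ENNReal.toReal_pos (measure_ball_pos _ _ one_pos).ne' measure_ball_lt_top.ne
  have hR : ∫ v in ball (0 : Vec p) 1, (G (x + δ • (v + d)) - G (x + δ • v)) ≤
      (volume : Measure (Vec p)).real (ball 0 1) * (t * c) := by
    have hGc := hG.continuous
    calc _ ≤ ∫ v in ball (0 : Vec p) 1, t * c := by
          refine setIntegral_mono_on ?_ (integrableOn_const measure_ball_lt_top.ne)
            measurableSet_ball fun v hv => ?_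
          · refine IntegrableOn.mono_set ?_ ball_subset_closedBall
            exact ContinuousOn.integrableOn_compact (isCompact_closedBall _ _) (by fun_prop)
          · have hv' := ball_subset_closedBall hv
            have h1 := hmem x hx v hv'
            have e : x + δ • (v + d) = (1 - t) • (x + δ • v) + t • (y + δ • v) := by
              have := hpt v 1
              rwa [one_smul, one_mul] at this
            have h2 : (1 - t) • (x + δ • v) + t • (y + δ • v) ∈ X :=
              hX h1 (hmem y hy v hv') (by linarith [ht.2]) ht0.le (by ring)
            rw [e, ← hGH h1, ← hGH h2]
            exact hc v hv
      _ = _ := by simp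
  have hI : ∫ u : sphere (0 : Vec p) 1, G (x + δ • (u : Vec p)) * inner ℝ (u : Vec p) d ∂σ =
      t / δ * ∫ u : sphere (0 : Vec p) 1,
        H (x + δ • (u : Vec p)) * inner ℝ (u : Vec p) (y - x) ∂σ := by
    rw [← integral_const_mul]
    congr 1 with u
    rw [← hGH (hmem x hx u (sphere_subset_closedBall u.2)), hd, inner_smul_right]
    ring
  rw [integral_uniformSphere]
  rw [hI] at key
  have hσ : σ.real univ = p * (volume : Measure (Vec p)).real (ball 0 1) := by
    simp [σ]
  rw [hσ]
  have hp' : (0 : ℝ) < p := by exact_mod_cast hp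
  have h3 := key.trans hR
  rw [← mul_le_mul_iff_right₀ ht0, ← mul_le_mul_iff_right₀ hV]
  refine le_of_eq_of_le ?_ h3
  field_simp
  rfl

/-- Constants have the one-point slope `0`: apply `onePoint_slope_le` to a constant and to its
negative. -/
theorem integral_inner_uniformSphere (hp : 0 < p) (b : Vec p) :
    ∫ u, inner ℝ u b ∂(uniformSphere p) = 0 := by
  have hp' : (0 : ℝ) < p := by exact_mod_cast hp
  have h : ∀ e : ℝ, e * ∫ u, inner ℝ u b ∂(uniformSphere p) ≤ 0 := by
    intro e
    have := onePoint_slope_le (H := fun _ => e) (K := 0) (c := 0) (x := 0) (y := b) (δ := 1)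
      (t := 1) hp convex_univ (LipschitzWith.const e).lipschitzOnWith
      (convexOn_const e convex_univ) one_pos (subset_univ _) (subset_univ _) (by simp)
      (by simp)
    rw [integral_const_mul] at this
    simp only [div_one, sub_zero] at this
    exact nonpos_of_mul_nonpos_right this hp'
  linarith [h 1, h (-1)]

/-- The one-point estimate is exact on linear functions: apply `onePoint_slope_le` to a linear
function and to its negative. -/
theorem integral_inner_mul_inner_uniformSphere (hp : 0 < p) (a b : Vec p) :
    (p : ℝ) * ∫ u, inner ℝ a u * inner ℝ u b ∂(uniformSphere p) = inner ℝ a b := by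
  have h : ∀ e : Vec p, (p : ℝ) * ∫ u, inner ℝ e u * inner ℝ u b ∂(uniformSphere p) ≤
      inner ℝ e b := by
    intro e
    have := onePoint_slope_le (H := fun u => inner ℝ e u) (K := ‖innerSL ℝ e‖₊)
      (c := inner ℝ e b) (x := 0) (y := b) (δ := 1)
      (t := 1) hp convex_univ (innerSL ℝ e).lipschitz.lipschitzOnWith
      ((innerSL ℝ e).toLinearMap.convexOn convex_univ) one_pos (subset_univ _) (subset_univ _)
      (by simp) (by simp [inner_add_right])
    simpa using this
  refine le_antisymm (h a) ?_
  have := h (-a)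
  simp only [inner_neg_left, neg_mul, integral_neg, mul_neg] at this
  linarith

/-- The bias of the one-point gradient estimator of a function with Lipschitz gradient. -/
theorem abs_onePoint_sub_gradient_le (hp : 0 < p) {X : Set (Vec p)} {f : Vec p → ℝ} {L : ℝ}
    (hf : DifferentiableOn ℝ f X)
    (hL : ∀ x ∈ X, ∀ y ∈ X, ‖gradientWithin f X x - gradientWithin f X y‖ ≤ L * ‖x - y‖)
    (hL0 : 0 ≤ L) {x : Vec p} {δ : ℝ} (hδ : 0 < δ) (hx : closedBall x δ ⊆ X) (d : Vec p) :
    |(p : ℝ) / δ * (∫ u, f (x + δ • u) * inner ℝ u d ∂(uniformSphere p)) -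
      inner ℝ (gradientWithin f X x) d| ≤ p * L * δ * ‖d‖ := by
  have := isProbabilityMeasure_uniformSphere hp
  have hp' : (0 : ℝ) < p := by exact_mod_cast hp
  set g := gradientWithin f X x
  set Ψ : Vec p → ℝ := fun u => f (x + δ • u) - f x - δ * inner ℝ g u with hΨ
  have hmem : ∀ v ∈ sphere (0 : Vec p) 1, x + δ • v ∈ closedBall x δ := by
    intro v hv
    rw [mem_sphere_zero_iff_norm] at hv
    simp [norm_smul, hv, abs_of_pos hδ]
  have hΨb : ∀ u ∈ sphere (0 : Vec p) 1, |Ψ u| ≤ L * δ * δ := by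
    intro u hu
    have h1 : ∀ y ∈ closedBall x δ, HasFDerivWithinAt (fun y => f y - inner ℝ g y)
        (InnerProductSpace.toDual ℝ (Vec p) (gradientWithin f X y) -
          InnerProductSpace.toDual ℝ (Vec p) g) (closedBall x δ) y := by
      intro y hy
      have := ((hf y (hx hy)).hasGradientWithinAt.hasFDerivWithinAt).mono hx
      exact this.sub (InnerProductSpace.toDual ℝ (Vec p) g).hasFDerivWithinAt
    have h2 : ∀ y ∈ closedBall x δ, ‖InnerProductSpace.toDual ℝ (Vec p) (gradientWithin f X y) -
          InnerProductSpace.toDual ℝ (Vec p) g‖ ≤ L * δ := by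
      intro y hy
      rw [← map_sub, LinearIsometryEquiv.norm_map]
      refine (hL y (hx hy) x (hx (mem_closedBall_self hδ.le))).trans ?_
      gcongr
      rwa [← dist_eq_norm]
    have h3 := (convex_closedBall x δ).norm_image_sub_le_of_norm_hasFDerivWithin_le h1 h2
      (mem_closedBall_self hδ.le) (hmem u hu)
    have hn : ‖x + δ • u - x‖ = δ := by
      rw [mem_sphere_zero_iff_norm] at hu
      simp [norm_smul, hu, abs_of_pos hδ]
    rw [hn, Real.norm_eq_abs] at h3
    convert h3 using 2
    simp only [Ψ, inner_add_right, inner_smul_right]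
    ring
  have hfc : ContinuousOn (fun u : Vec p => f (x + δ • u)) (sphere 0 1) := by
    refine (hf.continuousOn.mono hx).comp (by fun_prop) hmem
  have hΨc : ContinuousOn Ψ (sphere 0 1) :=
    (hfc.sub continuousOn_const).sub (by fun_prop)
  have i1 : Integrable (fun u => Ψ u * inner ℝ u d) (uniformSphere p) :=
    integrable_uniformSphere hp (by fun_prop)
  have i2 : Integrable (fun u => f x * inner ℝ u d) (uniformSphere p) :=
    integrable_uniformSphere hp (by fun_prop)
  have i3 : Integrable (fun u => δ * (inner ℝ g u * inner ℝ u d)) (uniformSphere p) :=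
    integrable_uniformSphere hp (by fun_prop)
  have e : ∫ u, f (x + δ • u) * inner ℝ u d ∂(uniformSphere p) =
      (∫ u, Ψ u * inner ℝ u d ∂(uniformSphere p)) + δ / p * inner ℝ g d := by
    have : ∀ u, f (x + δ • u) * inner ℝ u d =
        Ψ u * inner ℝ u d + f x * inner ℝ u d + δ * (inner ℝ g u * inner ℝ u d) := by
      intro u
      simp only [Ψ]
      ring
    simp_rw [this]
    rw [integral_add (f := fun u => Ψ u * inner ℝ u d + f x * inner ℝ u d) (i1.add i2) i3,
      integral_add i1 i2, integral_const_mul, integral_const_mul,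
      integral_inner_uniformSphere hp, ← integral_inner_mul_inner_uniformSphere hp g d]
    field_simp
    ring
  have hb : |∫ u, Ψ u * inner ℝ u d ∂(uniformSphere p)| ≤ L * δ * δ * ‖d‖ := by
    rw [← Real.norm_eq_abs]
    refine (norm_integral_le_of_norm_le_const (C := L * δ * δ * ‖d‖) ?_).trans (by simp)
    filter_upwards [ae_uniformSphere_mem_sphere] with u hu
    rw [norm_mul, Real.norm_eq_abs]
    refine mul_le_mul (hΨb u hu) ?_ (norm_nonneg _) (by positivity)
    refine (norm_inner_le_norm u d).trans ?_
    rw [mem_sphere_zero_iff_norm] at hu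
    simp [hu]
  rw [e, mul_add, show (p : ℝ) / δ * (δ / p * inner ℝ g d) = inner ℝ g d by field_simp,
    add_sub_cancel_right, abs_mul, abs_of_pos (by positivity)]
  calc (p : ℝ) / δ * |∫ u, Ψ u * inner ℝ u d ∂(uniformSphere p)|
      ≤ (p : ℝ) / δ * (L * δ * δ * ‖d‖) := by gcongr
    _ = _ := by field_simp

end UniformSphere

end OnePoint

/-! ### Averaging over jointly connected graphs -/

section Averaging

open Finset

section Mixing

variable {n : ℕ} {E : Type*} [NormedAddCommGroup E] [NormedSpace ℝ E]

/-- The action of a matrix on families of vectors. -/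
def mix (A : Matrix (Fin n) (Fin n) ℝ) (x : Fin n → E) : Fin n → E := fun i => ∑ j, A i j • x j

/-- The mean of a family of vectors. -/
def mean (x : Fin n → E) : E := (n : ℝ)⁻¹ • ∑ j, x j

/-- The total deviation of a family of vectors from its mean. -/
def dev (x : Fin n → E) : ℝ := ∑ i, ‖x i - mean x‖

theorem dev_nonneg (x : Fin n → E) : 0 ≤ dev x := sum_nonneg fun _ _ => norm_nonneg _

theorem sum_sub_mean (x : Fin n → E) : ∑ i, (x i - mean x) = 0 := by
  rcases Nat.eq_zero_or_pos n with rfl | hn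
  · simp
  · have : (n : ℝ) ≠ 0 := by positivity
    simp [mean, sum_sub_distrib, ← Nat.cast_smul_eq_nsmul ℝ, smul_smul, this]

theorem mix_mul (A A' : Matrix (Fin n) (Fin n) ℝ) (x : Fin n → E) :
    mix (A * A') x = mix A (mix A' x) := by
  funext i
  simp only [mix, Matrix.mul_apply, sum_smul, smul_sum, smul_smul]
  exact sum_comm

theorem mix_add (A : Matrix (Fin n) (Fin n) ℝ) (x y : Fin n → E) :
    mix A (fun i => x i + y i) = fun i => mix A x i + mix A y i := by
  funext i
  simp [mix, smul_add, sum_add_distrib]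

theorem mix_one (x : Fin n → E) : mix 1 x = x := by
  funext i
  simp [mix, Matrix.one_apply]

theorem sum_mix {A : Matrix (Fin n) (Fin n) ℝ} (hcol : ∀ j, ∑ i, A i j = 1) (x : Fin n → E) :
    ∑ i, mix A x i = ∑ j, x j := by
  simp only [mix]
  rw [sum_comm]
  simp [← sum_smul, hcol]

theorem sum_norm_mix_le {A : Matrix (Fin n) (Fin n) ℝ} (h0 : ∀ i j, 0 ≤ A i j)
    (hcol : ∀ j, ∑ i, A i j = 1) (x : Fin n → E) : ∑ i, ‖mix A x i‖ ≤ ∑ j, ‖x j‖ := by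
  calc ∑ i, ‖mix A x i‖ ≤ ∑ i, ∑ j, A i j * ‖x j‖ := by
        refine sum_le_sum fun i _ => (norm_sum_le _ _).trans (sum_le_sum fun j _ => ?_)
        rw [norm_smul, Real.norm_of_nonneg (h0 i j)]
    _ = _ := by
        rw [sum_comm]
        simp [← sum_mul, hcol]

/-- A doubly stochastic matrix with entries at least `η` contracts the deviation from the mean by
the factor `1 - n η`. -/
theorem dev_mix_le {A : Matrix (Fin n) (Fin n) ℝ} {η : ℝ} (h0 : ∀ i j, η ≤ A i j)
    (hrow : ∀ i, ∑ j, A i j = 1) (hcol : ∀ j, ∑ i, A i j = 1) (x : Fin n → E) :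
    dev (mix A x) ≤ (1 - n * η) * dev x := by
  have hmean : mean (mix A x) = mean x := by simp [mean, sum_mix hcol]
  have hi : ∀ i, mix A x i - mean (mix A x) = ∑ j, (A i j - η) • (x j - mean x) := by
    intro i
    simp_rw [sub_smul (A i _) η]
    rw [sum_sub_distrib, ← smul_sum, sum_sub_mean, smul_zero, sub_zero]
    simp only [smul_sub, sum_sub_distrib, ← sum_smul, hrow, one_smul, hmean]
    rfl
  calc dev (mix A x) ≤ ∑ i, ∑ j, (A i j - η) * ‖x j - mean x‖ := by
        refine sum_le_sum fun i _ => ?_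
        rw [hi]
        refine (norm_sum_le _ _).trans (sum_le_sum fun j _ => ?_)
        rw [norm_smul, Real.norm_of_nonneg (sub_nonneg.2 (h0 i j))]
    _ = _ := by
        rw [sum_comm]
        simp [← sum_mul, hcol, sum_sub_distrib, dev, mul_sum]

/-- The constant `2` covers both the perturbation and the shift of the mean. -/
theorem dev_add_le (x y : Fin n → E) : dev (fun i => x i + y i) ≤ dev x + 2 * ∑ i, ‖y i‖ := by
  have hmean : mean (fun i => x i + y i) = mean x + mean y := by
    simp [mean, sum_add_distrib]
  have hn : ∑ _i : Fin n, ‖mean y‖ ≤ ∑ i, ‖y i‖ := by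
    rcases Nat.eq_zero_or_pos n with rfl | hn
    · simp
    · have h : ‖mean y‖ ≤ (n : ℝ)⁻¹ * ∑ i, ‖y i‖ := by
        rw [mean, norm_smul, norm_inv, Real.norm_natCast]
        gcongr
        exact norm_sum_le _ _
      have : (0 : ℝ) < n := by positivity
      simp only [sum_const, card_univ, Fintype.card_fin, nsmul_eq_mul]
      calc (n : ℝ) * ‖mean y‖ ≤ n * ((n : ℝ)⁻¹ * ∑ i, ‖y i‖) := by gcongr
        _ = _ := by field_simp
  calc dev (fun i => x i + y i) ≤ ∑ i, (‖x i - mean x‖ + (‖y i‖ + ‖mean y‖)) := by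
        refine sum_le_sum fun i _ => ?_
        rw [hmean, show x i + y i - (mean x + mean y) = (x i - mean x) + (y i - mean y) by abel]
        exact (norm_add_le _ _).trans (by gcongr; exact norm_sub_le _ _)
    _ ≤ _ := by
        simp only [sum_add_distrib] at hn ⊢
        simp only [dev]
        linarith

/-- The product `W_{t+m-1} ⋯ W_t` of the matrices of a window of length `m`. -/
def windowProd (W : ℕ → Matrix (Fin n) (Fin n) ℝ) (t : ℕ) : ℕ → Matrix (Fin n) (Fin n) ℝ
  | 0 => 1
  | m + 1 => W (t + m) * windowProd W t m

/-- The assumptions on the graphs and the mixing matrices from time `1` on. -/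
structure MixingData (G : ℕ → Digraph (Fin n)) (W : ℕ → Matrix (Fin n) (Fin n) ℝ) (w : ℝ)
    (B : ℕ) : Prop where
  w_pos : 0 < w
  weight_ge : ∀ t, 1 ≤ t → ∀ i j, ((G t).Adj j i ∨ i = j) → w ≤ W t i j
  nonneg : ∀ t, 1 ≤ t → ∀ i j, 0 ≤ W t i j
  row_sum : ∀ t, 1 ≤ t → ∀ i, ∑ j, W t i j = 1
  col_sum : ∀ t, 1 ≤ t → ∀ j, ∑ i, W t i j = 1
  connected : ∀ t, 1 ≤ t → ∀ i j,
    Relation.ReflTransGen (fun a b => ∃ l < B, (G (t + l)).Adj a b) i j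

namespace MixingData

variable {G : ℕ → Digraph (Fin n)} {W : ℕ → Matrix (Fin n) (Fin n) ℝ} {w : ℝ} {B : ℕ}

theorem windowProd_nonneg (h : MixingData G W w B) {t : ℕ} (ht : 1 ≤ t) (m : ℕ) (i j : Fin n) :
    0 ≤ windowProd W t m i j := by
  induction m generalizing i with
  | zero => by_cases hij : i = j <;> simp [windowProd, Matrix.one_apply, hij]
  | succ m ih =>
    rw [windowProd, Matrix.mul_apply]
    exact sum_nonneg fun k _ => mul_nonneg (h.nonneg _ (by omega) _ _) (ih k)

theorem windowProd_row_sum (h : MixingData G W w B) {t : ℕ} (ht : 1 ≤ t) (m : ℕ) (i : Fin n) :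
    ∑ j, windowProd W t m i j = 1 := by
  induction m generalizing i with
  | zero => simp [windowProd, Matrix.one_apply]
  | succ m ih =>
    simp only [windowProd, Matrix.mul_apply]
    rw [sum_comm]
    simp [← mul_sum, ih, h.row_sum (t + m) (by omega)]

theorem windowProd_col_sum (h : MixingData G W w B) {t : ℕ} (ht : 1 ≤ t) (m : ℕ) (j : Fin n) :
    ∑ i, windowProd W t m i j = 1 := by
  induction m generalizing j with
  | zero => simp [windowProd, Matrix.one_apply]
  | succ m ih =>
    simp only [windowProd, Matrix.mul_apply]
    rw [sum_comm]
    simp [← sum_mul, ih, h.col_sum (t + m) (by omega)]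

/-- A lower bound on the weight of `j` at `k` passes to the agents that hear `k`. -/
theorem windowProd_step (h : MixingData G W w B) {t : ℕ} (ht : 1 ≤ t) {m : ℕ} {i k j : Fin n}
    (hik : (G (t + m)).Adj k i ∨ i = k) (hk : w ^ m ≤ windowProd W t m k j) :
    w ^ (m + 1) ≤ windowProd W t (m + 1) i j := by
  have hw := h.w_pos
  rw [windowProd, Matrix.mul_apply, pow_succ']
  refine le_trans ?_ (single_le_sum (f := fun k => W (t + m) i k * windowProd W t m k j)
    (fun l _ => mul_nonneg (h.nonneg _ (by omega) _ _) (h.windowProd_nonneg ht _ _ _))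
    (mem_univ k))
  exact mul_le_mul (h.weight_ge _ (by omega) _ _ hik) hk (by positivity)
    (h.nonneg _ (by omega) _ _)

/-- Lower bounds on weights persist, as every agent keeps a share of at least `w` of its own value.
-/
theorem windowProd_mono (h : MixingData G W w B) {t : ℕ} (ht : 1 ≤ t) {m : ℕ} {i j : Fin n}
    (hi : w ^ m ≤ windowProd W t m i j) (l : ℕ) :
    w ^ (m + l) ≤ windowProd W t (m + l) i j := by
  induction l with
  | zero => exact hi
  | succ l ih => exact h.windowProd_step ht (Or.inr rfl) ih

/-- The number of agents whose weight on `j` is bounded below grows with every window of joint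
strong connectivity, until it is `n`. -/
theorem card_reached (h : MixingData G W w B) {t : ℕ} (ht : 1 ≤ t) (j : Fin n) (q : ℕ) :
    min n (q + 1) ≤
      #{i | w ^ (q * B) ≤ windowProd W t (q * B) i j} := by
  classical
  induction q with
  | zero =>
    refine (min_le_right _ _).trans (card_pos.2 ⟨j, ?_⟩)
    simp [windowProd]
  | succ q ih =>
    set S : Finset (Fin n) := {i | w ^ (q * B) ≤ windowProd W t (q * B) i j} with hS
    set S' : Finset (Fin n) := {i | w ^ ((q + 1) * B) ≤ windowProd W t ((q + 1) * B) i j} with hS'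
    have hsub : S ⊆ S' := by
      intro i hi
      simp only [S, S', mem_filter, mem_univ, true_and] at hi ⊢
      rw [add_mul, one_mul]
      exact h.windowProd_mono ht hi B
    by_cases hall : S = univ
    · have : S' = univ := univ_subset_iff.1 (hall ▸ hsub)
      rw [this]
      simp
    · have hj : j ∈ S := by
        have : w ^ 0 ≤ windowProd W t 0 j j := by simp [windowProd]
        have := h.windowProd_mono ht this (q * B)
        rw [zero_add] at this
        simpa [S] using this
      have : ∃ a ∈ S, ∃ b, b ∉ S ∧ ∃ l < B, (G (t + q * B + l)).Adj a b := by
        by_contra hcon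
        push Not at hcon
        apply hall
        refine eq_univ_of_forall fun b => ?_
        have hr := h.connected (t + q * B) (by omega) j b
        induction hr with
        | refl => exact hj
        | tail _ hbc ih' =>
          obtain ⟨l, hl, hadj⟩ := hbc
          by_contra hnot
          exact hcon _ ih' _ hnot l hl hadj
      obtain ⟨a, ha, b, hb, l, hl, hadj⟩ := this
      have hb' : b ∈ S' := by
        simp only [S, S', mem_filter, mem_univ, true_and] at ha ⊢
        have h1 := h.windowProd_mono ht ha l
        have h2 : w ^ (q * B + l + 1) ≤ windowProd W t (q * B + l + 1) b j :=
          h.windowProd_step ht (Or.inl (by rw [← add_assoc]; exact hadj)) h1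
        have h3 := h.windowProd_mono ht h2 (B - (l + 1))
        rwa [show q * B + l + 1 + (B - (l + 1)) = (q + 1) * B by
          rw [add_mul, one_mul]; omega] at h3
      have hlt : #S < #S' := card_lt_card ⟨hsub, fun hh => hb (hh hb')⟩
      omega

/-- Over `n` windows of joint strong connectivity every agent hears every other one. -/
theorem windowProd_ge (h : MixingData G W w B) {t : ℕ} (ht : 1 ≤ t) (i j : Fin n) :
    w ^ (n * B) ≤ windowProd W t (n * B) i j := by
  have h1 := h.card_reached ht j n
  rw [min_eq_left (Nat.le_succ n)] at h1
  have h2 : ({i | w ^ (n * B) ≤ windowProd W t (n * B) i j} : Finset (Fin n)) = univ :=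
    eq_univ_of_card _ (le_antisymm (card_le_univ _) (by simpa using h1))
  have h3 := mem_univ i
  rw [← h2] at h3
  simpa using h3

end MixingData

theorem sum_range_shift_le {F : ℕ → ℝ} (hF : ∀ i, 0 ≤ F i) (k T : ℕ) :
    ∑ i ∈ range T, (if k ≤ i then F (i - k) else 0) ≤ ∑ i ∈ range T, F i := by
  have : ∑ i ∈ range T, (if k ≤ i then F (i - k) else 0) = ∑ i ∈ range (T - k), F i := by
    induction T with
    | zero => simp
    | succ T ih =>
      rw [sum_range_succ, ih]
      by_cases hk : k ≤ T
      · rw [if_pos hk, Nat.succ_sub hk, sum_range_succ]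
      · rw [if_neg hk, show T - k = 0 by omega, show T + 1 - k = 0 by omega]
        simp
  rw [this]
  exact sum_le_sum_of_subset_of_nonneg (range_mono (Nat.sub_le _ _)) fun i _ _ => hF i

/-- A sequence that contracts by `lam` over windows of length `m`, up to perturbations `P`, is
summable against the perturbations. -/
theorem sum_le_of_window_contraction {D P : ℕ → ℝ} {lam : ℝ} {m : ℕ} (hD : ∀ i, 0 ≤ D i)
    (hP : ∀ i, 0 ≤ P i) (h1 : ∀ i, D (i + 1) ≤ D i + 2 * P i)
    (hm : ∀ i, D (i + m) ≤ lam * D i + 2 * ∑ s ∈ range m, P (i + s)) (hlam : 0 ≤ lam) (T : ℕ) :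
    (1 - lam) * ∑ i ∈ range T, D i ≤ m * D 0 + 4 * m * ∑ i ∈ range T, P i := by
  set Q := ∑ i ∈ range T, P i with hQ
  have hQ0 : 0 ≤ Q := sum_nonneg fun i _ => hP i
  have hgrow : ∀ i, D i ≤ D 0 + 2 * ∑ s ∈ range i, P s := by
    intro i
    induction i with
    | zero => simp
    | succ i ih => rw [sum_range_succ]; linarith [h1 i]
  have hpt : ∀ i ∈ range T, D i ≤ (if i < m then D 0 + 2 * Q else 0) +
      lam * (if m ≤ i then D (i - m) else 0) +
      2 * ∑ s ∈ range m, (if m - s ≤ i then P (i - (m - s)) else 0) := by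
    intro i hi
    by_cases him : i < m
    · rw [if_pos him, if_neg (by omega)]
      have h2 : ∑ s ∈ range i, P s ≤ Q :=
        sum_le_sum_of_subset_of_nonneg (range_mono (mem_range.1 hi).le) fun i _ _ => hP i
      have h3 : 0 ≤ ∑ s ∈ range m, (if m - s ≤ i then P (i - (m - s)) else 0) :=
        sum_nonneg fun s _ => by split_ifs <;> simp [hP]
      linarith [hgrow i]
    · rw [if_neg him, if_pos (by omega)]
      have h2 := hm (i - m)
      rw [Nat.sub_add_cancel (by omega)] at h2
      refine h2.trans ?_
      rw [zero_add]
      gcongr with s hs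
      have := mem_range.1 hs
      rw [if_pos (by omega), show i - (m - s) = i - m + s by omega]
  have hsum := sum_le_sum hpt
  rw [sum_add_distrib, sum_add_distrib, ← mul_sum, ← mul_sum, sum_comm] at hsum
  have e1 : ∑ i ∈ range T, (if i < m then D 0 + 2 * Q else 0) ≤ m * (D 0 + 2 * Q) := by
    rw [← sum_filter, sum_const, nsmul_eq_mul]
    have hc : #((range T).filter (· < m)) ≤ m := by
      calc _ ≤ #(range m) := card_le_card fun i hi => by
            simp only [mem_filter] at hi
            exact mem_range.2 hi.2
        _ = m := card_range m
    have := hD 0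
    gcongr
  have e2 : lam * ∑ i ∈ range T, (if m ≤ i then D (i - m) else 0) ≤
      lam * ∑ i ∈ range T, D i := mul_le_mul_of_nonneg_left (sum_range_shift_le hD m T) hlam
  have e3 : ∑ s ∈ range m, ∑ i ∈ range T, (if m - s ≤ i then P (i - (m - s)) else 0) ≤ m * Q := by
    calc _ ≤ ∑ s ∈ range m, Q := sum_le_sum fun s _ => sum_range_shift_le hP (m - s) T
      _ = _ := by simp
  linarith

/-- `K` bounds the total deviation from the mean under perturbed averaging, relative to the total
perturbation. -/
structure AveragingBound (n : ℕ) (w : ℝ) (B : ℕ) (K : ℝ) : Prop where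
  pos : 0 < K
  sum_dev_le : ∀ (E : Type) [NormedAddCommGroup E] [NormedSpace ℝ E] (G : ℕ → Digraph (Fin n))
    (W : ℕ → Matrix (Fin n) (Fin n) ℝ), MixingData G W w B → ∀ (x π : ℕ → Fin n → E),
    (∀ t, 1 ≤ t → x (t + 1) = mix (W (t + 1)) (fun i => x t i + π t i)) → ∀ T,
    ∑ t ∈ Icc 1 T, dev (x t) ≤ K * (dev (x 1) + ∑ t ∈ Icc 1 T, ∑ i, ‖π t i‖)

/-- Over `n * B` steps the averaging contracts the deviation by the factor `1 - n * w ^ (n * B)`,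
so perturbations are forgotten geometrically. -/
theorem exists_averagingBound (n : ℕ) {w : ℝ} (hw : 0 < w) (B : ℕ) :
    ∃ K : ℝ, AveragingBound n w B K := by
  rcases Nat.eq_zero_or_pos n with rfl | hn
  · refine ⟨1, one_pos, fun E _ _ G W _ x π _ T => ?_⟩
    simp [dev]
  set m := n * B
  set η := w ^ m
  have hη : 0 < η := by positivity
  have hn' : (0 : ℝ) < n := by exact_mod_cast hn
  refine ⟨(4 * m + 1) / (n * η), by positivity, fun E _ _ G W h x π hrec T => ?_⟩
  have hstep0 : ∀ t, 1 ≤ t → dev (x (t + 1)) ≤ dev (x t) + 2 * ∑ i, ‖π t i‖ := by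
    intro t ht
    rw [hrec t ht]
    refine (dev_mix_le (η := 0) (h.nonneg _ (by omega)) (h.row_sum _ (by omega))
      (h.col_sum _ (by omega)) _).trans ?_
    rw [mul_zero, sub_zero, one_mul]
    exact dev_add_le _ _
  have hwin : ∀ t, 1 ≤ t → ∀ l, ∃ e : Fin n → E,
      x (t + l) = (fun i => mix (windowProd W (t + 1) l) (x t) i + e i) ∧
      ∑ i, ‖e i‖ ≤ ∑ s ∈ range l, ∑ i, ‖π (t + s) i‖ := by
    intro t ht l
    induction l with
    | zero => exact ⟨0, by simp [windowProd, mix_one], by simp⟩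
    | succ l ih =>
      obtain ⟨e, he, hle⟩ := ih
      refine ⟨mix (W (t + l + 1)) (fun i => e i + π (t + l) i), ?_, ?_⟩
      · rw [← add_assoc, hrec (t + l) (by omega), he]
        simp only [windowProd, mix_mul, mix_add, add_assoc]
        rw [show t + (1 + l) = t + (l + 1) by omega]
      · refine (sum_norm_mix_le (h.nonneg _ (by omega)) (h.col_sum _ (by omega)) _).trans ?_
        rw [sum_range_succ]
        refine (sum_le_sum fun i _ => norm_add_le _ _).trans ?_
        rw [sum_add_distrib]
        gcongr
  have hstepm : ∀ t, 1 ≤ t → dev (x (t + m)) ≤ (1 - n * η) * dev (x t) +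
      2 * ∑ s ∈ range m, ∑ i, ‖π (t + s) i‖ := by
    intro t ht
    obtain ⟨e, he, hle⟩ := hwin t ht m
    rw [he]
    refine (dev_add_le _ _).trans ?_
    gcongr
    exact dev_mix_le (h.windowProd_ge (by omega)) (h.windowProd_row_sum (by omega) _)
      (h.windowProd_col_sum (by omega) _) _
  have hlam : 0 ≤ 1 - n * η := by
    have h1 := h.windowProd_row_sum (t := 1) le_rfl m ⟨0, hn⟩
    have h2 := sum_le_sum fun (j : Fin n) (_ : j ∈ univ) =>
      h.windowProd_ge (t := 1) le_rfl ⟨0, hn⟩ j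
    rw [h1] at h2
    simpa [η] using h2
  have key := sum_le_of_window_contraction (D := fun i => dev (x (i + 1)))
    (P := fun i => ∑ j, ‖π (i + 1) j‖) (lam := 1 - n * η) (m := m)
    (fun i => dev_nonneg _) (fun i => sum_nonneg fun _ _ => norm_nonneg _)
    (fun i => hstep0 (i + 1) (by omega))
    (fun i => by
      have := hstepm (i + 1) (by omega)
      simpa only [add_right_comm] using this) hlam T
  have hIcc : ∀ F : ℕ → ℝ, ∑ t ∈ Icc 1 T, F t = ∑ i ∈ range T, F (i + 1) := by
    intro F
    rw [range_eq_Ico, sum_Ico_add' F 0 T 1]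
    rfl
  rw [hIcc, hIcc, div_mul_eq_mul_div, le_div_iff₀ (by positivity)]
  have hQ0 : 0 ≤ ∑ i ∈ range T, ∑ j, ‖π (i + 1) j‖ :=
    sum_nonneg fun _ _ => sum_nonneg fun _ _ => norm_nonneg _
  have hD0 := dev_nonneg (x 1)
  have hm0 : (0 : ℝ) ≤ m := by positivity
  simp only [sub_sub_cancel, zero_add] at key
  nlinarith [mul_nonneg hm0 hD0]

end Mixing

end Averaging

/-! ### Projections, independence and dependence on finitely many draws -/

section Probability

section Projection

variable {d : ℕ} {K : Set (Vec d)}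

theorem IsProj.inner_le (hK : Convex ℝ K) {x y : Vec d} (h : IsProj K x y) {w : Vec d}
    (hw : w ∈ K) : inner ℝ (x - y) (w - y) ≤ 0 := by
  refine (norm_eq_iInf_iff_real_inner_le_zero hK h.1).1 ?_ w hw
  have : Nonempty K := ⟨⟨y, h.1⟩⟩
  refine le_antisymm (le_ciInf fun w => h.2 w w.2) ?_
  exact ciInf_le (f := fun w : K => ‖x - w‖) ⟨0, by rintro _ ⟨w, rfl⟩; exact norm_nonneg _⟩
    ⟨y, h.1⟩

theorem IsProj.sq_norm_sub_le (hK : Convex ℝ K) {x y : Vec d} (h : IsProj K x y) {w : Vec d}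
    (hw : w ∈ K) : ‖y - w‖ ^ 2 ≤ ‖x - w‖ ^ 2 := by
  have h1 := h.inner_le hK hw
  have h2 : ‖x - w‖ ^ 2 = ‖x - y‖ ^ 2 - 2 * inner ℝ (x - y) (w - y) + ‖w - y‖ ^ 2 := by
    rw [← norm_sub_sq_real]
    congr 2
    abel
  rw [norm_sub_rev y w]
  nlinarith [sq_nonneg ‖x - y‖]

theorem IsProj.norm_sub_le (hK : Convex ℝ K) {x y : Vec d} (h : IsProj K x y) {w : Vec d}
    (hw : w ∈ K) : ‖y - w‖ ≤ ‖x - w‖ :=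
  (pow_le_pow_iff_left₀ (norm_nonneg _) (norm_nonneg _) two_ne_zero).1 (h.sq_norm_sub_le hK hw)

theorem IsProj.dist_le (hK : Convex ℝ K) {x y x' y' : Vec d} (h : IsProj K x y)
    (h' : IsProj K x' y') : ‖y - y'‖ ≤ ‖x - x'‖ := by
  have h1 := h.inner_le hK h'.1
  have h2 := h'.inner_le hK h.1
  have h3 : ‖y - y'‖ * ‖y - y'‖ ≤ ‖x - x'‖ * ‖y - y'‖ := by
    rw [← real_inner_self_eq_norm_mul_norm]
    refine le_trans ?_ (real_inner_le_norm (x - x') (y - y'))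
    simp only [inner_sub_left, inner_sub_right] at *
    linarith [real_inner_comm y y']
  by_contra hcon
  push Not at hcon
  have : 0 < ‖y - y'‖ := lt_of_le_of_lt (norm_nonneg _) hcon
  nlinarith

/-- The projection onto a closed convex nonempty set is given by a continuous map. -/
theorem exists_continuous_proj (hK : Convex ℝ K) (hc : IsClosed K) (hne : K.Nonempty) :
    ∃ π : Vec d → Vec d, Continuous π ∧ ∀ x y, IsProj K x y → y = π x := by
  have hex : ∀ x, ∃ y, IsProj K x y := by
    intro x
    obtain ⟨y, hy, hmin⟩ := exists_norm_eq_iInf_of_complete_convex hne hc.isComplete hK x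
    refine ⟨y, hy, fun w hw => ?_⟩
    rw [hmin]
    exact ciInf_le (f := fun w : K => ‖x - w‖) ⟨0, by rintro _ ⟨w, rfl⟩; exact norm_nonneg _⟩
      ⟨w, hw⟩
  choose π hπ using hex
  refine ⟨π, ?_, fun x y h => ?_⟩
  · refine (LipschitzWith.of_dist_le_mul (K := 1) fun x x' => ?_).continuous
    rw [dist_eq_norm, dist_eq_norm, NNReal.coe_one, one_mul]
    exact (hπ x).dist_le hK (hπ x')
  · have := h.dist_le hK (hπ x)
    rw [sub_self, norm_zero] at this
    exact sub_eq_zero.1 (norm_le_zero_iff.1 this)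

end Projection

section Independence

/-- If `A` and `B` are independent, and the pair is independent of `C`, then `B` is independent of
the pair of `A` and `C`. -/
theorem indepFun_rotate {Ω α β γ : Type*} [MeasurableSpace Ω] [MeasurableSpace α]
    [MeasurableSpace β] [MeasurableSpace γ] {P : Measure Ω} [IsProbabilityMeasure P]
    {A : Ω → α} {B : Ω → β} {C : Ω → γ} (hA : AEMeasurable A P) (hB : AEMeasurable B P)
    (hC : AEMeasurable C P) (h1 : IndepFun A B P)
    (h2 : IndepFun (fun ω => (A ω, B ω)) C P) : IndepFun (fun ω => (A ω, C ω)) B P := by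
  have := Measure.isProbabilityMeasure_map hA
  have := Measure.isProbabilityMeasure_map hB
  have := Measure.isProbabilityMeasure_map hC
  have hAC : IndepFun A C P := h2.comp measurable_fst measurable_id
  rw [indepFun_iff_map_prod_eq_prod_map_map hA hB] at h1
  rw [indepFun_iff_map_prod_eq_prod_map_map hA hC] at hAC
  rw [indepFun_iff_map_prod_eq_prod_map_map (hA.prodMk hB) hC, h1] at h2
  rw [indepFun_iff_map_prod_eq_prod_map_map (hA.prodMk hC) hB, hAC]
  have m1 := measurePreserving_prodAssoc (P.map A) (P.map B) (P.map C)
  have m2 := (MeasurePreserving.id (P.map A)).prod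
    (Measure.measurePreserving_swap (μ := P.map B) (ν := P.map C))
  have m3 := (measurePreserving_prodAssoc (P.map A) (P.map C) (P.map B)).symm
  have m := (m3.comp (m2.comp m1)).map_eq
  rw [← h2, AEMeasurable.map_map_of_aemeasurable
    (m3.measurable.comp (m2.measurable.comp m1.measurable)).aemeasurable
    ((hA.prodMk hB).prodMk hC)] at m
  exact m

section Freezing

variable {Ω α β : Type*} [MeasurableSpace Ω] [MeasurableSpace α] [MeasurableSpace β]
  {P : Measure Ω} [IsProbabilityMeasure P] {X : Ω → α} {U : Ω → β} {μ : Measure β}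

theorem map_prodMk_eq (hX : AEMeasurable X P) (hU : HasLaw U μ P) (h : IndepFun X U P) :
    P.map (fun ω => (X ω, U ω)) = (P.map X).prod μ := by
  rw [(indepFun_iff_map_prod_eq_prod_map_map hX hU.aemeasurable).1 h, hU.map_eq]

/-- Freezing: an almost sure property of the pair of `X` and an independent `U` holds, for almost
every value of `X`, almost surely in `U`. -/
theorem ae_ae_of_indep (hX : AEMeasurable X P) (hU : HasLaw U μ P) (h : IndepFun X U P)
    {s : Set (α × β)} (hs : MeasurableSet s) (hae : ∀ᵐ ω ∂P, (X ω, U ω) ∈ s) :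
    ∀ᵐ ω ∂P, ∀ᵐ b ∂μ, (X ω, b) ∈ s := by
  have : IsProbabilityMeasure μ := hU.isProbabilityMeasure_iff.1 inferInstance
  have h1 : ∀ᵐ q ∂((P.map X).prod μ), q ∈ s := by
    rw [← map_prodMk_eq hX hU h]
    exact (ae_map_iff (hX.prodMk hU.aemeasurable) (p := fun q => q ∈ s) hs).2 hae
  exact ae_of_ae_map hX (Measure.ae_ae_of_ae_prod h1)

theorem integral_indep (hX : AEMeasurable X P) (hU : HasLaw U μ P) (h : IndepFun X U P)
    {Ψ : α × β → ℝ} (hΨ : Measurable Ψ) (hi : Integrable (fun ω => Ψ (X ω, U ω)) P) :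
    ∫ ω, Ψ (X ω, U ω) ∂P = ∫ ω, ∫ b, Ψ (X ω, b) ∂μ ∂P := by
  have : IsProbabilityMeasure μ := hU.isProbabilityMeasure_iff.1 inferInstance
  have := Measure.isProbabilityMeasure_map hX
  have hXU := hX.prodMk hU.aemeasurable
  have hi' : Integrable Ψ ((P.map X).prod μ) := by
    rw [← map_prodMk_eq hX hU h]
    exact (integrable_map_measure hΨ.aestronglyMeasurable hXU).2 hi
  rw [← integral_map (φ := fun ω => (X ω, U ω)) hXU hΨ.aestronglyMeasurable, map_prodMk_eq hX hU h,
    integral_prod _ hi',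
    integral_map hX (hΨ.stronglyMeasurable.integral_prod_right').aestronglyMeasurable]

theorem lintegral_indep (hX : AEMeasurable X P) (hU : HasLaw U μ P) (h : IndepFun X U P)
    {Ψ : α × β → ENNReal} (hΨ : Measurable Ψ) :
    ∫⁻ ω, Ψ (X ω, U ω) ∂P = ∫⁻ ω, ∫⁻ b, Ψ (X ω, b) ∂μ ∂P := by
  have : IsProbabilityMeasure μ := hU.isProbabilityMeasure_iff.1 inferInstance
  have := Measure.isProbabilityMeasure_map hX
  have hXU := hX.prodMk hU.aemeasurable
  rw [← lintegral_map' (f := Ψ) (g := fun ω => (X ω, U ω)) hΨ.aemeasurable hXU,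
    map_prodMk_eq hX hU h, lintegral_prod _ hΨ.aemeasurable,
    lintegral_map' hΨ.lintegral_prod_right'.aemeasurable hX]

end Freezing

variable {n p : ℕ} {Ω : Type u} [MeasurableSpace Ω] {Z : Type v} [MeasurableSpace Z]
  {P : Measure Ω} {ν : Measure Z} {u : ℕ → Fin n → Ω → Vec p} {ζ : ℕ → Fin n → Ω → Z}
  {S S' R R' : Finset (ℕ × Fin n)} {β : Type*} [MeasurableSpace β]

/-- The directions with indices in `S` and the seeds with indices in `R`. -/
def noise (u : ℕ → Fin n → Ω → Vec p) (ζ : ℕ → Fin n → Ω → Z) (S R : Finset (ℕ × Fin n)) (ω : Ω) :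
    (S → Vec p) × (R → Z) :=
  (fun k => u k.1.1 k.1.2 ω, fun k => ζ k.1.1 k.1.2 ω)

/-- Up to a null event, `φ` is a measurable function of the directions with indices in `S` and the
seeds with indices in `R`. -/
def Depends (P : Measure Ω) (u : ℕ → Fin n → Ω → Vec p) (ζ : ℕ → Fin n → Ω → Z)
    (S R : Finset (ℕ × Fin n)) (φ : Ω → β) : Prop :=
  ∃ Φ : (S → Vec p) × (R → Z) → β, Measurable Φ ∧ φ =ᵐ[P] fun ω => Φ (noise u ζ S R ω)

namespace Depends

variable {φ : Ω → β}

theorem const (b : β) : Depends P u ζ S R fun _ => b := ⟨fun _ => b, measurable_const, .rfl⟩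

theorem congr (h : Depends P u ζ S R φ) {ψ : Ω → β} (he : ψ =ᵐ[P] φ) : Depends P u ζ S R ψ := by
  obtain ⟨Φ, hΦ, h⟩ := h
  exact ⟨Φ, hΦ, he.trans h⟩

theorem comp (h : Depends P u ζ S R φ) {γ : Type*} [MeasurableSpace γ] {F : β → γ}
    (hF : Measurable F) : Depends P u ζ S R fun ω => F (φ ω) := by
  obtain ⟨Φ, hΦ, h⟩ := h
  refine ⟨F ∘ Φ, hF.comp hΦ, ?_⟩
  filter_upwards [h] with ω hω
  rw [hω]
  rfl

theorem prodMk (h : Depends P u ζ S R φ) {γ : Type*} [MeasurableSpace γ] {ψ : Ω → γ}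
    (h' : Depends P u ζ S R ψ) : Depends P u ζ S R fun ω => (φ ω, ψ ω) := by
  obtain ⟨Φ, hΦ, h⟩ := h
  obtain ⟨Ψ, hΨ, h'⟩ := h'
  refine ⟨fun q => (Φ q, Ψ q), hΦ.prodMk hΨ, ?_⟩
  filter_upwards [h, h'] with ω h1 h2
  rw [h1, h2]

theorem pi {ι : Type*} [Countable ι] {φ : ι → Ω → β} (h : ∀ i, Depends P u ζ S R (φ i)) :
    Depends P u ζ S R fun ω i => φ i ω := by
  choose Φ hΦ h using h
  refine ⟨fun q i => Φ i q, measurable_pi_iff.2 hΦ, ?_⟩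
  filter_upwards [ae_all_iff.2 h] with ω hω
  funext i
  exact hω i

theorem mono (h : Depends P u ζ S R φ) (hS : S ⊆ S') (hR : R ⊆ R') : Depends P u ζ S' R' φ := by
  obtain ⟨Φ, hΦ, h⟩ := h
  refine ⟨fun q => Φ (fun k => q.1 ⟨k.1, hS k.2⟩, fun k => q.2 ⟨k.1, hR k.2⟩),
    hΦ.comp (by fun_prop), h⟩

theorem direction {k : ℕ × Fin n} (hk : k ∈ S) : Depends P u ζ S R (u k.1 k.2) :=
  ⟨fun q => q.1 ⟨k, hk⟩, by fun_prop, .rfl⟩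

theorem seed {k : ℕ × Fin n} (hk : k ∈ R) : Depends P u ζ S R (ζ k.1 k.2) :=
  ⟨fun q => q.2 ⟨k, hk⟩, by fun_prop, .rfl⟩

theorem aemeasurable_noise (hr : Randomness P ν u ζ) : AEMeasurable (noise u ζ S R) P :=
  (aemeasurable_pi_lambda _ fun _ => (hr.law_u _ _).aemeasurable).prodMk
    (aemeasurable_pi_lambda _ fun _ => (hr.law_ζ _ _).aemeasurable)

theorem aemeasurable (h : Depends P u ζ S R φ) (hr : Randomness P ν u ζ) : AEMeasurable φ P := by
  obtain ⟨Φ, hΦ, h⟩ := h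
  exact (hΦ.comp_aemeasurable (aemeasurable_noise hr)).congr h.symm

variable [IsProbabilityMeasure P]

/-- What depends on the directions in `S` only, and on any seeds, is independent of each further
direction. -/
theorem indep_direction (h : Depends P u ζ S R φ) (hr : Randomness P ν u ζ) {k : ℕ × Fin n}
    (hk : k ∉ S) : IndepFun φ (u k.1 k.2) P := by
  obtain ⟨Φ, hΦ, h⟩ := h
  have hu : ∀ k : ℕ × Fin n, AEMeasurable (u k.1 k.2) P := fun k => (hr.law_u _ _).aemeasurable
  have hζ : ∀ k : ℕ × Fin n, AEMeasurable (ζ k.1 k.2) P := fun k => (hr.law_ζ _ _).aemeasurable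
  have hAB : IndepFun (fun ω (k : S) => u k.1.1 k.1.2 ω) (u k.1 k.2) P := by
    have := iIndepFun.indepFun_finset₀ S {k} (by simpa using hk) hr.indep_u hu
    have hm : Measurable fun q : ({k} : Finset (ℕ × Fin n)) → Vec p =>
        q ⟨k, Finset.mem_singleton_self k⟩ := measurable_pi_apply _
    exact this.comp measurable_id hm
  have hABC : IndepFun (fun ω => ((fun k : S => u k.1.1 k.1.2 ω), u k.1 k.2 ω))
      (fun ω (k : ℕ × Fin n) => ζ k.1 k.2 ω) P :=
    hr.indep.comp (φ := fun q : ℕ × Fin n → Vec p => ((fun k : S => q k), q k)) (ψ := id)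
      (by fun_prop) measurable_id
  have := indepFun_rotate (aemeasurable_pi_lambda _ fun _ => hu _) (hu k)
    (aemeasurable_pi_lambda _ fun _ => hζ _) hAB hABC
  have h2 : IndepFun (fun ω => Φ (noise u ζ S R ω)) (u k.1 k.2) P :=
    this.comp (φ := fun q : (S → Vec p) × (ℕ × Fin n → Z) => Φ (q.1, fun k : R => q.2 k))
      (ψ := id) (hΦ.comp (by fun_prop)) measurable_id
  exact h2.congr h.symm .rfl

/-- What depends on the seeds in `R` only, and on any directions, is independent of each further
seed. -/
theorem indep_seed (h : Depends P u ζ S R φ) (hr : Randomness P ν u ζ) {k : ℕ × Fin n}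
    (hk : k ∉ R) : IndepFun φ (ζ k.1 k.2) P := by
  obtain ⟨Φ, hΦ, h⟩ := h
  have hu : ∀ k : ℕ × Fin n, AEMeasurable (u k.1 k.2) P := fun k => (hr.law_u _ _).aemeasurable
  have hζ : ∀ k : ℕ × Fin n, AEMeasurable (ζ k.1 k.2) P := fun k => (hr.law_ζ _ _).aemeasurable
  have hAB : IndepFun (fun ω (k : R) => ζ k.1.1 k.1.2 ω) (ζ k.1 k.2) P := by
    have := iIndepFun.indepFun_finset₀ R {k} (by simpa using hk) hr.indep_ζ hζ
    have hm : Measurable fun q : ({k} : Finset (ℕ × Fin n)) → Z =>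
        q ⟨k, Finset.mem_singleton_self k⟩ := measurable_pi_apply _
    exact this.comp measurable_id hm
  have hABC : IndepFun (fun ω => ((fun k : R => ζ k.1.1 k.1.2 ω), ζ k.1 k.2 ω))
      (fun ω (k : ℕ × Fin n) => u k.1 k.2 ω) P :=
    hr.indep.symm.comp (φ := fun q : ℕ × Fin n → Z => ((fun k : R => q k), q k)) (ψ := id)
      (by fun_prop) measurable_id
  have := indepFun_rotate (aemeasurable_pi_lambda _ fun _ => hζ _) (hζ k)
    (aemeasurable_pi_lambda _ fun _ => hu _) hAB hABC
  have h2 : IndepFun (fun ω => Φ (noise u ζ S R ω)) (ζ k.1 k.2) P :=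
    this.comp (φ := fun q : (R → Z) × (ℕ × Fin n → Vec p) => Φ (fun k : S => q.2 k, q.1))
      (ψ := id) (hΦ.comp (by fun_prop)) measurable_id
  exact h2.congr h.symm .rfl

end Depends

end Independence

end Probability

/-! ### Violations and the penalized loss -/

section Penalty

open Metric Set

section PosPart

@[simp]
theorem posPart_apply {ι : Type*} (v : EuclideanSpace ℝ ι) (k : ι) :
    posPart v k = max (v k) 0 := rfl

variable {ι : Type*} [Fintype ι]

theorem norm_posPart_sq (v : EuclideanSpace ℝ ι) : ‖posPart v‖ ^ 2 = ∑ k, max (v k) 0 ^ 2 := by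
  simp [EuclideanSpace.norm_sq_eq]

theorem norm_le_norm_of_abs_le {v w : EuclideanSpace ℝ ι} (h : ∀ k, |v k| ≤ |w k|) :
    ‖v‖ ≤ ‖w‖ := by
  rw [← pow_le_pow_iff_left₀ (norm_nonneg _) (norm_nonneg _) two_ne_zero,
    EuclideanSpace.norm_sq_eq, EuclideanSpace.norm_sq_eq]
  refine Finset.sum_le_sum fun k _ => ?_
  simpa only [Real.norm_eq_abs] using pow_le_pow_left₀ (abs_nonneg _) (h k) 2

theorem norm_posPart_le (v : EuclideanSpace ℝ ι) : ‖posPart v‖ ≤ ‖v‖ := by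
  refine norm_le_norm_of_abs_le fun k => ?_
  rw [posPart_apply, abs_of_nonneg (le_max_right _ _)]
  exact max_le (le_abs_self _) (abs_nonneg _)

theorem norm_posPart_le_sum (v : EuclideanSpace ℝ ι) : ‖posPart v‖ ≤ ∑ k, max (v k) 0 := by
  have h0 : ∀ k ∈ Finset.univ, 0 ≤ max (v k) 0 := fun k _ => le_max_right _ _
  rw [← pow_le_pow_iff_left₀ (norm_nonneg _) (Finset.sum_nonneg h0) two_ne_zero, norm_posPart_sq]
  exact Finset.sum_sq_le_sq_sum_of_nonneg h0

theorem norm_posPart_le_add {v w e : EuclideanSpace ℝ ι} (h : ∀ k, v k ≤ w k + e k) :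
    ‖posPart v‖ ≤ ‖posPart w‖ + ‖e‖ := by
  have h1 : ‖posPart v‖ ≤ ‖posPart w + WithLp.toLp 2 (fun k => |e k|)‖ := by
    refine norm_le_norm_of_abs_le fun k => ?_
    rw [posPart_apply, abs_of_nonneg (le_max_right _ _), PiLp.add_apply, posPart_apply]
    have h2 : 0 ≤ max (w k) 0 := le_max_right _ _
    have h3 : w k ≤ max (w k) 0 := le_max_left _ _
    refine le_trans (max_le ?_ ?_) (le_abs_self _)
    · have := le_abs_self (e k)
      simp only
      linarith [h k]
    · have := abs_nonneg (e k)
      simp only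
      linarith
  refine h1.trans ((norm_add_le _ _).trans ?_)
  gcongr
  refine norm_le_norm_of_abs_le fun k => ?_
  simp

end PosPart

section ScheduleFacts

variable {S : Schedule} {p : ℕ} {c : Constants}

namespace Schedule.Admissible

variable (hS : S.Admissible p c)
include hS

theorem θ₃_pos : 0 < S.θ₃ := hS.θ₂_mem.1.trans hS.θ₃_mem.1

end Schedule.Admissible

theorem Schedule.ξ_one : S.ξ 1 = 1 := by simp [Schedule.ξ]

theorem Schedule.δ_eq (r : ℝ) (t : ℕ) : S.δ r t = r * S.ξ t := by
  simp [Schedule.δ, Schedule.ξ, div_eq_mul_inv]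

end ScheduleFacts

namespace Problem

variable {n p : ℕ} {M : Problem n p} {c : Constants} {S : Schedule}

namespace Standing

theorem mixingData (hM : M.Standing c) (hc : c.Valid) : MixingData M.graph M.W c.w c.B where
  w_pos := hc.w_mem.1
  weight_ge := hM.weight_ge
  nonneg := fun t ht i j => by
    by_cases h : (M.graph t).Adj j i ∨ i = j
    · exact hc.w_mem.1.le.trans (hM.weight_ge t ht i j h)
    · rw [hM.weight_zero t ht i j h]
  row_sum := hM.row_sum
  col_sum := hM.col_sum
  connected := hM.connected

theorem zero_mem (hM : M.Standing c) (hc : c.Valid) : (0 : Vec p) ∈ M.X :=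
  hM.ball_subset (mem_closedBall_self hc.r_pos.le)

theorem norm_le (hM : M.Standing c) {x : Vec p} (hx : x ∈ M.X) : ‖x‖ ≤ c.R := by
  simpa using hM.subset_ball hx

theorem F₁_nonneg (hM : M.Standing c) (hc : c.Valid) (hn : 0 < n) : 0 ≤ c.F₁ :=
  (abs_nonneg _).trans (hM.f_bound ⟨0, hn⟩ 1 le_rfl 0 (hM.zero_mem hc))

theorem G₁_nonneg (hM : M.Standing c) (hc : c.Valid) (hn : 0 < n) : 0 ≤ c.G₁ :=
  (norm_nonneg _).trans (hM.f_grad_bound ⟨0, hn⟩ 1 le_rfl 0 (hM.zero_mem hc))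

theorem G₂_nonneg (hM : M.Standing c) (hc : c.Valid) (hn : 0 < n) : 0 ≤ c.G₂ := by
  obtain ⟨J, hJ, -⟩ := hM.g_subgrad ⟨0, hn⟩ 1 le_rfl 0 (hM.zero_mem hc)
  exact (norm_nonneg _).trans hJ

theorem L_nonneg (hM : M.Standing c) (hc : c.Valid) (hn : 0 < n) (hp : 0 < p) : 0 ≤ c.L := by
  have : NeZero p := ⟨hp.ne'⟩
  obtain ⟨x, hx⟩ := exists_norm_eq (Vec p) (c := c.r) hc.r_pos.le
  have h := (norm_nonneg _).trans (hM.f_grad_lipschitz ⟨0, hn⟩ 1 le_rfl x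
    (hM.ball_subset (by simp [hx])) 0 (hM.zero_mem hc))
  rw [sub_zero, hx] at h
  exact nonneg_of_mul_nonneg_left h hc.r_pos

/-- The shrunk decision sets leave room for the exploration radius. -/
theorem closedBall_shrink_subset (hM : M.Standing c) {y : Vec p} (hy : y ∈ M.X) {ξ : ℝ}
    (h0 : 0 < ξ) (h1 : ξ ≤ 1) : closedBall ((1 - ξ) • y) (c.r * ξ) ⊆ M.X := by
  intro w hw
  rw [mem_closedBall, dist_eq_norm] at hw
  have h2 : ξ⁻¹ • (w - (1 - ξ) • y) ∈ M.X := by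
    refine hM.ball_subset ?_
    rw [mem_closedBall_zero_iff, norm_smul, norm_inv, Real.norm_of_nonneg h0.le,
      inv_mul_le_iff₀ h0, mul_comm]
    exact hw
  have h3 := hM.convex hy h2 (sub_nonneg.2 h1) h0.le (by ring)
  rwa [smul_smul, mul_inv_cancel₀ h0.ne', one_smul, add_sub_cancel] at h3

end Standing

/-- The local violation `‖[g_{i,t}(x)]_+‖`. -/
def viol (M : Problem n p) (i : Fin n) (t : ℕ) (x : Vec p) : ℝ := ‖posPart (M.g i t x)‖

theorem viol_nonneg (i : Fin n) (t : ℕ) (x : Vec p) : 0 ≤ M.viol i t x := norm_nonneg _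

namespace Standing

variable {i : Fin n} {t : ℕ}

theorem viol_le (hM : M.Standing c) (ht : 1 ≤ t) {x : Vec p} (hx : x ∈ M.X) :
    M.viol i t x ≤ c.F₂ := (norm_posPart_le _).trans (hM.g_bound i t ht x hx)

theorem viol_le_add (hM : M.Standing c) (ht : 1 ≤ t) {x y : Vec p} (hx : x ∈ M.X) (hy : y ∈ M.X) :
    M.viol i t x ≤ M.viol i t y + c.G₂ * ‖x - y‖ := by
  obtain ⟨J, hJ, h⟩ := hM.g_subgrad i t ht x hx
  refine (norm_posPart_le_add (e := J (x - y)) (w := M.g i t y) fun k => ?_).trans ?_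
  · have := h y hy k
    rw [← neg_sub x y, map_neg] at this
    simp only [PiLp.neg_apply] at this
    linarith
  · unfold viol
    gcongr
    exact (J.le_opNorm _).trans (by gcongr)

theorem viol_sq_le_add (hM : M.Standing c) (ht : 1 ≤ t) {x y : Vec p} (hx : x ∈ M.X)
    (hy : y ∈ M.X) :
    M.viol i t x ^ 2 ≤ M.viol i t y ^ 2 + 2 * c.F₂ * c.G₂ * ‖x - y‖ := by
  have h1 := hM.viol_le_add (i := i) ht hx hy
  have h2 := hM.viol_le (i := i) ht hx
  have h3 := hM.viol_le (i := i) ht hy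
  have h4 := viol_nonneg (M := M) i t x
  have h5 := viol_nonneg (M := M) i t y
  have h6 : 0 ≤ c.G₂ * ‖x - y‖ := by
    obtain ⟨J, hJ, -⟩ := hM.g_subgrad i t ht x hx
    exact mul_nonneg ((norm_nonneg _).trans hJ) (norm_nonneg _)
  nlinarith

theorem viol_sq_lipschitz (hM : M.Standing c) (hc : c.Valid) (hn : 0 < n) (ht : 1 ≤ t) :
    LipschitzOnWith (Real.toNNReal (2 * c.F₂ * c.G₂)) (fun x => M.viol i t x ^ 2) M.X := by
  have h0 : 0 ≤ 2 * c.F₂ * c.G₂ :=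
    mul_nonneg (mul_nonneg zero_le_two hc.F₂_pos.le) (hM.G₂_nonneg hc hn)
  refine LipschitzOnWith.of_le_add_mul _ fun x hx y hy => ?_
  rw [Real.coe_toNNReal _ h0, dist_eq_norm]
  exact hM.viol_sq_le_add ht hx hy

theorem viol_sq_convexOn (hM : M.Standing c) (ht : 1 ≤ t) :
    ConvexOn ℝ M.X (fun x => M.viol i t x ^ 2) := by
  have h : ∀ x, M.viol i t x ^ 2 = ∑ k, max (M.g i t x k) 0 ^ 2 := fun x => norm_posPart_sq _
  simp_rw [h]
  have hk : ∀ k, ConvexOn ℝ M.X (fun x => max (M.g i t x k) 0 ^ 2) := fun k =>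
    ((hM.g_convex i t ht k).sup (convexOn_const 0 hM.convex)).pow
      (fun x _ => le_max_right _ _) 2
  refine ⟨hM.convex, fun x hx y hy a b ha hb hab => ?_⟩
  simp only [smul_eq_mul, Finset.mul_sum, ← Finset.sum_add_distrib]
  exact Finset.sum_le_sum fun k _ => (hk k).2 hx hy ha hb hab

/-- The smoothed squared violation decreases towards a point `y` around which the violation is
small. -/
theorem onePoint_viol_sq_le (hM : M.Standing c) (hc : c.Valid) (hn : 0 < n) (hp : 0 < p)
    (ht : 1 ≤ t) {x y : Vec p} {δ b : ℝ} (hδ : 0 < δ) (hx : closedBall x δ ⊆ M.X)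
    (hy : closedBall y δ ⊆ M.X) (hb : ∀ w ∈ closedBall y δ, M.viol i t w ^ 2 ≤ b) :
    (p : ℝ) / δ * ∫ u, M.viol i t (x + δ • u) ^ 2 * inner ℝ u (y - x) ∂(uniformSphere p) ≤
      b + 2 * c.F₂ * c.G₂ * δ - M.viol i t x ^ 2 := by
  have hmem : ∀ (z v : Vec p), v ∈ ball (0 : Vec p) 1 → z + δ • v ∈ closedBall z δ := by
    intro z v hv
    rw [mem_ball_zero_iff] at hv
    simpa [norm_smul, abs_of_pos hδ] using mul_le_of_le_one_right hδ.le hv.le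
  refine onePoint_slope_le (H := fun x => M.viol i t x ^ 2) (t := 1) hp hM.convex
    (hM.viol_sq_lipschitz hc hn ht) (hM.viol_sq_convexOn ht) hδ hx hy (by simp) fun v hv => ?_
  simp only [sub_self, zero_smul, one_smul, zero_add, one_mul]
  have h1 := hb _ (hmem y v hv)
  have h2 := hM.viol_sq_le_add (i := i) ht (hx (mem_closedBall_self hδ.le)) (hx (hmem x v hv))
  have h3 : ‖x - (x + δ • v)‖ ≤ δ := by
    have := hmem x v hv
    rwa [mem_closedBall, dist_comm, dist_eq_norm] at this
  have h4 : 2 * c.F₂ * c.G₂ * ‖x - (x + δ • v)‖ ≤ 2 * c.F₂ * c.G₂ * δ := by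
    have := hc.F₂_pos
    have := hM.G₂_nonneg hc hn
    gcongr
  linarith

/-- Towards a point `y` around which the constraints hold with margin `σ`, the smoothed squared
violation decreases at a rate proportional to the violation itself. -/
theorem onePoint_viol_sq_le_of_margin (hM : M.Standing c) (hc : c.Valid) (hn : 0 < n) (hp : 0 < p)
    (ht : 1 ≤ t) {x y : Vec p} {δ σ : ℝ} (hδ : 0 < δ) (hσ : 0 < σ) (hx : closedBall x δ ⊆ M.X)
    (hy : closedBall y δ ⊆ M.X) (hb : ∀ w ∈ closedBall y δ, ∀ k, M.g i t w k ≤ -σ) :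
    (p : ℝ) / δ * ∫ u, M.viol i t (x + δ • u) ^ 2 * inner ℝ u (y - x) ∂(uniformSphere p) ≤
      -(2 * σ * (M.viol i t x - c.G₂ * δ)) := by
  have hmem : ∀ (z v : Vec p), v ∈ ball (0 : Vec p) 1 → z + δ • v ∈ closedBall z δ := by
    intro z v hv
    rw [mem_ball_zero_iff] at hv
    simpa [norm_smul, abs_of_pos hδ] using mul_le_of_le_one_right hδ.le hv.le
  set I := (p : ℝ) / δ * ∫ u, M.viol i t (x + δ • u) ^ 2 * inner ℝ u (y - x) ∂(uniformSphere p)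
  have key : ∀ τ ∈ Ioc (0 : ℝ) 1,
      I ≤ -(2 * σ * (M.viol i t x - c.G₂ * δ)) + τ * (M.m i * σ ^ 2) := by
    intro τ hτ
    refine onePoint_slope_le (H := fun x => M.viol i t x ^ 2) (t := τ) hp hM.convex
      (hM.viol_sq_lipschitz hc hn ht) (hM.viol_sq_convexOn ht) hδ hx hy hτ fun v hv => ?_
    set a := x + δ • v
    set b := y + δ • v
    have ha : a ∈ M.X := hx (hmem x v hv)
    have hbX : b ∈ M.X := hy (hmem y v hv)
    have hcomp : ∀ k, max (M.g i t ((1 - τ) • a + τ • b) k) 0 ^ 2 ≤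
        max (M.g i t a k) 0 ^ 2 - 2 * τ * σ * max (M.g i t a k) 0 + τ ^ 2 * σ ^ 2 := by
      intro k
      have h1 := (hM.g_convex i t ht k).2 ha hbX (sub_nonneg.2 hτ.2) hτ.1.le (by ring)
      simp only [smul_eq_mul] at h1
      have h2 := hb b (hmem y v hv) k
      have h3 : τ * M.g i t b k ≤ τ * (-σ) := mul_le_mul_of_nonneg_left h2 hτ.1.le
      have h4 : 0 < τ * σ := mul_pos hτ.1 hσ
      rcases le_total (M.g i t a k) 0 with hq | hq
      · have h5 : M.g i t ((1 - τ) • a + τ • b) k ≤ 0 := by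
          have := mul_nonpos_of_nonneg_of_nonpos (sub_nonneg.2 hτ.2) hq
          linarith
        rw [max_eq_right h5, max_eq_right hq]
        have : 0 ≤ τ ^ 2 * σ ^ 2 := by positivity
        linarith
      · rw [max_eq_left hq]
        have h5 : M.g i t ((1 - τ) • a + τ • b) k ≤ M.g i t a k - τ * σ := by
          have := mul_nonneg hτ.1.le hq
          linarith
        rcases le_total (M.g i t ((1 - τ) • a + τ • b) k) 0 with h6 | h6
        · rw [max_eq_right h6]
          nlinarith [sq_nonneg (M.g i t a k - τ * σ)]
        · rw [max_eq_left h6]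
          nlinarith
    have hsum := Finset.sum_le_sum fun k (_ : k ∈ Finset.univ) => hcomp k
    rw [Finset.sum_add_distrib, Finset.sum_sub_distrib, ← Finset.mul_sum, ← norm_posPart_sq,
      ← norm_posPart_sq] at hsum
    simp only [Finset.sum_const, Finset.card_univ, Fintype.card_fin, nsmul_eq_mul] at hsum
    have h1 : M.viol i t a ≤ ∑ k, max (M.g i t a k) 0 := norm_posPart_le_sum _
    have h2 := hM.viol_le_add (i := i) ht (hx (mem_closedBall_self hδ.le)) ha
    have h3 : ‖x - a‖ ≤ δ := by
      have := hmem x v hv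
      rwa [mem_closedBall, dist_comm, dist_eq_norm] at this
    have h4 : c.G₂ * ‖x - a‖ ≤ c.G₂ * δ := mul_le_mul_of_nonneg_left h3 (hM.G₂_nonneg hc hn)
    have h5 : 2 * τ * σ * (M.viol i t x - c.G₂ * δ) ≤ 2 * τ * σ * ∑ k, max (M.g i t a k) 0 := by
      have := hτ.1
      gcongr
      linarith
    simp only [viol] at h5 ⊢
    nlinarith
  by_contra hcon
  push Not at hcon
  set C := -(2 * σ * (M.viol i t x - c.G₂ * δ))
  set D := (M.m i : ℝ) * σ ^ 2
  have hD : 0 ≤ D := by positivity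
  have hpos : 0 < (I - C) / (2 * (D + (I - C))) := by
    have : 0 < I - C := by linarith
    positivity
  have h1 := key ((I - C) / (2 * (D + (I - C)))) ⟨hpos, by
    rw [div_le_one (by linarith)]
    linarith⟩
  have h2 : (I - C) / (2 * (D + (I - C))) * D < I - C := by
    rw [div_mul_eq_mul_div, div_lt_iff₀ (by linarith)]
    nlinarith
  linarith

end Standing

/-- The function whose one-point gradient estimate the method follows: the loss plus `γ_t` times
the squared violation. -/
def penalized (M : Problem n p) (S : Schedule) (i : Fin n) (t : ℕ) (x : Vec p) : ℝ :=
  M.f i t x + S.γ t * M.viol i t x ^ 2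

/-- The one-point gradient estimate at `x` in the direction `u`. The penalized loss is set to `0`
off the decision set, where the problem does not specify it, so that the estimate is a measurable
function of `x` and `u`. -/
def gradEst (M : Problem n p) (c : Constants) (S : Schedule) (i : Fin n) (t : ℕ) (x u : Vec p) :
    Vec p :=
  (p / S.δ c.r t * M.X.indicator (M.penalized S i t) (x + S.δ c.r t • u)) • u

/-- The average of the one-point gradient estimate over the directions. -/
def meanEst (M : Problem n p) (c : Constants) (S : Schedule) (i : Fin n) (t : ℕ) (x : Vec p) :
    Vec p := ∫ u, M.gradEst c S i t x u ∂(uniformSphere p)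

/-- A bound on the one-point gradient estimates. -/
def estBound (p : ℕ) (c : Constants) (S : Schedule) (t : ℕ) : ℝ :=
  p / S.δ c.r t * (c.F₁ + S.γ t * c.F₂ ^ 2)

/-- The loss estimate and the constraint estimate of the method combine to the one-point estimate
of the penalized loss, because `⟨g, [g]_+⟩ = ‖[g]_+‖²`. -/
theorem onePoint_eq (i : Fin n) (t : ℕ) (x u : Vec p) (δ : ℝ) :
    onePointGrad δ (M.f i t) x u +
      WithLp.toLp 2 ((onePointJac δ (M.g i t) x u).mulVec
        ((S.γ t • posPart (M.g i t (x + δ • u)) : Vec (M.m i)))) =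
    (p / δ * M.penalized S i t (x + δ • u)) • u := by
  have h : (∑ k, M.g i t (x + δ • u) k * max (M.g i t (x + δ • u) k) 0) =
      M.viol i t (x + δ • u) ^ 2 := by
    rw [viol, norm_posPart_sq]
    refine Finset.sum_congr rfl fun k _ => ?_
    rcases le_total (M.g i t (x + δ • u) k) 0 with h | h
    · simp [max_eq_right h]
    · rw [max_eq_left h, sq]
  ext j
  simp only [onePointGrad, onePointJac, penalized, PiLp.add_apply, PiLp.smul_apply, smul_eq_mul,
    Matrix.mulVec, dotProduct, Matrix.smul_apply, Matrix.vecMulVec_apply, posPart_apply]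
  rw [← h, Finset.mul_sum, mul_add, add_mul]
  congr 1
  rw [Finset.mul_sum, Finset.sum_mul]
  refine Finset.sum_congr rfl fun k _ => ?_
  ring

end Problem

end Penalty

/-! ### Schedules, estimates and one step along a realization -/

section Steps

open Metric Set

section ScheduleSigns

variable {S : Schedule} {p : ℕ} {c : Constants} {t : ℕ}

namespace Schedule.Admissible

theorem α_pos (hS : S.Admissible p c) (ht : 1 ≤ t) : 0 < S.α t := by
  have := hS.α₀_pos
  have : (0 : ℝ) < t := by exact_mod_cast ht
  unfold Schedule.α
  positivity

theorem γ_pos (hS : S.Admissible p c) (ht : 1 ≤ t) : 0 < S.γ t := by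
  have := hS.γ₀_mem.1
  have : (0 : ℝ) < t := by exact_mod_cast ht
  unfold Schedule.γ
  positivity

theorem s_pos (hS : S.Admissible p c) (ht : 1 ≤ t) : 0 < S.s t := by
  have := hS.s₀_pos
  have : (0 : ℝ) < t := by exact_mod_cast ht
  unfold Schedule.s
  positivity

theorem δ_pos (hc : c.Valid) (ht : 1 ≤ t) : 0 < S.δ c.r t := by
  have := hc.r_pos
  have : (0 : ℝ) < t := by exact_mod_cast ht
  unfold Schedule.δ
  positivity

theorem ξ_pos (ht : 1 ≤ t) : 0 < S.ξ t := by
  have : (0 : ℝ) < t := by exact_mod_cast ht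
  unfold Schedule.ξ
  positivity

theorem ξ_le_one (hS : S.Admissible p c) (ht : 1 ≤ t) : S.ξ t ≤ 1 := by
  have : (1 : ℝ) ≤ t := by exact_mod_cast ht
  have h := Real.one_le_rpow this hS.θ₃_pos.le
  unfold Schedule.ξ
  rw [div_le_one (by linarith)]
  exact h

theorem ξ_succ_le (hS : S.Admissible p c) (ht : 1 ≤ t) : S.ξ (t + 1) ≤ S.ξ t := by
  have : (0 : ℝ) < t := by exact_mod_cast ht
  have := hS.θ₃_pos
  unfold Schedule.ξ
  gcongr
  simp

end Schedule.Admissible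

end ScheduleSigns

namespace Problem

variable {n p : ℕ} {M : Problem n p} {c : Constants} {S : Schedule} {i : Fin n} {t : ℕ}

open Schedule.Admissible

/-- The points around a shrunk point are convex combinations of that point and a point of the
decision set. -/
theorem Standing.exists_of_mem_shrink (hM : M.Standing c) {y : Vec p} {ξ : ℝ}
    (h0 : 0 < ξ) {w : Vec p} (hw : w ∈ closedBall ((1 - ξ) • y) (c.r * ξ)) :
    ∃ w' ∈ M.X, w = (1 - ξ) • y + ξ • w' := by
  rw [mem_closedBall, dist_eq_norm] at hw
  refine ⟨ξ⁻¹ • (w - (1 - ξ) • y), hM.ball_subset ?_, ?_⟩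
  · rw [mem_closedBall_zero_iff, norm_smul, norm_inv, Real.norm_of_nonneg h0.le,
      inv_mul_le_iff₀ h0, mul_comm]
    exact hw
  · rw [smul_smul, mul_inv_cancel₀ h0.ne', one_smul, add_sub_cancel]

/-- Around a shrunk feasible point the violation is at most a multiple of the shrinkage. -/
theorem Standing.viol_sq_le_of_mem_shrink (hM : M.Standing c) (ht : 1 ≤ t) {y : Vec p}
    (hy : y ∈ M.X) (hf : ∀ k, M.g i t y k ≤ 0) {ξ : ℝ} (h0 : 0 < ξ) (h1 : ξ ≤ 1) {w : Vec p}
    (hw : w ∈ closedBall ((1 - ξ) • y) (c.r * ξ)) : M.viol i t w ^ 2 ≤ ξ ^ 2 * c.F₂ ^ 2 := by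
  obtain ⟨w', hw', rfl⟩ := hM.exists_of_mem_shrink h0 hw
  have h : M.viol i t ((1 - ξ) • y + ξ • w') ≤ ξ * c.F₂ := by
    have h2 : M.viol i t ((1 - ξ) • y + ξ • w') ≤ ‖ξ • posPart (M.g i t w')‖ := by
      refine norm_le_norm_of_abs_le fun k => ?_
      have h3 := (hM.g_convex i t ht k).2 hy hw' (sub_nonneg.2 h1) h0.le (by ring)
      simp only [smul_eq_mul] at h3
      have h4 := mul_nonpos_of_nonneg_of_nonpos (sub_nonneg.2 h1) (hf k)
      have h5 := mul_le_mul_of_nonneg_left (le_max_left (M.g i t w' k) 0) h0.le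
      have h6 := mul_nonneg h0.le (le_max_right (M.g i t w' k) 0)
      rw [posPart_apply, abs_of_nonneg (le_max_right _ _), PiLp.smul_apply, posPart_apply,
        smul_eq_mul, abs_of_nonneg h6]
      exact max_le (by linarith) h6
    rw [norm_smul, Real.norm_of_nonneg h0.le] at h2
    exact h2.trans (mul_le_mul_of_nonneg_left (hM.viol_le ht hw') h0.le)
  rw [← mul_pow]
  exact pow_le_pow_left₀ (viol_nonneg _ _ _) h 2

/-- Around a shrunk Slater point a margin remains when the shrinkage is small. -/
theorem Standing.margin_of_mem_shrink (hM : M.Standing c) (ht : 1 ≤ t) {y : Vec p}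
    (hy : y ∈ M.X) {ς : ℝ} (hf : ∀ k, M.g i t y k ≤ -ς) {ξ : ℝ} (h0 : 0 < ξ) (h1 : ξ ≤ 1)
    {w : Vec p} (hw : w ∈ closedBall ((1 - ξ) • y) (c.r * ξ)) (k : Fin (M.m i)) :
    M.g i t w k ≤ -(1 - ξ) * ς + ξ * c.F₂ := by
  obtain ⟨w', hw', rfl⟩ := hM.exists_of_mem_shrink h0 hw
  have h3 := (hM.g_convex i t ht k).2 hy hw' (sub_nonneg.2 h1) h0.le (by ring)
  simp only [smul_eq_mul] at h3
  have h4 := mul_le_mul_of_nonneg_left (hf k) (sub_nonneg.2 h1)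
  have h5 : M.g i t w' k ≤ c.F₂ :=
    (le_abs_self _).trans ((PiLp.norm_apply_le (M.g i t w') k).trans (hM.g_bound i t ht w' hw'))
  have h6 := mul_le_mul_of_nonneg_left h5 h0.le
  linarith

theorem Standing.abs_penalized_le (hM : M.Standing c) (hS : S.Admissible p c) (ht : 1 ≤ t)
    {x : Vec p} (hx : x ∈ M.X) : |M.penalized S i t x| ≤ c.F₁ + S.γ t * c.F₂ ^ 2 := by
  refine (abs_add_le _ _).trans (add_le_add (hM.f_bound i t ht x hx) ?_)
  have h1 := hM.viol_le (i := i) ht hx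
  have h2 := viol_nonneg (M := M) i t x
  have := hS.γ_pos ht
  rw [abs_of_nonneg (by positivity)]
  gcongr

theorem Standing.abs_indicator_penalized_le (hM : M.Standing c) (hc : c.Valid) (hn : 0 < n)
    (hS : S.Admissible p c) (ht : 1 ≤ t) (x : Vec p) :
    |M.X.indicator (M.penalized S i t) x| ≤ c.F₁ + S.γ t * c.F₂ ^ 2 := by
  by_cases hx : x ∈ M.X
  · rw [indicator_of_mem hx]
    exact hM.abs_penalized_le hS ht hx
  · rw [indicator_of_notMem hx, abs_zero]
    have := hS.γ_pos ht
    have := hM.F₁_nonneg hc hn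
    positivity

theorem Standing.continuousOn_penalized (hM : M.Standing c) (hc : c.Valid) (hn : 0 < n)
    (ht : 1 ≤ t) : ContinuousOn (M.penalized S i t) M.X :=
  (hM.f_diff i t ht).continuousOn.add
    (continuousOn_const.mul (hM.viol_sq_lipschitz hc hn ht).continuousOn)

theorem measurable_indicator_of_continuousOn {E F : Type*} [TopologicalSpace E]
    [MeasurableSpace E] [BorelSpace E] [TopologicalSpace F] [MeasurableSpace F] [BorelSpace F]
    [Zero F] {X : Set E} (hX : IsClosed X) {f : E → F} (hf : ContinuousOn f X) :
    Measurable (X.indicator f) := by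
  classical
  rw [← piecewise_eq_indicator]
  exact hf.measurable_piecewise continuousOn_const hX.measurableSet

theorem Standing.measurable_gradEst (hM : M.Standing c) (hc : c.Valid) (hn : 0 < n)
    (ht : 1 ≤ t) : Measurable fun q : Vec p × Vec p => M.gradEst c S i t q.1 q.2 := by
  have := measurable_indicator_of_continuousOn hM.closed
    (hM.continuousOn_penalized (S := S) (i := i) hc hn ht)
  have h : Measurable fun q : Vec p × Vec p =>
      p / S.δ c.r t * M.X.indicator (M.penalized S i t) (q.1 + S.δ c.r t • q.2) :=
    measurable_const.mul (this.comp (by fun_prop))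
  exact h.smul measurable_snd

theorem Standing.norm_gradEst_le (hM : M.Standing c) (hc : c.Valid) (hn : 0 < n)
    (hS : S.Admissible p c) (ht : 1 ≤ t) (x : Vec p) {u : Vec p} (hu : ‖u‖ = 1) :
    ‖M.gradEst c S i t x u‖ ≤ estBound p c S t := by
  have hδ := δ_pos (S := S) hc ht
  rw [gradEst, norm_smul, hu, mul_one, norm_mul, estBound, Real.norm_of_nonneg (by positivity)]
  gcongr
  exact hM.abs_indicator_penalized_le hc hn hS ht _

theorem Standing.integrable_gradEst (hM : M.Standing c) (hc : c.Valid) (hn : 0 < n) (hp : 0 < p)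
    (hS : S.Admissible p c) (ht : 1 ≤ t) (x : Vec p) :
    Integrable (fun u => M.gradEst c S i t x u) (uniformSphere p) := by
  have := isProbabilityMeasure_uniformSphere hp
  refine Integrable.of_bound (C := estBound p c S t) ?_ ?_
  · exact ((hM.measurable_gradEst hc hn ht).comp measurable_prodMk_left).aestronglyMeasurable
  · filter_upwards [ae_uniformSphere_mem_sphere] with u hu
    exact hM.norm_gradEst_le hc hn hS ht x (mem_sphere_zero_iff_norm.1 hu)

theorem Standing.norm_meanEst_le (hM : M.Standing c) (hc : c.Valid) (hn : 0 < n) (hp : 0 < p)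
    (hS : S.Admissible p c) (ht : 1 ≤ t) (x : Vec p) :
    ‖M.meanEst c S i t x‖ ≤ estBound p c S t := by
  have := isProbabilityMeasure_uniformSphere hp
  refine (norm_integral_le_of_norm_le_const (C := estBound p c S t) ?_).trans (by simp)
  filter_upwards [ae_uniformSphere_mem_sphere] with u hu
  exact hM.norm_gradEst_le hc hn hS ht x (mem_sphere_zero_iff_norm.1 hu)

theorem Standing.measurable_meanEst (hM : M.Standing c) (hc : c.Valid) (hn : 0 < n) (hp : 0 < p)
    (ht : 1 ≤ t) : Measurable (M.meanEst c S i t) := by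
  have := isProbabilityMeasure_uniformSphere hp
  exact ((hM.measurable_gradEst (S := S) (i := i)
    hc hn ht).stronglyMeasurable.integral_prod_right').measurable

theorem Standing.inner_meanEst (hM : M.Standing c) (hc : c.Valid) (hn : 0 < n) (hp : 0 < p)
    (hS : S.Admissible p c) (ht : 1 ≤ t) (x d : Vec p) :
    inner ℝ (M.meanEst c S i t x) d =
      ∫ u, inner ℝ (M.gradEst c S i t x u) d ∂(uniformSphere p) := by
  simp_rw [meanEst, real_inner_comm d]
  exact (integral_inner (hM.integrable_gradEst hc hn hp hS ht x) d).symm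

/-- The averaged estimate, tested against `x - y`: the loss contributes its gradient up to the
one-point bias, the penalty its smoothed slope. -/
theorem Standing.le_inner_meanEst (hM : M.Standing c) (hc : c.Valid) (hn : 0 < n) (hp : 0 < p)
    (hS : S.Admissible p c) (ht : 1 ≤ t) {x y : Vec p} (hx : closedBall x (S.δ c.r t) ⊆ M.X)
    {b : ℝ} (hb : (p : ℝ) / S.δ c.r t * ∫ u, M.viol i t (x + S.δ c.r t • u) ^ 2 *
      inner ℝ u (y - x) ∂(uniformSphere p) ≤ b) :
    inner ℝ (gradientWithin (M.f i t) M.X x) (x - y) - p * c.L * S.δ c.r t * ‖x - y‖ -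
      S.γ t * b ≤ inner ℝ (M.meanEst c S i t x) (x - y) := by
  set δ := S.δ c.r t with hδdef
  have hδ : 0 < δ := δ_pos hc ht
  have hγ := hS.γ_pos ht
  have hmem : ∀ v ∈ sphere (0 : Vec p) 1, x + δ • v ∈ closedBall x δ := by
    intro v hv
    rw [mem_sphere_zero_iff_norm] at hv
    simp [norm_smul, hv, abs_of_pos hδ]
  have hcomp : MapsTo (fun u : Vec p => x + δ • u) (sphere 0 1) M.X := fun v hv => hx (hmem v hv)
  have hfc : ContinuousOn (fun u : Vec p => M.f i t (x + δ • u)) (sphere 0 1) :=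
    (hM.f_diff i t ht).continuousOn.comp (by fun_prop) hcomp
  have hvc : ContinuousOn (fun u : Vec p => M.viol i t (x + δ • u) ^ 2) (sphere 0 1) :=
    (hM.viol_sq_lipschitz hc hn ht).continuousOn.comp (by fun_prop) hcomp
  have i1 : Integrable (fun u => p / δ * (M.f i t (x + δ • u) * inner ℝ u (x - y)))
      (uniformSphere p) := integrable_uniformSphere hp (by fun_prop)
  have i2 : Integrable (fun u => S.γ t * (p / δ) *
      (M.viol i t (x + δ • u) ^ 2 * inner ℝ u (y - x))) (uniformSphere p) :=
    integrable_uniformSphere hp (by fun_prop)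
  have e : inner ℝ (M.meanEst c S i t x) (x - y) =
      p / δ * (∫ u, M.f i t (x + δ • u) * inner ℝ u (x - y) ∂(uniformSphere p)) -
      S.γ t * (p / δ * ∫ u, M.viol i t (x + δ • u) ^ 2 * inner ℝ u (y - x)
        ∂(uniformSphere p)) := by
    rw [hM.inner_meanEst hc hn hp hS ht, ← mul_assoc (S.γ t), ← integral_const_mul,
      ← integral_const_mul, ← integral_sub i1 i2]
    refine integral_congr_ae ?_
    filter_upwards [ae_uniformSphere_mem_sphere] with u hu
    rw [gradEst, ← hδdef, indicator_of_mem (hcomp hu), real_inner_smul_left, penalized,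
      ← neg_sub x y, inner_neg_right]
    ring
  have h1 := abs_le.1 (abs_onePoint_sub_gradient_le hp (hM.f_diff i t ht)
    (hM.f_grad_lipschitz i t ht) (hM.L_nonneg hc hn hp) hδ hx (x - y))
  have h2 := mul_le_mul_of_nonneg_left hb hγ.le
  rw [e]
  linarith [h1.1]

/-- The second moment of the estimate is controlled by the squared violation at the query point. -/
theorem Standing.sq_norm_gradEst_le (hM : M.Standing c) (ht : 1 ≤ t) {x u : Vec p}
    (hu : ‖u‖ = 1) (he : x + S.δ c.r t • u ∈ M.X) :
    ‖M.gradEst c S i t x u‖ ^ 2 ≤ (p / S.δ c.r t) ^ 2 *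
      (2 * c.F₁ ^ 2 + 2 * S.γ t ^ 2 * c.F₂ ^ 2 * M.viol i t (x + S.δ c.r t • u) ^ 2) := by
  rw [gradEst, norm_smul, hu, mul_one, norm_mul, mul_pow, indicator_of_mem he, Real.norm_eq_abs,
    sq_abs, Real.norm_eq_abs, sq_abs]
  refine mul_le_mul_of_nonneg_left ?_ (sq_nonneg _)
  set e := x + S.δ c.r t • u
  have h1 := hM.f_bound i t ht e he
  have h2 := hM.viol_le (i := i) ht he
  have h3 := viol_nonneg (M := M) i t e
  have h4 : M.f i t e ^ 2 ≤ c.F₁ ^ 2 := by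
    rw [← sq_abs]
    exact pow_le_pow_left₀ (abs_nonneg _) h1 2
  have h5 : (M.viol i t e ^ 2) ^ 2 ≤ c.F₂ ^ 2 * M.viol i t e ^ 2 := by
    rw [sq (M.viol i t e ^ 2)]
    gcongr
  have h6 := mul_le_mul_of_nonneg_left h5 (sq_nonneg (S.γ t))
  unfold penalized
  nlinarith [sq_nonneg (M.f i t e - S.γ t * M.viol i t e ^ 2)]

end Problem

section Pathwise

theorem mem_smul_of_le {d : ℕ} {X : Set (Vec d)} (hX : Convex ℝ X) (h0 : (0 : Vec d) ∈ X)
    {a b : ℝ} (ha : 0 ≤ a) (hab : a ≤ b) {w : Vec d} (hw : w ∈ a • X) : w ∈ b • X := by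
  obtain ⟨x, hx, rfl⟩ := hw
  rcases hab.eq_or_lt with rfl | hlt
  · exact smul_mem_smul_set hx
  · have hb : 0 < b := ha.trans_lt hlt
    refine ⟨(a / b) • x, ?_, ?_⟩
    · exact hX.smul_mem_of_zero_mem h0 hx ⟨by positivity, (div_le_one hb).2 hab⟩
    · simp only [smul_smul]
      rw [mul_div_cancel₀ _ hb.ne']

theorem sq_norm_mix_sub_le {n d : ℕ} {A : Matrix (Fin n) (Fin n) ℝ} (h0 : ∀ i j, 0 ≤ A i j)
    (hrow : ∀ i, ∑ j, A i j = 1) (hcol : ∀ j, ∑ i, A i j = 1) (x : Fin n → Vec d) (y : Vec d) :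
    ∑ i, ‖mix A x i - y‖ ^ 2 ≤ ∑ j, ‖x j - y‖ ^ 2 := by
  have hi : ∀ i, ‖mix A x i - y‖ ^ 2 ≤ ∑ j, A i j * ‖x j - y‖ ^ 2 := by
    intro i
    have h1 : mix A x i - y = ∑ j, A i j • (x j - y) := by
      simp [mix, smul_sub, ← Finset.sum_smul, hrow]
    rw [h1]
    have hc : ConvexOn ℝ univ fun v : Vec d => ‖v‖ ^ 2 :=
      convexOn_univ_norm.pow (fun _ _ => norm_nonneg _) 2
    exact hc.map_sum_le (fun j _ => h0 i j) (hrow i) (fun _ _ => mem_univ _)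
  refine (Finset.sum_le_sum fun i _ => hi i).trans ?_
  rw [Finset.sum_comm]
  simp [← Finset.sum_mul, hcol]

variable {n p : ℕ} {Z : Type v} {M : Problem n p} {c : Constants} {S : Schedule}
  {Q : Vec p → Z → Vec p} {u : ℕ → Fin n → Vec p} {ζ : ℕ → Fin n → Z}
  {x z zhat a : ℕ → Fin n → Vec p} {v : ℕ → (i : Fin n) → Vec (M.m i)} {t : ℕ}

/-- The Lyapunov function of the method, relative to the comparator `y`. The second term pays for
the drift of the shrunk comparator `(1 - ξ_t) y`. -/
def energy (c : Constants) (S : Schedule) (y : Vec p) (z : ℕ → Fin n → Vec p) (t : ℕ) : ℝ :=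
  ∑ i, ‖z t i - (1 - S.ξ t) • y‖ ^ 2 + 4 * n * c.R ^ 2 * S.ξ t

/-- The total compression error, to first order. -/
def compErr (z zhat : ℕ → Fin n → Vec p) (t : ℕ) : ℝ := ∑ i, ‖zhat t i - z t i‖

/-- The total compression error, to second order. -/
def compErrSq (z zhat : ℕ → Fin n → Vec p) (t : ℕ) : ℝ := ∑ i, ‖zhat t i - z t i‖ ^ 2

open Schedule.Admissible

namespace IsRun

theorem z_mem (h : IsRun M c S Q u ζ x z zhat a v) (ht : 1 ≤ t) (i : Fin n) :
    z t i ∈ (1 - S.ξ t) • M.X := by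
  rcases ht.eq_or_lt with rfl | ht
  · exact h.z_one i
  · obtain ⟨t, rfl⟩ := Nat.exists_eq_add_of_le ht
    have := (h.z_eq (1 + t) (by omega) i).1
    rwa [show 1 + t + 1 = Nat.succ 1 + t by omega] at this

/-- The method starts at `0`, since `ξ_1 = 1` shrinks the decision set to a point. -/
theorem z_one_eq (h : IsRun M c S Q u ζ x z zhat a v) (i : Fin n) : z 1 i = 0 := by
  obtain ⟨w, -, hw⟩ := h.z_one i
  rw [← hw]
  simp [Schedule.ξ_one]

theorem z_mem_X (h : IsRun M c S Q u ζ x z zhat a v) (hM : M.Standing c) (hc : c.Valid)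
    (hS : S.Admissible p c) (ht : 1 ≤ t) (i : Fin n) : z t i ∈ M.X := by
  have := mem_smul_of_le hM.convex (hM.zero_mem hc) (sub_nonneg.2 (hS.ξ_le_one ht))
    (b := 1) (by linarith [ξ_pos (S := S) ht]) (h.z_mem ht i)
  rwa [one_smul] at this

theorem x_eq_mix (h : IsRun M c S Q u ζ x z zhat a v) (ht : 1 ≤ t) :
    x t = mix (M.W t) (zhat t) := by
  funext i
  exact h.x_eq t ht i

theorem a_eq_gradEst (h : IsRun M c S Q u ζ x z zhat a v) (ht : 1 ≤ t) {i : Fin n}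
    (he : x t i + S.δ c.r t • u t i ∈ M.X) :
    a (t + 1) i = M.gradEst c S i t (x t i) (u t i) := by
  rw [h.a_eq t ht i, h.v_eq t ht i, Problem.onePoint_eq, Problem.gradEst,
    indicator_of_mem he]

theorem smul_mem_X (hM : M.Standing c) (hc : c.Valid) (hS : S.Admissible p c) (ht : 1 ≤ t)
    {y : Vec p} (hy : y ∈ M.X) : (1 - S.ξ t) • y ∈ M.X :=
  hM.convex.smul_mem_of_zero_mem (hM.zero_mem hc) hy
    ⟨sub_nonneg.2 (hS.ξ_le_one ht), by linarith [ξ_pos (S := S) ht]⟩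

theorem norm_sub_le (hM : M.Standing c) {x y : Vec p} (hx : x ∈ M.X) (hy : y ∈ M.X) :
    ‖x - y‖ ≤ 2 * c.R := by
  linarith [_root_.norm_sub_le x y, hM.norm_le hx, hM.norm_le hy]

theorem energy_nonneg (hc : c.Valid) (ht : 1 ≤ t) (y : Vec p) : 0 ≤ energy c S y z t := by
  have := ξ_pos (S := S) ht
  have := hc.R_pos
  exact add_nonneg (Finset.sum_nonneg fun _ _ => sq_nonneg _) (by positivity)

theorem energy_le (h : IsRun M c S Q u ζ x z zhat a v) (hM : M.Standing c) (hc : c.Valid)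
    (hS : S.Admissible p c) (ht : 1 ≤ t) {y : Vec p} (hy : y ∈ M.X) :
    energy c S y z t ≤ 8 * n * c.R ^ 2 := by
  have h1 : ∑ i, ‖z t i - (1 - S.ξ t) • y‖ ^ 2 ≤ ∑ _i : Fin n, (2 * c.R) ^ 2 :=
    Finset.sum_le_sum fun i _ => pow_le_pow_left₀ (norm_nonneg _)
      (norm_sub_le hM (h.z_mem_X hM hc hS ht i) (smul_mem_X hM hc hS ht hy)) 2
  simp only [Finset.sum_const, Finset.card_univ, Fintype.card_fin, nsmul_eq_mul] at h1
  have h2 : 4 * n * c.R ^ 2 * S.ξ t ≤ 4 * n * c.R ^ 2 * 1 :=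
    mul_le_mul_of_nonneg_left (hS.ξ_le_one ht) (by positivity)
  unfold energy
  linarith

/-- One step of the method decreases the energy by the (random) linearized gap, up to the
compression error and the squared step. -/
theorem energy_step (h : IsRun M c S Q u ζ x z zhat a v) (hM : M.Standing c) (hc : c.Valid)
    (hS : S.Admissible p c) (ht : 1 ≤ t) {y : Vec p} (hy : y ∈ M.X) :
    2 * S.α t * ∑ i, inner ℝ (a (t + 1) i) (x t i - (1 - S.ξ t) • y) ≤
      energy c S y z t - energy c S y z (t + 1) +
      (4 * c.R * compErr z zhat t + compErrSq z zhat t) +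
      S.α t ^ 2 * ∑ i, ‖a (t + 1) i‖ ^ 2 := by
  set y' := (1 - S.ξ t) • y with hy'
  have hW := hM.mixingData hc
  have hy'X : y' ∈ M.X := smul_mem_X hM hc hS ht hy
  have hξ := hS.ξ_succ_le ht
  have hR := hc.R_pos
  have hy'm : y' ∈ (1 - S.ξ (t + 1)) • M.X :=
    mem_smul_of_le hM.convex (hM.zero_mem hc) (sub_nonneg.2 (hS.ξ_le_one ht)) (by linarith)
      (smul_mem_smul_set hy)
  have s1 : ∀ i, ‖z (t + 1) i - y'‖ ^ 2 ≤ ‖x t i - y'‖ ^ 2 -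
      2 * S.α t * inner ℝ (a (t + 1) i) (x t i - y') + S.α t ^ 2 * ‖a (t + 1) i‖ ^ 2 := by
    intro i
    refine ((h.z_eq t ht i).sq_norm_sub_le (hM.convex.smul _) hy'm).trans (le_of_eq ?_)
    rw [show x t i - S.α t • a (t + 1) i - y' = (x t i - y') - S.α t • a (t + 1) i by abel,
      norm_sub_sq_real, norm_smul, inner_smul_right, real_inner_comm, mul_pow, Real.norm_eq_abs,
      sq_abs]
    ring
  have s2 : ∑ i, ‖x t i - y'‖ ^ 2 ≤ ∑ j, ‖zhat t j - y'‖ ^ 2 := by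
    rw [h.x_eq_mix ht]
    exact sq_norm_mix_sub_le (hW.nonneg t ht) (hM.row_sum t ht) (hM.col_sum t ht) _ _
  have s3 : ∀ j, ‖zhat t j - y'‖ ^ 2 ≤ ‖z t j - y'‖ ^ 2 + 4 * c.R * ‖zhat t j - z t j‖ +
      ‖zhat t j - z t j‖ ^ 2 := by
    intro j
    have h1 := norm_sub_le hM (h.z_mem_X hM hc hS ht j) hy'X
    have h2 : ‖zhat t j - y'‖ ≤ ‖zhat t j - z t j‖ + ‖z t j - y'‖ := by
      have := norm_add_le (zhat t j - z t j) (z t j - y')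
      rwa [sub_add_sub_cancel] at this
    have h3 := mul_le_mul_of_nonneg_left h1 (norm_nonneg (zhat t j - z t j))
    nlinarith [norm_nonneg (zhat t j - y'), norm_nonneg (zhat t j - z t j),
      norm_nonneg (z t j - y')]
  have s4 : ∀ i, ‖z (t + 1) i - (1 - S.ξ (t + 1)) • y‖ ^ 2 ≤ ‖z (t + 1) i - y'‖ ^ 2 +
      4 * c.R ^ 2 * (S.ξ t - S.ξ (t + 1)) := by
    intro i
    have hz := h.z_mem_X hM hc hS (show 1 ≤ t + 1 by omega) i
    have h1 := norm_sub_le hM hz hy'X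
    have h2 := norm_sub_le hM hz (smul_mem_X hM hc hS (show 1 ≤ t + 1 by omega) hy)
    have h3 : ‖z (t + 1) i - (1 - S.ξ (t + 1)) • y‖ ≤ ‖z (t + 1) i - y'‖ +
        (S.ξ t - S.ξ (t + 1)) * c.R := by
      have e : z (t + 1) i - (1 - S.ξ (t + 1)) • y =
          (z (t + 1) i - y') - (S.ξ t - S.ξ (t + 1)) • y := by
        rw [hy']
        module
      rw [e]
      refine (_root_.norm_sub_le _ _).trans ?_
      rw [norm_smul, Real.norm_of_nonneg (sub_nonneg.2 hξ)]
      gcongr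
      exact hM.norm_le hy
    have h4 : 0 ≤ (S.ξ t - S.ξ (t + 1)) * c.R := mul_nonneg (sub_nonneg.2 hξ) hR.le
    nlinarith [norm_nonneg (z (t + 1) i - y'), norm_nonneg (z (t + 1) i - (1 - S.ξ (t + 1)) • y)]
  have t1 := Finset.sum_le_sum fun i (_ : i ∈ Finset.univ) => s1 i
  have t3 := Finset.sum_le_sum fun i (_ : i ∈ Finset.univ) => s3 i
  have t4 := Finset.sum_le_sum fun i (_ : i ∈ Finset.univ) => s4 i
  simp only [Finset.sum_add_distrib, Finset.sum_sub_distrib, ← Finset.mul_sum, Finset.sum_const,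
    Finset.card_univ, Fintype.card_fin, nsmul_eq_mul] at t1 t3 t4
  unfold energy compErr compErrSq
  linarith

/-- The perturbation by which the method departs from pure averaging is at most the step plus
compression errors. The averages of the `z_t` lie in the next shrunk set, so the projection does not
move them. -/
theorem sum_norm_perturbation_le (h : IsRun M c S Q u ζ x z zhat a v) (hM : M.Standing c)
    (hc : c.Valid) (hS : S.Admissible p c) (ht : 1 ≤ t) :
    ∑ i, ‖zhat (t + 1) i - x t i‖ ≤ S.α t * ∑ i, ‖a (t + 1) i‖ + 2 * compErr z zhat t +
      compErr z zhat (t + 1) := by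
  have hW := hM.mixingData hc
  have hα := hS.α_pos ht
  have hξ := hS.ξ_succ_le ht
  set xt := mix (M.W t) (z t) with hxt
  have hxm : ∀ i, xt i ∈ (1 - S.ξ (t + 1)) • M.X := by
    intro i
    refine mem_smul_of_le hM.convex (hM.zero_mem hc) (sub_nonneg.2 (hS.ξ_le_one ht))
      (by linarith) ?_
    exact (hM.convex.smul (1 - S.ξ t)).sum_mem (fun j _ => hW.nonneg t ht i j) (hM.row_sum t ht i)
      (fun j _ => h.z_mem ht j)
  have hdiff : ∀ i, x t i - xt i = mix (M.W t) (fun j => zhat t j - z t j) i := by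
    intro i
    rw [h.x_eq_mix ht]
    simp [mix, hxt, smul_sub]
  have hd : ∑ i, ‖x t i - xt i‖ ≤ compErr z zhat t := by
    simp_rw [hdiff]
    exact sum_norm_mix_le (hW.nonneg t ht) (hM.col_sum t ht) _
  have hi : ∀ i, ‖zhat (t + 1) i - x t i‖ ≤
      S.α t * ‖a (t + 1) i‖ + 2 * ‖x t i - xt i‖ + ‖zhat (t + 1) i - z (t + 1) i‖ := by
    intro i
    have h1 := (h.z_eq t ht i).norm_sub_le (hM.convex.smul _) (hxm i)
    have h2 : ‖x t i - S.α t • a (t + 1) i - xt i‖ ≤ ‖x t i - xt i‖ + S.α t * ‖a (t + 1) i‖ := by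
      rw [show x t i - S.α t • a (t + 1) i - xt i = (x t i - xt i) - S.α t • a (t + 1) i by abel]
      refine (_root_.norm_sub_le _ _).trans ?_
      rw [norm_smul, Real.norm_of_nonneg hα.le]
    have h3 : ‖zhat (t + 1) i - x t i‖ ≤ ‖zhat (t + 1) i - z (t + 1) i‖ +
        (‖z (t + 1) i - xt i‖ + ‖x t i - xt i‖) := by
      rw [show zhat (t + 1) i - x t i = (zhat (t + 1) i - z (t + 1) i) +
        ((z (t + 1) i - xt i) - (x t i - xt i)) by abel]
      exact (norm_add_le _ _).trans (by gcongr; exact _root_.norm_sub_le _ _)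
    linarith
  have hs := Finset.sum_le_sum fun i (_ : i ∈ Finset.univ) => hi i
  simp only [Finset.sum_add_distrib, ← Finset.mul_sum] at hs
  unfold compErr at hd ⊢
  linarith

theorem dev_x_one_le (h : IsRun M c S Q u ζ x z zhat a v) (hM : M.Standing c) (hc : c.Valid) :
    dev (x 1) ≤ 2 * compErr z zhat 1 := by
  have hW := hM.mixingData hc
  rw [h.x_eq_mix le_rfl]
  refine (dev_mix_le (η := 0) (hW.nonneg 1 le_rfl) (hM.row_sum 1 le_rfl)
    (hM.col_sum 1 le_rfl) _).trans ?_
  have h1 := dev_add_le (fun _ : Fin n => (0 : Vec p)) (zhat 1)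
  have h2 : dev (fun _ : Fin n => (0 : Vec p)) = 0 := by simp [dev, mean]
  simp only [zero_add, h2] at h1
  rw [mul_zero, sub_zero, one_mul]
  refine h1.trans (le_of_eq ?_)
  simp [compErr, h.z_one_eq]

theorem x_succ_eq (h : IsRun M c S Q u ζ x z zhat a v) (ht : 1 ≤ t) :
    x (t + 1) = mix (M.W (t + 1)) (fun i => x t i + (zhat (t + 1) i - x t i)) := by
  rw [h.x_eq_mix (by omega)]
  simp

end IsRun

end Pathwise

end Steps

/-! ### Random executions: measurability, compression error, estimation noise -/

section Randomness

open Metric Set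

/-- A random execution of the method that is well defined: the hypotheses of `ExpectedRate` on one
execution. -/
structure Execution {n p : ℕ} {Ω : Type u} [MeasurableSpace Ω] {Z : Type v} [MeasurableSpace Z]
    (M : Problem n p) (c : Constants) (S : Schedule) (P : Measure Ω) (ν : Measure Z)
    (Q : Vec p → Z → Vec p) (Y : Set (Vec p)) (u : ℕ → Fin n → Ω → Vec p) (ζ : ℕ → Fin n → Ω → Z)
    (x z zhat a : Ω → ℕ → Fin n → Vec p) (v : Ω → ℕ → (i : Fin n) → Vec (M.m i)) : Prop where
  compressor : IsCompressor ν Q Y c.C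
  randomness : Randomness P ν u ζ
  run : ∀ ω, IsRun M c S Q (fun t i => u t i ω) (fun t i => ζ t i ω)
    (x ω) (z ω) (zhat ω) (a ω) (v ω)
  wellDef : ∀ t, 1 ≤ t → ∀ i, ∀ᵐ ω ∂P, x ω t i + S.δ c.r t • u t i ω ∈ M.X ∧
    (S.s t)⁻¹ • (z ω t i - zhat ω (t - 1) i) ∈ Y

/-- The indices of the draws made before time `t`. The decisions of time `t` depend on the
directions with indices in `past n t` and the seeds with indices in `past n (t + 1)`, since
compression comes before exploration. -/
def past (n t : ℕ) : Finset (ℕ × Fin n) := Finset.range t ×ˢ Finset.univ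

theorem mem_past {n t : ℕ} {k : ℕ × Fin n} : k ∈ past n t ↔ k.1 < t := by simp [past]

theorem past_mono {n s t : ℕ} (h : s ≤ t) : past n s ⊆ past n t := fun _ hk =>
  mem_past.2 ((mem_past.1 hk).trans_le h)

namespace Execution

open Schedule.Admissible Problem

set_option linter.unusedSectionVars false

variable {n p : ℕ} {Ω : Type u} [MeasurableSpace Ω] {Z : Type v} [MeasurableSpace Z]
  {M : Problem n p} {c : Constants} {S : Schedule} {P : Measure Ω} [IsProbabilityMeasure P]
  {ν : Measure Z} {Q : Vec p → Z → Vec p} {Y : Set (Vec p)} {u : ℕ → Fin n → Ω → Vec p}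
  {ζ : ℕ → Fin n → Ω → Z} {x z zhat a : Ω → ℕ → Fin n → Vec p}
  {v : Ω → ℕ → (i : Fin n) → Vec (M.m i)} {t : ℕ} {i : Fin n}

/-- The difference of the gradient estimate and its average over the current direction. -/
def estNoise (M : Problem n p) (c : Constants) (S : Schedule) (x a : Ω → ℕ → Fin n → Vec p)
    (t : ℕ) (i : Fin n) (ω : Ω) : Vec p :=
  a ω (t + 1) i - M.meanEst c S i t (x ω t i)

theorem ae_norm_direction (h : Execution M c S P ν Q Y u ζ x z zhat a v) (t : ℕ) (i : Fin n) :
    ∀ᵐ ω ∂P, ‖u t i ω‖ = 1 := by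
  have h1 := h.randomness.law_u t i
  have h2 : ∀ᵐ w ∂(P.map (u t i)), w ∈ sphere (0 : Vec p) 1 := by
    rw [h1.map_eq]
    exact ae_uniformSphere_mem_sphere
  filter_upwards [ae_of_ae_map h1.aemeasurable h2] with ω hω
  exact mem_sphere_zero_iff_norm.1 hω

theorem ae_a_eq (h : Execution M c S P ν Q Y u ζ x z zhat a v) (ht : 1 ≤ t) (i : Fin n) :
    ∀ᵐ ω ∂P, a ω (t + 1) i = M.gradEst c S i t (x ω t i) (u t i ω) := by
  filter_upwards [h.wellDef t ht i] with ω hω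
  exact (h.run ω).a_eq_gradEst ht hω.1

theorem depends_zhat_of (h : Execution M c S P ν Q Y u ζ x z zhat a v) (ht : 1 ≤ t)
    (hz : Depends P u ζ (past n t) (past n t) fun ω => z ω t)
    (hzh : Depends P u ζ (past n t) (past n t) fun ω => zhat ω (t - 1)) :
    Depends P u ζ (past n t) (past n (t + 1)) fun ω => zhat ω t := by
  have hsub : past n t ⊆ past n (t + 1) := past_mono (Nat.le_succ t)
  refine Depends.pi fun j => ?_
  have h1 := (hz.comp (measurable_pi_apply j)).mono (subset_refl _) hsub
  have h2 := (hzh.comp (measurable_pi_apply j)).mono (subset_refl _) hsub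
  have h3 : Depends P u ζ (past n t) (past n (t + 1)) (ζ t j) :=
    Depends.seed (k := (t, j)) (mem_past.2 (Nat.lt_succ_self t))
  have hm : Measurable fun q : (Vec p × Vec p) × Z =>
      q.1.2 + S.s t • Q ((S.s t)⁻¹ • (q.1.1 - q.1.2)) q.2 := by
    have := h.compressor.measurable.comp (show Measurable fun q : (Vec p × Vec p) × Z =>
      ((S.s t)⁻¹ • (q.1.1 - q.1.2), q.2) by fun_prop)
    exact Measurable.add (by fun_prop) (this.const_smul (S.s t))
  refine (((h1.prodMk h2).prodMk h3).comp hm).congr (ae_of_all _ fun ω => ?_)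
  exact (h.run ω).zhat_eq t ht j

theorem depends_x_of (h : Execution M c S P ν Q Y u ζ x z zhat a v) (ht : 1 ≤ t)
    {A B : Finset (ℕ × Fin n)} (hzh : Depends P u ζ A B fun ω => zhat ω t) :
    Depends P u ζ A B fun ω => x ω t := by
  have hm : Measurable fun q : Fin n → Vec p => mix (M.W t) q := by
    unfold mix
    fun_prop
  exact (hzh.comp hm).congr (ae_of_all _ fun ω => (h.run ω).x_eq_mix ht)

theorem depends_a_of (h : Execution M c S P ν Q Y u ζ x z zhat a v) (hM : M.Standing c)
    (hc : c.Valid) (hn : 0 < n) (ht : 1 ≤ t)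
    (hx : Depends P u ζ (past n t) (past n (t + 1)) fun ω => x ω t) (i : Fin n) :
    Depends P u ζ (past n (t + 1)) (past n (t + 1)) fun ω => a ω (t + 1) i := by
  have h1 := (hx.comp (measurable_pi_apply i)).mono (past_mono (Nat.le_succ t)) (subset_refl _)
  have h2 : Depends P u ζ (past n (t + 1)) (past n (t + 1)) (u t i) :=
    Depends.direction (k := (t, i)) (mem_past.2 (Nat.lt_succ_self t))
  exact ((h1.prodMk h2).comp (hM.measurable_gradEst (S := S) (i := i) hc hn ht)).congr
    (h.ae_a_eq ht i)

/-- The states `z_t` and `ẑ_{t-1}` are functions of the draws made before time `t`. -/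
theorem depends_state (h : Execution M c S P ν Q Y u ζ x z zhat a v) (hM : M.Standing c)
    (hc : c.Valid) (hn : 0 < n) (ht : 1 ≤ t) :
    Depends P u ζ (past n t) (past n t) (fun ω => z ω t) ∧
      Depends P u ζ (past n t) (past n t) (fun ω => zhat ω (t - 1)) := by
  induction t, ht using Nat.le_induction with
  | base =>
    refine ⟨(Depends.const 0).congr (ae_of_all _ fun ω => ?_),
      (Depends.const 0).congr (ae_of_all _ fun ω => ?_)⟩
    · funext i
      exact (h.run ω).z_one_eq i
    · funext i
      exact (h.run ω).zhat_zero i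
  | succ t ht ih =>
    have hzh := h.depends_zhat_of ht ih.1 ih.2
    have hx := h.depends_x_of ht hzh
    have hsub : past n t ⊆ past n (t + 1) := past_mono (Nat.le_succ t)
    refine ⟨Depends.pi fun i => ?_, hzh.mono hsub (subset_refl _)⟩
    have ha := h.depends_a_of hM hc hn ht hx i
    have hcomp : IsCompact M.X :=
      Metric.isCompact_of_isClosed_isBounded hM.closed (isBounded_closedBall.subset hM.subset_ball)
    obtain ⟨π, hπ, hπe⟩ := exists_continuous_proj (hM.convex.smul (1 - S.ξ (t + 1)))
      (hcomp.smul (1 - S.ξ (t + 1))).isClosed ⟨_, smul_mem_smul_set (hM.zero_mem hc)⟩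
    have h1 := (hx.comp (measurable_pi_apply i)).mono hsub (subset_refl _)
    have hm : Measurable fun q : Vec p × Vec p => π (q.1 - S.α t • q.2) :=
      hπ.measurable.comp (by fun_prop)
    exact ((h1.prodMk ha).comp hm).congr (ae_of_all _ fun ω => hπe _ _ ((h.run ω).z_eq t ht i))

theorem depends_zhat (h : Execution M c S P ν Q Y u ζ x z zhat a v) (hM : M.Standing c)
    (hc : c.Valid) (hn : 0 < n) (ht : 1 ≤ t) :
    Depends P u ζ (past n t) (past n (t + 1)) fun ω => zhat ω t :=
  h.depends_zhat_of ht (h.depends_state hM hc hn ht).1 (h.depends_state hM hc hn ht).2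

theorem depends_x (h : Execution M c S P ν Q Y u ζ x z zhat a v) (hM : M.Standing c)
    (hc : c.Valid) (hn : 0 < n) (ht : 1 ≤ t) (i : Fin n) :
    Depends P u ζ (past n t) (past n (t + 1)) fun ω => x ω t i :=
  (h.depends_x_of ht (h.depends_zhat hM hc hn ht)).comp (measurable_pi_apply i)

theorem depends_a (h : Execution M c S P ν Q Y u ζ x z zhat a v) (hM : M.Standing c)
    (hc : c.Valid) (hn : 0 < n) (ht : 1 ≤ t) (i : Fin n) :
    Depends P u ζ (past n (t + 1)) (past n (t + 1)) fun ω => a ω (t + 1) i :=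
  h.depends_a_of hM hc hn ht (h.depends_x_of ht (h.depends_zhat hM hc hn ht)) i

theorem aemeasurable_x (h : Execution M c S P ν Q Y u ζ x z zhat a v) (hM : M.Standing c)
    (hc : c.Valid) (hn : 0 < n) (ht : 1 ≤ t) (i : Fin n) :
    AEMeasurable (fun ω => x ω t i) P :=
  (h.depends_x hM hc hn ht i).aemeasurable h.randomness

theorem aemeasurable_a (h : Execution M c S P ν Q Y u ζ x z zhat a v) (hM : M.Standing c)
    (hc : c.Valid) (hn : 0 < n) (ht : 1 ≤ t) (i : Fin n) :
    AEMeasurable (fun ω => a ω (t + 1) i) P :=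
  (h.depends_a hM hc hn ht i).aemeasurable h.randomness

/-- The directions of time `t` are independent of everything that precedes their draw, which
includes the seeds of time `t`. -/
theorem indep_x_direction (h : Execution M c S P ν Q Y u ζ x z zhat a v) {β : Type*}
    [MeasurableSpace β] {φ : Ω → β} (hφ : Depends P u ζ (past n t) (past n (t + 1)) φ)
    (i : Fin n) : IndepFun φ (u t i) P :=
  hφ.indep_direction h.randomness (k := (t, i)) (by simp [mem_past])

/-- Almost surely, the whole exploration ball around every decision lies in the decision set. -/
theorem ae_closedBall_subset (h : Execution M c S P ν Q Y u ζ x z zhat a v) (hM : M.Standing c)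
    (hc : c.Valid) (hn : 0 < n) (hp : 0 < p) (ht : 1 ≤ t) (i : Fin n) :
    ∀ᵐ ω ∂P, closedBall (x ω t i) (S.δ c.r t) ⊆ M.X := by
  have hx := h.depends_x hM hc hn ht i
  have hs : MeasurableSet {q : Vec p × Vec p | q.1 + S.δ c.r t • q.2 ∈ M.X} :=
    (show Measurable fun q : Vec p × Vec p => q.1 + S.δ c.r t • q.2 by fun_prop)
      hM.closed.measurableSet
  have := ae_ae_of_indep (hx.aemeasurable h.randomness) (h.randomness.law_u t i)
    (h.indep_x_direction hx i) hs
    (by filter_upwards [h.wellDef t ht i] with ω hω using hω.1)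
  filter_upwards [this] with ω hω
  exact closedBall_subset_of_ae hp hM.closed hM.convex (δ_pos hc ht) hω

theorem ae_x_mem (h : Execution M c S P ν Q Y u ζ x z zhat a v) (hM : M.Standing c)
    (hc : c.Valid) (hn : 0 < n) (hp : 0 < p) (ht : 1 ≤ t) (i : Fin n) :
    ∀ᵐ ω ∂P, x ω t i ∈ M.X := by
  filter_upwards [h.ae_closedBall_subset hM hc hn hp ht i] with ω hω
  exact hω (mem_closedBall_self (δ_pos hc ht).le)

theorem aemeasurable_compErr (h : Execution M c S P ν Q Y u ζ x z zhat a v) (hM : M.Standing c)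
    (hc : c.Valid) (hn : 0 < n) (ht : 1 ≤ t) (i : Fin n) :
    AEMeasurable (fun ω => zhat ω t i - z ω t i) P := by
  have h1 := ((h.depends_zhat hM hc hn ht).comp (measurable_pi_apply i)).aemeasurable h.randomness
  have h2 := ((h.depends_state hM hc hn ht).1.comp (measurable_pi_apply i)).aemeasurable
    h.randomness
  exact h1.sub h2

/-- The mean square compression error of one agent. -/
theorem lintegral_compErr_sq_le (h : Execution M c S P ν Q Y u ζ x z zhat a v) (hM : M.Standing c)
    (hc : c.Valid) (hn : 0 < n) (hS : S.Admissible p c) (ht : 1 ≤ t) (i : Fin n) :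
    ∫⁻ ω, ENNReal.ofReal (‖zhat ω t i - z ω t i‖ ^ 2) ∂P ≤ ENNReal.ofReal (S.s t ^ 2 * c.C) := by
  have hs := hS.s_pos ht
  set q : Ω → Vec p := fun ω => (S.s t)⁻¹ • (z ω t i - zhat ω (t - 1) i) with hq
  have hqd : Depends P u ζ (past n t) (past n t) q := by
    have h1 := (h.depends_state hM hc hn ht).1.comp (measurable_pi_apply i)
    have h2 := (h.depends_state hM hc hn ht).2.comp (measurable_pi_apply i)
    exact (h1.prodMk h2).comp
      (show Measurable fun w : Vec p × Vec p => (S.s t)⁻¹ • (w.1 - w.2) by fun_prop)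
  have hind : IndepFun q (ζ t i) P :=
    hqd.indep_seed h.randomness (k := (t, i)) (by simp [mem_past])
  have hpt : ∀ ω, ‖zhat ω t i - z ω t i‖ ^ 2 = S.s t ^ 2 * ‖Q (q ω) (ζ t i ω) - q ω‖ ^ 2 := by
    intro ω
    have e : zhat ω t i - z ω t i = S.s t • (Q (q ω) (ζ t i ω) - q ω) := by
      have hqω : S.s t • q ω = z ω t i - zhat ω (t - 1) i := by
        rw [hq]
        exact smul_inv_smul₀ hs.ne' _
      rw [(h.run ω).zhat_eq t ht i, smul_sub (S.s t) (Q _ _), hqω]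
      change zhat ω (t - 1) i + S.s t • Q (q ω) (ζ t i ω) - z ω t i = _
      abel
    rw [e, norm_smul, mul_pow, Real.norm_eq_abs, sq_abs]
  have hQm := h.compressor.measurable
  have hΨ : Measurable fun w : Vec p × Z =>
      ENNReal.ofReal (S.s t ^ 2 * ‖Q w.1 w.2 - w.1‖ ^ 2) :=
    ENNReal.measurable_ofReal.comp
      (measurable_const.mul ((hQm.sub measurable_fst).norm.pow_const 2))
  simp_rw [hpt]
  rw [lintegral_indep (hqd.aemeasurable h.randomness) (h.randomness.law_ζ t i) hind hΨ]
  have hprob : IsProbabilityMeasure P := inferInstance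
  calc _ ≤ ∫⁻ _ω, ENNReal.ofReal (S.s t ^ 2 * c.C) ∂P := by
        refine lintegral_mono_ae ?_
        filter_upwards [h.wellDef t ht i] with ω hω
        have := h.compressor.error _ hω.2
        simp_rw [ENNReal.ofReal_mul (sq_nonneg (S.s t))]
        rw [lintegral_const_mul']
        · gcongr
        · exact ENNReal.ofReal_ne_top
    _ = _ := by simp

theorem integrable_compErr_sq (h : Execution M c S P ν Q Y u ζ x z zhat a v) (hM : M.Standing c)
    (hc : c.Valid) (hn : 0 < n) (hS : S.Admissible p c) (ht : 1 ≤ t) (i : Fin n) :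
    Integrable (fun ω => ‖zhat ω t i - z ω t i‖ ^ 2) P := by
  refine ⟨((h.aemeasurable_compErr hM hc hn ht i).norm.pow_const 2).aestronglyMeasurable, ?_⟩
  rw [hasFiniteIntegral_iff_ofReal (ae_of_all _ fun ω => sq_nonneg _)]
  exact (h.lintegral_compErr_sq_le hM hc hn hS ht i).trans_lt ENNReal.ofReal_lt_top

theorem integral_compErr_sq_le (h : Execution M c S P ν Q Y u ζ x z zhat a v) (hM : M.Standing c)
    (hc : c.Valid) (hn : 0 < n) (hS : S.Admissible p c) (ht : 1 ≤ t) (i : Fin n) :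
    ∫ ω, ‖zhat ω t i - z ω t i‖ ^ 2 ∂P ≤ S.s t ^ 2 * c.C := by
  rw [integral_eq_lintegral_of_nonneg_ae (ae_of_all _ fun ω => sq_nonneg _)
    (h.integrable_compErr_sq hM hc hn hS ht i).aestronglyMeasurable]
  exact ENNReal.toReal_le_of_le_ofReal (mul_nonneg (sq_nonneg _) hc.C_nonneg)
    (h.lintegral_compErr_sq_le hM hc hn hS ht i)

theorem norm_compErr_le (hS : S.Admissible p c) (ht : 1 ≤ t) (w : Vec p) :
    ‖w‖ ≤ S.s t / 2 + (2 * S.s t)⁻¹ * ‖w‖ ^ 2 := by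
  have hs := hS.s_pos ht
  have : 0 ≤ (2 * S.s t)⁻¹ * (‖w‖ - S.s t) ^ 2 := by positivity
  have e : (2 * S.s t)⁻¹ * (‖w‖ - S.s t) ^ 2 = S.s t / 2 + (2 * S.s t)⁻¹ * ‖w‖ ^ 2 - ‖w‖ := by
    field_simp
    ring
  linarith

theorem integrable_compErr_norm (h : Execution M c S P ν Q Y u ζ x z zhat a v)
    (hM : M.Standing c) (hc : c.Valid) (hn : 0 < n) (hS : S.Admissible p c) (ht : 1 ≤ t)
    (i : Fin n) : Integrable (fun ω => ‖zhat ω t i - z ω t i‖) P := by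
  refine ((integrable_const (S.s t / 2)).add
    ((h.integrable_compErr_sq hM hc hn hS ht i).const_mul (2 * S.s t)⁻¹)).mono'
    (h.aemeasurable_compErr hM hc hn ht i).norm.aestronglyMeasurable (ae_of_all _ fun ω => ?_)
  rw [norm_norm]
  exact norm_compErr_le hS ht _

theorem integrable_compErr (h : Execution M c S P ν Q Y u ζ x z zhat a v)
    (hM : M.Standing c) (hc : c.Valid) (hn : 0 < n) (hS : S.Admissible p c) (ht : 1 ≤ t) :
    Integrable (fun ω => compErr (z ω) (zhat ω) t) P :=
  integrable_finsetSum _ fun i _ => h.integrable_compErr_norm hM hc hn hS ht i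

theorem integrable_compErrSq (h : Execution M c S P ν Q Y u ζ x z zhat a v)
    (hM : M.Standing c) (hc : c.Valid) (hn : 0 < n) (hS : S.Admissible p c) (ht : 1 ≤ t) :
    Integrable (fun ω => compErrSq (z ω) (zhat ω) t) P :=
  integrable_finsetSum _ fun i _ => h.integrable_compErr_sq hM hc hn hS ht i

theorem integral_compErr_le (h : Execution M c S P ν Q Y u ζ x z zhat a v)
    (hM : M.Standing c) (hc : c.Valid) (hn : 0 < n) (hS : S.Admissible p c) (ht : 1 ≤ t) :
    ∫ ω, compErr (z ω) (zhat ω) t ∂P ≤ n * (1 + c.C) * S.s t := by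
  have hs := hS.s_pos ht
  have hi : ∀ i, ∫ ω, ‖zhat ω t i - z ω t i‖ ∂P ≤ (1 + c.C) * S.s t := by
    intro i
    have h1 := (h.integrable_compErr_sq hM hc hn hS ht i).const_mul (2 * S.s t)⁻¹
    have h2 := integral_mono (h.integrable_compErr_norm hM hc hn hS ht i)
      ((integrable_const (S.s t / 2)).add h1) fun ω => norm_compErr_le hS ht _
    simp only [Pi.add_apply] at h2
    rw [integral_add (integrable_const _) h1, integral_const_mul] at h2
    have h3 := mul_le_mul_of_nonneg_left (h.integral_compErr_sq_le hM hc hn hS ht i)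
      (show 0 ≤ (2 * S.s t)⁻¹ by positivity)
    have h4 : (2 * S.s t)⁻¹ * (S.s t ^ 2 * c.C) = S.s t / 2 * c.C := by field_simp
    simp only [integral_const, probReal_univ, one_smul] at h2
    have := mul_nonneg hs.le hc.C_nonneg
    linarith
  unfold compErr
  rw [integral_finsetSum _ fun i _ => h.integrable_compErr_norm hM hc hn hS ht i]
  refine (Finset.sum_le_sum fun i _ => hi i).trans (le_of_eq ?_)
  simp [mul_assoc]

theorem integral_compErrSq_le (h : Execution M c S P ν Q Y u ζ x z zhat a v)
    (hM : M.Standing c) (hc : c.Valid) (hn : 0 < n) (hS : S.Admissible p c) (ht : 1 ≤ t) :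
    ∫ ω, compErrSq (z ω) (zhat ω) t ∂P ≤ n * (S.s t ^ 2 * c.C) := by
  unfold compErrSq
  rw [integral_finsetSum _ fun i _ => h.integrable_compErr_sq hM hc hn hS ht i]
  refine (Finset.sum_le_sum fun i _ => h.integral_compErr_sq_le hM hc hn hS ht i).trans
    (le_of_eq ?_)
  simp

theorem ae_norm_a_le (h : Execution M c S P ν Q Y u ζ x z zhat a v) (hM : M.Standing c)
    (hc : c.Valid) (hn : 0 < n) (hS : S.Admissible p c) (ht : 1 ≤ t) (i : Fin n) :
    ∀ᵐ ω ∂P, ‖a ω (t + 1) i‖ ≤ estBound p c S t := by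
  filter_upwards [h.ae_a_eq ht i, h.ae_norm_direction t i] with ω h1 h2
  rw [h1]
  exact hM.norm_gradEst_le hc hn hS ht _ h2

theorem depends_meanEst (h : Execution M c S P ν Q Y u ζ x z zhat a v) (hM : M.Standing c)
    (hc : c.Valid) (hn : 0 < n) (hp : 0 < p) (ht : 1 ≤ t) (i : Fin n) :
    Depends P u ζ (past n t) (past n (t + 1)) fun ω => M.meanEst c S i t (x ω t i) :=
  (h.depends_x hM hc hn ht i).comp (hM.measurable_meanEst hc hn hp ht)

theorem depends_estNoise (h : Execution M c S P ν Q Y u ζ x z zhat a v) (hM : M.Standing c)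
    (hc : c.Valid) (hn : 0 < n) (hp : 0 < p) (ht : 1 ≤ t) (i : Fin n) :
    Depends P u ζ (past n (t + 1)) (past n (t + 1)) (estNoise M c S x a t i) :=
  ((h.depends_a hM hc hn ht i).prodMk ((h.depends_meanEst hM hc hn hp ht i).mono
    (past_mono (Nat.le_succ t)) (subset_refl _))).comp
    (show Measurable fun q : Vec p × Vec p => q.1 - q.2 by fun_prop)

theorem ae_norm_estNoise_le (h : Execution M c S P ν Q Y u ζ x z zhat a v) (hM : M.Standing c)
    (hc : c.Valid) (hn : 0 < n) (hp : 0 < p) (hS : S.Admissible p c) (ht : 1 ≤ t) (i : Fin n) :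
    ∀ᵐ ω ∂P, ‖estNoise M c S x a t i ω‖ ≤ 2 * estBound p c S t := by
  filter_upwards [h.ae_norm_a_le hM hc hn hS ht i] with ω h1
  have h2 := hM.norm_meanEst_le hc hn hp hS ht (i := i) (x ω t i)
  exact (norm_sub_le _ _).trans (by linarith)

theorem integrable_inner_of_bound {f g : Ω → Vec p} {A B : ℝ} (hf : AEMeasurable f P)
    (hg : AEMeasurable g P) (hfb : ∀ᵐ ω ∂P, ‖f ω‖ ≤ A) (hgb : ∀ᵐ ω ∂P, ‖g ω‖ ≤ B) :
    Integrable (fun ω => inner ℝ (f ω) (g ω)) P := by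
  refine Integrable.of_bound (C := A * B) (hf.inner hg).aestronglyMeasurable ?_
  filter_upwards [hfb, hgb] with ω h1 h2
  exact (norm_inner_le_norm _ _).trans
    (mul_le_mul h1 h2 (norm_nonneg _) ((norm_nonneg _).trans h1))

/-- The estimation noise at time `t` is orthogonal to everything that precedes the draw of the
directions of time `t`. -/
theorem integral_inner_estNoise_eq_zero (h : Execution M c S P ν Q Y u ζ x z zhat a v)
    (hM : M.Standing c) (hc : c.Valid) (hn : 0 < n) (hp : 0 < p) (hS : S.Admissible p c)
    (ht : 1 ≤ t) (i : Fin n) {φ : Ω → Vec p} {B : ℝ}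
    (hφ : Depends P u ζ (past n t) (past n (t + 1)) φ) (hB : ∀ᵐ ω ∂P, ‖φ ω‖ ≤ B) :
    ∫ ω, inner ℝ (estNoise M c S x a t i ω) (φ ω) ∂P = 0 := by
  have hprob := isProbabilityMeasure_uniformSphere hp
  have hX : Depends P u ζ (past n t) (past n (t + 1)) fun ω => (x ω t i, φ ω) :=
    (h.depends_x hM hc hn ht i).prodMk hφ
  set Ψ : (Vec p × Vec p) × Vec p → ℝ := fun q =>
    inner ℝ (M.gradEst c S i t q.1.1 q.2 - M.meanEst c S i t q.1.1) q.1.2 with hΨdef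
  have hΨ : Measurable Ψ := by
    have h1 := (hM.measurable_gradEst (S := S) (i := i) hc hn ht).comp
      (show Measurable fun q : (Vec p × Vec p) × Vec p => (q.1.1, q.2) by fun_prop)
    have h2 := (hM.measurable_meanEst (S := S) (i := i) hc hn hp ht).comp
      (show Measurable fun q : (Vec p × Vec p) × Vec p => q.1.1 by fun_prop)
    exact Measurable.inner (h1.sub h2) (by fun_prop)
  have he : (fun ω => inner ℝ (estNoise M c S x a t i ω) (φ ω)) =ᵐ[P]
      fun ω => Ψ ((x ω t i, φ ω), u t i ω) := by
    filter_upwards [h.ae_a_eq ht i] with ω hω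
    simp only [estNoise, hω, Ψ]
  have hint : Integrable (fun ω => inner ℝ (estNoise M c S x a t i ω) (φ ω)) P :=
    integrable_inner_of_bound ((h.depends_estNoise hM hc hn hp ht i).aemeasurable h.randomness)
      (hφ.aemeasurable h.randomness) (h.ae_norm_estNoise_le hM hc hn hp hS ht i) hB
  rw [integral_congr_ae he, integral_indep (X := fun ω => (x ω t i, φ ω))
    (hX.aemeasurable h.randomness) (h.randomness.law_u t i) (h.indep_x_direction hX i) hΨ
    ((integrable_congr he).1 hint)]
  have hzero : ∀ ω, ∫ b, Ψ ((x ω t i, φ ω), b) ∂(uniformSphere p) = 0 := by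
    intro ω
    have hi := hM.integrable_gradEst (i := i) hc hn hp hS ht (x ω t i)
    simp only [Ψ, inner_sub_left]
    rw [integral_sub (hi.inner_const _) (integrable_const _),
      ← hM.inner_meanEst hc hn hp hS ht]
    simp
  simp [hzero]

theorem integrable_sq_norm_of_bound {f : Ω → Vec p} {A : ℝ} (hf : AEMeasurable f P)
    (hfb : ∀ᵐ ω ∂P, ‖f ω‖ ≤ A) : Integrable (fun ω => ‖f ω‖ ^ 2) P := by
  refine (integrable_inner_of_bound hf hf hfb hfb).congr (ae_of_all _ fun ω => ?_)
  exact real_inner_self_eq_norm_sq _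

theorem integrable_sq_a (h : Execution M c S P ν Q Y u ζ x z zhat a v) (hM : M.Standing c)
    (hc : c.Valid) (hn : 0 < n) (hS : S.Admissible p c) (ht : 1 ≤ t) (i : Fin n) :
    Integrable (fun ω => ‖a ω (t + 1) i‖ ^ 2) P :=
  integrable_sq_norm_of_bound (h.aemeasurable_a hM hc hn ht i)
    (h.ae_norm_a_le hM hc hn hS ht i)

/-- Centring an estimate does not increase its second moment. -/
theorem integral_sq_estNoise_le (h : Execution M c S P ν Q Y u ζ x z zhat a v)
    (hM : M.Standing c) (hc : c.Valid) (hn : 0 < n) (hp : 0 < p) (hS : S.Admissible p c)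
    (ht : 1 ≤ t) (i : Fin n) :
    ∫ ω, ‖estNoise M c S x a t i ω‖ ^ 2 ∂P ≤ ∫ ω, ‖a ω (t + 1) i‖ ^ 2 ∂P := by
  have hA := h.depends_meanEst hM hc hn hp ht i
  have hAb : ∀ᵐ ω ∂P, ‖M.meanEst c S i t (x ω t i)‖ ≤ estBound p c S t :=
    ae_of_all _ fun ω => hM.norm_meanEst_le hc hn hp hS ht _
  have hN := (h.depends_estNoise hM hc hn hp ht i).aemeasurable h.randomness
  have hNb := h.ae_norm_estNoise_le hM hc hn hp hS ht i
  have i1 := integrable_inner_of_bound hN (hA.aemeasurable h.randomness) hNb hAb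
  have h0 := h.integral_inner_estNoise_eq_zero hM hc hn hp hS ht i hA hAb
  have hle : ∀ ω, ‖estNoise M c S x a t i ω‖ ^ 2 ≤ ‖a ω (t + 1) i‖ ^ 2 -
      2 * inner ℝ (estNoise M c S x a t i ω) (M.meanEst c S i t (x ω t i)) := by
    intro ω
    have e : a ω (t + 1) i = estNoise M c S x a t i ω + M.meanEst c S i t (x ω t i) := by
      simp [estNoise]
    rw [e, norm_add_sq_real]
    linarith [sq_nonneg ‖M.meanEst c S i t (x ω t i)‖]
  have h1 := integral_mono (integrable_sq_norm_of_bound hN hNb)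
    ((h.integrable_sq_a hM hc hn hS ht i).sub (i1.const_mul 2)) hle
  simp only [Pi.sub_apply] at h1
  rw [integral_sub (h.integrable_sq_a hM hc hn hS ht i) (i1.const_mul 2), integral_const_mul, h0,
    mul_zero, sub_zero] at h1
  exact h1

/-- The accumulated estimation noise of all agents, weighted by the shrinkage factors. -/
def noiseSum (M : Problem n p) (c : Constants) (S : Schedule) (x a : Ω → ℕ → Fin n → Vec p)
    (T : ℕ) (ω : Ω) : Vec p :=
  ∑ t ∈ Finset.Icc 1 T, (1 - S.ξ t) • ∑ i, estNoise M c S x a t i ω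

theorem depends_noiseSum (h : Execution M c S P ν Q Y u ζ x z zhat a v) (hM : M.Standing c)
    (hc : c.Valid) (hn : 0 < n) (hp : 0 < p) (T : ℕ) :
    Depends P u ζ (past n (T + 1)) (past n (T + 1)) (noiseSum M c S x a T) := by
  have h1 : ∀ k : Finset.Icc 1 T × Fin n,
      Depends P u ζ (past n (T + 1)) (past n (T + 1)) (estNoise M c S x a k.1 k.2) := by
    intro k
    have hk := Finset.mem_Icc.1 k.1.2
    exact (h.depends_estNoise hM hc hn hp hk.1 k.2).mono (past_mono (by omega))
      (past_mono (by omega))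
  have hm : Measurable fun q : Finset.Icc 1 T × Fin n → Vec p =>
      ∑ t : Finset.Icc 1 T, (1 - S.ξ t) • ∑ i, q (t, i) := by fun_prop
  refine ((Depends.pi h1).comp hm).congr (ae_of_all _ fun ω => ?_)
  exact (Finset.sum_coe_sort (Finset.Icc 1 T)
    fun t => (1 - S.ξ t) • ∑ i, estNoise M c S x a t i ω).symm

theorem exists_noiseSum_bound (h : Execution M c S P ν Q Y u ζ x z zhat a v) (hM : M.Standing c)
    (hc : c.Valid) (hn : 0 < n) (hp : 0 < p) (hS : S.Admissible p c) (T : ℕ) :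
    ∃ B : ℝ, ∀ᵐ ω ∂P, ‖noiseSum M c S x a T ω‖ ≤ B := by
  refine ⟨∑ t ∈ Finset.Icc 1 T, ‖1 - S.ξ t‖ * ∑ _i : Fin n, 2 * estBound p c S t, ?_⟩
  have h1 : ∀ᵐ ω ∂P, ∀ k : Finset.Icc 1 T × Fin n,
      ‖estNoise M c S x a k.1 k.2 ω‖ ≤ 2 * estBound p c S k.1 :=
    ae_all_iff.2 fun k => h.ae_norm_estNoise_le hM hc hn hp hS (Finset.mem_Icc.1 k.1.2).1 k.2
  filter_upwards [h1] with ω hω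
  refine (norm_sum_le _ _).trans (Finset.sum_le_sum fun t ht => ?_)
  rw [norm_smul]
  gcongr
  exact (norm_sum_le _ _).trans (Finset.sum_le_sum fun i _ => hω (⟨t, ht⟩, i))

/-- The accumulated noise is a martingale, so its second moment is additive. -/
theorem integral_sq_noiseSum_le (h : Execution M c S P ν Q Y u ζ x z zhat a v)
    (hM : M.Standing c) (hc : c.Valid) (hn : 0 < n) (hp : 0 < p) (hS : S.Admissible p c)
    (T : ℕ) : ∫ ω, ‖noiseSum M c S x a T ω‖ ^ 2 ∂P ≤
      n * ∑ t ∈ Finset.Icc 1 T, ∑ i, ∫ ω, ‖a ω (t + 1) i‖ ^ 2 ∂P := by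
  induction T with
  | zero => simp [noiseSum]
  | succ T ih =>
    have ht : 1 ≤ T + 1 := by omega
    obtain ⟨B, hB⟩ := h.exists_noiseSum_bound hM hc hn hp hS T
    have hD := h.depends_noiseSum hM hc hn hp T
    have hD' : Depends P u ζ (past n (T + 1)) (past n (T + 1 + 1)) (noiseSum M c S x a T) :=
      hD.mono (subset_refl _) (past_mono (Nat.le_succ _))
    have hDm := hD.aemeasurable h.randomness
    have hN : ∀ i, AEMeasurable (estNoise M c S x a (T + 1) i) P := fun i =>
      (h.depends_estNoise hM hc hn hp ht i).aemeasurable h.randomness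
    have hNb := fun i => h.ae_norm_estNoise_le hM hc hn hp hS ht i
    have i0 := integrable_sq_norm_of_bound hDm hB
    have i1 : ∀ i, Integrable (fun ω => inner ℝ (estNoise M c S x a (T + 1) i ω)
        (noiseSum M c S x a T ω)) P := fun i => integrable_inner_of_bound (hN i) hDm (hNb i) hB
    have i2 : ∀ i, Integrable (fun ω => ‖estNoise M c S x a (T + 1) i ω‖ ^ 2) P := fun i =>
      integrable_sq_norm_of_bound (hN i) (hNb i)
    set w := 1 - S.ξ (T + 1) with hw
    have hw0 : 0 ≤ w := sub_nonneg.2 (hS.ξ_le_one ht)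
    have hw1 : w ≤ 1 := by linarith [ξ_pos (S := S) ht]
    have hle : ∀ ω, ‖noiseSum M c S x a (T + 1) ω‖ ^ 2 ≤ ‖noiseSum M c S x a T ω‖ ^ 2 +
        2 * w * ∑ i, inner ℝ (estNoise M c S x a (T + 1) i ω) (noiseSum M c S x a T ω) +
        n * ∑ i, ‖estNoise M c S x a (T + 1) i ω‖ ^ 2 := by
      intro ω
      have e : noiseSum M c S x a (T + 1) ω = noiseSum M c S x a T ω +
          w • ∑ i, estNoise M c S x a (T + 1) i ω := by
        rw [noiseSum, Finset.sum_Icc_succ_top (by omega)]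
        rfl
      have h1 : ‖w • ∑ i, estNoise M c S x a (T + 1) i ω‖ ^ 2 ≤
          n * ∑ i, ‖estNoise M c S x a (T + 1) i ω‖ ^ 2 := by
        rw [norm_smul, Real.norm_of_nonneg hw0]
        calc (w * ‖∑ i, estNoise M c S x a (T + 1) i ω‖) ^ 2
            ≤ (∑ i, ‖estNoise M c S x a (T + 1) i ω‖) ^ 2 := by
              refine pow_le_pow_left₀ (by positivity) ?_ 2
              exact (mul_le_of_le_one_left (norm_nonneg _) hw1).trans (norm_sum_le _ _)
          _ ≤ _ := by
              have := sq_sum_le_card_mul_sum_sq (s := (Finset.univ : Finset (Fin n)))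
                (f := fun i => ‖estNoise M c S x a (T + 1) i ω‖)
              simpa using this
      rw [e, norm_add_sq_real, inner_smul_right, inner_sum, Finset.mul_sum, Finset.mul_sum]
      simp_rw [real_inner_comm (noiseSum M c S x a T ω)]
      rw [← Finset.mul_sum, ← Finset.mul_sum, mul_assoc]
      linarith
    obtain ⟨B', hB'⟩ := h.exists_noiseSum_bound hM hc hn hp hS (T + 1)
    have i3 := integrable_sq_norm_of_bound
      ((h.depends_noiseSum hM hc hn hp (T + 1)).aemeasurable h.randomness) hB'
    have i4 : Integrable (fun ω => 2 * w * ∑ i, inner ℝ (estNoise M c S x a (T + 1) i ω)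
        (noiseSum M c S x a T ω)) P := (integrable_finsetSum _ fun i _ => i1 i).const_mul _
    have i5 : Integrable (fun ω => n * ∑ i, ‖estNoise M c S x a (T + 1) i ω‖ ^ 2) P :=
      (integrable_finsetSum _ fun i _ => i2 i).const_mul _
    have h2 := integral_mono i3 ((i0.add i4).add i5) hle
    simp only [Pi.add_apply] at h2
    rw [integral_add (f := fun ω => ‖noiseSum M c S x a T ω‖ ^ 2 + 2 * w *
      ∑ i, inner ℝ (estNoise M c S x a (T + 1) i ω) (noiseSum M c S x a T ω)) (i0.add i4) i5,
      integral_add i0 i4, integral_const_mul, integral_const_mul,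
      integral_finsetSum _ fun i _ => i1 i, integral_finsetSum _ fun i _ => i2 i] at h2
    have h3 : ∀ i, ∫ ω, inner ℝ (estNoise M c S x a (T + 1) i ω) (noiseSum M c S x a T ω) ∂P = 0 :=
      fun i => h.integral_inner_estNoise_eq_zero hM hc hn hp hS ht i hD' hB
    simp only [h3, Finset.sum_const_zero, mul_zero, add_zero] at h2
    rw [Finset.sum_Icc_succ_top (by omega), mul_add]
    refine h2.trans (add_le_add ih ?_)
    refine mul_le_mul_of_nonneg_left (Finset.sum_le_sum fun i _ => ?_) (Nat.cast_nonneg n)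
    exact h.integral_sq_estNoise_le hM hc hn hp hS ht i

end Execution

end Randomness

/-! ### Power bounds and rates of the schedules -/

section PowerRates

open Filter Topology

section PowerBounds

/-- `|f t|` is at most a constant times `t ^ a`, for all `t ≥ 1`. -/
def PowerBounded (f : ℕ → ℝ) (a : ℝ) : Prop :=
  ∃ K : ℝ, ∀ t : ℕ, 1 ≤ t → |f t| ≤ K * (t : ℝ) ^ a

theorem rpow_sub_one_le {b : ℝ} (hb0 : 0 < b) (hb1 : b ≤ 1) {t : ℕ} (ht : 1 ≤ t) :
    b * (t : ℝ) ^ (b - 1) ≤ (t : ℝ) ^ b - ((t - 1 : ℕ) : ℝ) ^ b := by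
  have h1 : (1 : ℝ) ≤ t := by exact_mod_cast ht
  have h0 : (0 : ℝ) < t := by linarith
  have e : ((t - 1 : ℕ) : ℝ) = t * (1 + -(1 / (t : ℝ))) := by
    rw [Nat.cast_sub ht]
    field_simp
    simp [sub_eq_add_neg]
  have hle : 1 / (t : ℝ) ≤ 1 := (div_le_one h0).2 h1
  have h2 := rpow_one_add_le_one_add_mul_self (s := -(1 / (t : ℝ))) (by linarith) hb0.le hb1
  rw [e, Real.mul_rpow h0.le (by linarith), Real.rpow_sub_one h0.ne']
  have h3 := mul_le_mul_of_nonneg_left h2 (Real.rpow_nonneg h0.le b)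
  have e2 : (t : ℝ) ^ b * (1 + b * -(1 / (t : ℝ))) = (t : ℝ) ^ b - b * ((t : ℝ) ^ b / t) := by
    field_simp
    ring
  linarith

theorem sum_rpow_le {a : ℝ} (ha : -1 < a) (T : ℕ) :
    ∑ t ∈ Finset.Icc 1 T, (t : ℝ) ^ a ≤ max 1 (1 / (a + 1)) * (T : ℝ) ^ (a + 1) := by
  have hT0 : (0 : ℝ) ≤ T := Nat.cast_nonneg T
  rcases le_or_gt 0 a with h | h
  · have h1 : ∑ t ∈ Finset.Icc 1 T, (t : ℝ) ^ a ≤ ∑ _t ∈ Finset.Icc 1 T, (T : ℝ) ^ a := by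
      refine Finset.sum_le_sum fun t ht => ?_
      have := (Finset.mem_Icc.1 ht).2
      gcongr
    have h2 : ∑ _t ∈ Finset.Icc 1 T, (T : ℝ) ^ a = (T : ℝ) ^ (a + 1) := by
      rw [Real.rpow_add_one' hT0 (by linarith)]
      simp [mul_comm]
    rw [h2] at h1
    exact h1.trans (le_mul_of_one_le_left (Real.rpow_nonneg hT0 _) (le_max_left _ _))
  · have hb : 0 < a + 1 := by linarith
    have h1 : ∑ t ∈ Finset.Icc 1 T, (a + 1) * (t : ℝ) ^ a ≤ (T : ℝ) ^ (a + 1) := by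
      induction T with
      | zero => simp [Real.zero_rpow hb.ne']
      | succ T ih =>
        rw [Finset.sum_Icc_succ_top (by omega)]
        have h3 := rpow_sub_one_le hb (by linarith) (show 1 ≤ T + 1 by omega)
        simp only [add_sub_cancel_right, Nat.add_sub_cancel] at h3
        linarith [ih (Nat.cast_nonneg T)]
    rw [← Finset.mul_sum] at h1
    have h2 : ∑ t ∈ Finset.Icc 1 T, (t : ℝ) ^ a ≤ 1 / (a + 1) * (T : ℝ) ^ (a + 1) := by
      rw [one_div_mul_eq_div, le_div_iff₀ hb]
      linarith
    exact h2.trans (mul_le_mul_of_nonneg_right (le_max_right _ _) (Real.rpow_nonneg hT0 _))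

namespace PowerBounded

variable {f g : ℕ → ℝ} {a b : ℝ}

theorem rpow (a : ℝ) : PowerBounded (fun t => (t : ℝ) ^ a) a :=
  ⟨1, fun t _ => by rw [abs_of_nonneg (by positivity), one_mul]⟩

theorem const (b : ℝ) : PowerBounded (fun _ => b) 0 := ⟨|b|, fun t _ => by simp⟩

theorem add (hf : PowerBounded f a) (hg : PowerBounded g a) :
    PowerBounded (fun t => f t + g t) a := by
  obtain ⟨K, hK⟩ := hf
  obtain ⟨K', hK'⟩ := hg
  refine ⟨K + K', fun t ht => (abs_add_le _ _).trans ?_⟩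
  rw [add_mul]
  exact add_le_add (hK t ht) (hK' t ht)

theorem mul (hf : PowerBounded f a) (hg : PowerBounded g b) :
    PowerBounded (fun t => f t * g t) (a + b) := by
  obtain ⟨K, hK⟩ := hf
  obtain ⟨K', hK'⟩ := hg
  refine ⟨K * K', fun t ht => ?_⟩
  have h0 : (0 : ℝ) < t := by exact_mod_cast ht
  rw [abs_mul, Real.rpow_add h0, mul_mul_mul_comm]
  exact mul_le_mul (hK t ht) (hK' t ht) (abs_nonneg _) ((abs_nonneg _).trans (hK t ht))

theorem const_mul (hf : PowerBounded f a) (b : ℝ) : PowerBounded (fun t => b * f t) a := by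
  simpa using (const b).mul hf

theorem exists_nonneg (hf : PowerBounded f a) :
    ∃ K : ℝ, 0 ≤ K ∧ ∀ t : ℕ, 1 ≤ t → |f t| ≤ K * (t : ℝ) ^ a := by
  obtain ⟨K, hK⟩ := hf
  exact ⟨K, (abs_nonneg _).trans (by simpa using hK 1 le_rfl), hK⟩

theorem mono (hf : PowerBounded f a) (h : a ≤ b) : PowerBounded f b := by
  obtain ⟨K, hK0, hK⟩ := hf.exists_nonneg
  refine ⟨K, fun t ht => (hK t ht).trans ?_⟩
  have h1 : (1 : ℝ) ≤ t := by exact_mod_cast ht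
  gcongr

theorem congr (hf : PowerBounded f a) (h : ∀ t, 1 ≤ t → g t = f t) : PowerBounded g a := by
  obtain ⟨K, hK⟩ := hf
  exact ⟨K, fun t ht => by rw [h t ht]; exact hK t ht⟩

theorem sum (hf : PowerBounded f a) (ha : -1 < a) :
    PowerBounded (fun T => ∑ t ∈ Finset.Icc 1 T, f t) (a + 1) := by
  obtain ⟨K, hK0, hK⟩ := hf.exists_nonneg
  refine ⟨K * max 1 (1 / (a + 1)), fun T _ => (Finset.abs_sum_le_sum_abs _ _).trans ?_⟩
  refine (Finset.sum_le_sum fun t ht => hK t (Finset.mem_Icc.1 ht).1).trans ?_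
  rw [← Finset.mul_sum, mul_assoc]
  exact mul_le_mul_of_nonneg_left (sum_rpow_le ha T) hK0

end PowerBounded

/-- A telescoping sum with nondecreasing weights. -/
theorem sum_mul_sub_succ_le {β U : ℕ → ℝ} {D : ℝ} (hβ : ∀ t, 1 ≤ t → β t ≤ β (t + 1))
    (hβ0 : ∀ t, 1 ≤ t → 0 ≤ β t) (hU0 : ∀ t, 1 ≤ t → 0 ≤ U t) (hU : ∀ t, 1 ≤ t → U t ≤ D) {T : ℕ}
    (hT : 1 ≤ T) : ∑ t ∈ Finset.Icc 1 T, β t * (U t - U (t + 1)) ≤ β T * D := by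
  have key : ∑ t ∈ Finset.Icc 1 T, β t * (U t - U (t + 1)) ≤ β T * D - β T * U (T + 1) := by
    induction T, hT using Nat.le_induction with
    | base =>
      have := mul_le_mul_of_nonneg_left (hU 1 le_rfl) (hβ0 1 le_rfl)
      simp only [Finset.Icc_self, Finset.sum_singleton]
      linarith
    | succ T hT ih =>
      rw [Finset.sum_Icc_succ_top (by omega)]
      have := mul_nonneg (sub_nonneg.2 (hβ T hT)) (sub_nonneg.2 (hU (T + 1) (by omega)))
      linarith
  have := mul_nonneg (hβ0 T hT) (hU0 (T + 1) (by omega))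
  linarith

end PowerBounds

section Rates

variable {S : Schedule} {p : ℕ} {c : Constants}

namespace Schedule

/-- `K` bounds the part of the weighted second moment of the estimates that the decrease of the
squared violation does not pay for. -/
def VarianceBound (S : Schedule) (p : ℕ) (c : Constants) (K : ℝ) : Prop :=
  ∀ t : ℕ, 1 ≤ t → ∀ h : ℝ, 0 ≤ h → h ≤ c.F₂ ^ 2 →
    S.α t * ((p / S.δ c.r t) ^ 2 * (2 * c.F₁ ^ 2 + 2 * S.γ t ^ 2 * c.F₂ ^ 2 * h)) ≤
      K * (S.α t / S.δ c.r t ^ 2) + S.γ t * h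

theorem powerBounded_α : PowerBounded S.α (-S.θ₁) :=
  ((PowerBounded.rpow (-S.θ₁)).const_mul S.α₀).congr fun t _ => by
    rw [α, Real.rpow_neg (by positivity), div_eq_mul_inv]

theorem powerBounded_inv_α : PowerBounded (fun t => (S.α t)⁻¹) S.θ₁ :=
  ((PowerBounded.rpow S.θ₁).const_mul S.α₀⁻¹).congr fun t _ => by
    rw [α, inv_div, div_eq_inv_mul]

theorem powerBounded_γ : PowerBounded S.γ S.θ₂ :=
  ((PowerBounded.rpow S.θ₂).const_mul S.γ₀).congr fun t _ => by rw [γ]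

theorem powerBounded_inv_γ : PowerBounded (fun t => (S.γ t)⁻¹) (-S.θ₂) :=
  ((PowerBounded.rpow (-S.θ₂)).const_mul S.γ₀⁻¹).congr fun t _ => by
    rw [γ, mul_inv, Real.rpow_neg (by positivity)]

theorem powerBounded_ξ : PowerBounded S.ξ (-S.θ₃) :=
  (PowerBounded.rpow (-S.θ₃)).congr fun t _ => by
    rw [ξ, Real.rpow_neg (by positivity), one_div]

theorem powerBounded_δ : PowerBounded (S.δ c.r) (-S.θ₃) :=
  (powerBounded_ξ.const_mul c.r).congr fun t _ => S.δ_eq c.r t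

theorem powerBounded_inv_δ : PowerBounded (fun t => (S.δ c.r t)⁻¹) S.θ₃ :=
  ((PowerBounded.rpow S.θ₃).const_mul c.r⁻¹).congr fun t _ => by
    rw [δ, inv_div, div_eq_inv_mul]

namespace Admissible

theorem powerBounded_s (hS : S.Admissible p c) : PowerBounded S.s (-1) := by
  refine PowerBounded.mono (a := -S.θ₄) ?_ (by linarith [hS.θ₄_ge])
  exact ((PowerBounded.rpow (-S.θ₄)).const_mul S.s₀).congr fun t _ => by
    rw [s, Real.rpow_neg (by positivity), div_eq_mul_inv]

theorem inv_α_le_succ (hS : S.Admissible p c) {t : ℕ} (ht : 1 ≤ t) :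
    (S.α t)⁻¹ ≤ (S.α (t + 1))⁻¹ := by
  have h0 : (0 : ℝ) < t := by exact_mod_cast ht
  have := hS.α₀_pos
  have := hS.θ₁_mem.1
  simp only [α, inv_div]
  gcongr
  simp

theorem α_antitone (hS : S.Admissible p c) {t T : ℕ} (ht : 1 ≤ t) (hT : t ≤ T) :
    S.α T ≤ S.α t := by
  have h0 : (0 : ℝ) < t := by exact_mod_cast ht
  have := hS.α₀_pos
  have := hS.θ₁_mem.1
  simp only [α]
  gcongr

theorem s_succ_le (hS : S.Admissible p c) {t : ℕ} (ht : 1 ≤ t) : S.s (t + 1) ≤ S.s t := by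
  have h0 : (0 : ℝ) < t := by exact_mod_cast ht
  have := hS.s₀_pos
  have := hS.θ₄_ge
  simp only [s]
  gcongr
  simp

theorem γ_monotone (hS : S.Admissible p c) {t T : ℕ} (hT : t ≤ T) : S.γ t ≤ S.γ T := by
  have := hS.γ₀_mem.1
  have := hS.θ₂_mem.1
  simp only [γ]
  gcongr

theorem inv_αγ_le_succ (hS : S.Admissible p c) {t : ℕ} (ht : 1 ≤ t) :
    (S.α t * S.γ t)⁻¹ ≤ (S.α (t + 1) * S.γ (t + 1))⁻¹ := by
  have e : ∀ t : ℕ, 1 ≤ t → (S.α t * S.γ t)⁻¹ = (S.α₀ * S.γ₀)⁻¹ * (t : ℝ) ^ (S.θ₁ - S.θ₂) := by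
    intro t ht
    have h0 : (0 : ℝ) < t := by exact_mod_cast ht
    rw [α, γ, Real.rpow_sub h0, mul_inv, mul_inv, mul_inv, inv_div]
    field_simp
  have h0 : (0 : ℝ) < t := by exact_mod_cast ht
  rw [e t ht, e (t + 1) (by omega)]
  have := hS.α₀_pos
  have := hS.γ₀_mem.1
  have := hS.θ₂_mem
  have h3 : 0 ≤ S.θ₁ - S.θ₂ := by linarith [this.2, hS.θ₁_mem.1]
  gcongr
  simp

theorem eventually_ξ_le (hS : S.Admissible p c) {ε : ℝ} (hε : 0 < ε) :
    ∃ t₀ : ℕ, ∀ t, t₀ ≤ t → S.ξ t ≤ ε := by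
  have h := (tendsto_rpow_neg_atTop hS.θ₃_pos).comp (tendsto_natCast_atTop_atTop (R := ℝ))
  obtain ⟨t₀, h₀⟩ := eventually_atTop.1 (h.eventually (ge_mem_nhds hε))
  refine ⟨t₀, fun t ht => ?_⟩
  have := h₀ t ht
  simp only [Function.comp] at this
  rwa [ξ, one_div, ← Real.rpow_neg (by positivity)]

/-- Eventually the step is so short that the second moment of the penalty part of the estimate is
paid for by the decrease of the squared violation. In the borderline case this is an assumption on
the constants. -/
theorem exists_αγ_le (hS : S.Admissible p c) (hc : c.Valid) :
    ∃ t₀ : ℕ, ∀ t, t₀ ≤ t → 1 ≤ t →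
      2 * (p : ℝ) ^ 2 * c.F₂ ^ 2 * (S.α t * S.γ t) ≤ S.δ c.r t ^ 2 := by
  have hr := hc.r_pos
  have hF := hc.F₂_pos
  have hα := hS.α₀_pos
  have hγ := hS.γ₀_mem.1
  have h2 := hS.θ₃_mem.2
  set A := 2 * (p : ℝ) ^ 2 * c.F₂ ^ 2 * (S.α₀ * S.γ₀)
  set κ := S.θ₁ - S.θ₂ - 2 * S.θ₃ with hκ
  have e1 : ∀ t : ℕ, 1 ≤ t → 2 * (p : ℝ) ^ 2 * c.F₂ ^ 2 * (S.α t * S.γ t) =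
      A * (t : ℝ) ^ (-κ) * (1 / (t : ℝ) ^ S.θ₃) ^ 2 := by
    intro t ht
    have h0 : (0 : ℝ) < t := by exact_mod_cast ht
    have e2 : (t : ℝ) ^ (-κ) = (t : ℝ) ^ S.θ₂ * ((t : ℝ) ^ S.θ₃) ^ 2 / (t : ℝ) ^ S.θ₁ := by
      rw [← Real.rpow_natCast ((t : ℝ) ^ S.θ₃), ← Real.rpow_mul h0.le, ← Real.rpow_add h0,
        ← Real.rpow_sub h0]
      congr 1
      push_cast
      rw [hκ]
      ring
    rw [e2, α, γ]
    field_simp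
    simp only [A]
    ring
  have e3 : ∀ t : ℕ, S.δ c.r t ^ 2 = c.r ^ 2 * (1 / (t : ℝ) ^ S.θ₃) ^ 2 := by
    intro t
    rw [δ_eq, ξ, mul_pow]
  suffices h : ∃ t₀ : ℕ, ∀ t, t₀ ≤ t → A * (t : ℝ) ^ (-κ) ≤ c.r ^ 2 by
    obtain ⟨t₀, h⟩ := h
    refine ⟨t₀, fun t ht ht1 => ?_⟩
    rw [e1 t ht1, e3]
    exact mul_le_mul_of_nonneg_right (h t ht) (sq_nonneg _)
  rcases h2.eq_or_lt with h3 | h3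
  · have hκ0 : κ = 0 := by
      rw [hκ]
      linarith
    have h4 := hS.borderline h3
    refine ⟨0, fun t _ => ?_⟩
    rw [hκ0, neg_zero, Real.rpow_zero, mul_one]
    rcases Nat.eq_zero_or_pos p with rfl | hp
    · simp only [A]
      simp
      positivity
    · have hp' : (0 : ℝ) < p := by exact_mod_cast hp
      rw [le_div_iff₀ (by positivity)] at h4
      simp only [A]
      linarith
  · have hκ0 : 0 < κ := by
      rw [hκ]
      linarith
    have h := ((tendsto_rpow_neg_atTop hκ0).comp
      (tendsto_natCast_atTop_atTop (R := ℝ))).const_mul A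
    rw [mul_zero] at h
    obtain ⟨t₀, h₀⟩ := eventually_atTop.1
      (h.eventually (ge_mem_nhds (show 0 < c.r ^ 2 by positivity)))
    exact ⟨t₀, fun t ht => h₀ t ht⟩

/-- The finitely many early times, at which the step may be too long for `exists_αγ_le`, only
increase the constant. -/
theorem exists_varianceBound (hS : S.Admissible p c) (hc : c.Valid) :
    ∃ K : ℝ, S.VarianceBound p c K := by
  obtain ⟨t₀, h₀⟩ := hS.exists_αγ_le hc
  set K := (p : ℝ) ^ 2 * (2 * c.F₁ ^ 2 + 2 * S.γ t₀ ^ 2 * c.F₂ ^ 2 * c.F₂ ^ 2) with hK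
  refine ⟨K, fun t ht h hh0 hh1 => ?_⟩
  have hα := hS.α_pos ht
  have hγ := hS.γ_pos ht
  have hδ := δ_pos (S := S) hc ht
  rcases le_total t₀ t with h1 | h1
  · have h2 := h₀ t h1 ht
    have h3 : S.α t * ((p / S.δ c.r t) ^ 2 * (2 * S.γ t ^ 2 * c.F₂ ^ 2 * h)) ≤ S.γ t * h := by
      have e : S.α t * ((p / S.δ c.r t) ^ 2 * (2 * S.γ t ^ 2 * c.F₂ ^ 2 * h)) =
          2 * (p : ℝ) ^ 2 * c.F₂ ^ 2 * (S.α t * S.γ t) / S.δ c.r t ^ 2 * (S.γ t * h) := by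
        field_simp
      rw [e]
      exact mul_le_of_le_one_left (by positivity) ((div_le_one (by positivity)).2 h2)
    have h4 : S.α t * ((p / S.δ c.r t) ^ 2 * (2 * c.F₁ ^ 2)) ≤ K * (S.α t / S.δ c.r t ^ 2) := by
      have e : S.α t * ((p / S.δ c.r t) ^ 2 * (2 * c.F₁ ^ 2)) =
          (p : ℝ) ^ 2 * (2 * c.F₁ ^ 2) * (S.α t / S.δ c.r t ^ 2) := by
        field_simp
      rw [e, hK]
      gcongr
      have : 0 ≤ 2 * S.γ t₀ ^ 2 * c.F₂ ^ 2 * c.F₂ ^ 2 := by positivity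
      linarith
    linarith
  · have h2 := hS.γ_monotone h1
    have e : S.α t * ((p / S.δ c.r t) ^ 2 * (2 * c.F₁ ^ 2 + 2 * S.γ t ^ 2 * c.F₂ ^ 2 * h)) =
        (p : ℝ) ^ 2 * (2 * c.F₁ ^ 2 + 2 * S.γ t ^ 2 * c.F₂ ^ 2 * h) *
          (S.α t / S.δ c.r t ^ 2) := by
      field_simp
    have h3 : S.α t * ((p / S.δ c.r t) ^ 2 * (2 * c.F₁ ^ 2 + 2 * S.γ t ^ 2 * c.F₂ ^ 2 * h)) ≤
        K * (S.α t / S.δ c.r t ^ 2) := by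
      rw [e, hK]
      gcongr
    have := mul_nonneg hγ.le hh0
    linarith

end Admissible

end Schedule

end Rates

end PowerRates

/-! ### Performance measures -/

section Performance

open Metric Set

theorem sum_norm_sub_le_dev {n : ℕ} {E : Type*} [NormedAddCommGroup E] [NormedSpace ℝ E]
    (x : Fin n → E) : ∑ i, ∑ j, ‖x i - x j‖ ≤ 2 * n * dev x := by
  calc ∑ i, ∑ j, ‖x i - x j‖ ≤ ∑ i, ∑ j, (‖x i - mean x‖ + ‖x j - mean x‖) := by
        refine Finset.sum_le_sum fun i _ => Finset.sum_le_sum fun j _ => ?_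
        have := norm_sub_le (x i - mean x) (x j - mean x)
        rwa [sub_sub_sub_cancel_right] at this
    _ = _ := by
        simp only [Finset.sum_add_distrib, Finset.sum_const, Finset.card_univ, Fintype.card_fin,
          nsmul_eq_mul, ← Finset.mul_sum, dev]
        ring

theorem dev_le_of_norm_le {n : ℕ} {E : Type*} [NormedAddCommGroup E] [NormedSpace ℝ E]
    {x : Fin n → E} {R : ℝ} (h : ∀ i, ‖x i‖ ≤ R) : dev x ≤ 2 * n * R := by
  rcases Nat.eq_zero_or_pos n with rfl | hn
  · simp [dev]
  have hn' : (0 : ℝ) < n := by exact_mod_cast hn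
  have hm : ‖mean x‖ ≤ R := by
    rw [mean, norm_smul, norm_inv, Real.norm_natCast, inv_mul_le_iff₀ hn']
    refine (norm_sum_le _ _).trans ((Finset.sum_le_sum fun i _ => h i).trans (le_of_eq ?_))
    simp
  refine (Finset.sum_le_sum fun i (_ : i ∈ Finset.univ) =>
    (norm_sub_le (x i) (mean x)).trans (add_le_add (h i) hm)).trans (le_of_eq ?_)
  simp
  ring

section LinearOptimization

variable {E : Type*} [NormedAddCommGroup E] [InnerProductSpace ℝ E] {K : Set E} {R : ℝ}

theorem bddBelow_inner_image (hR : ∀ y ∈ K, ‖y‖ ≤ R) (w : E) :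
    BddBelow ((fun y => inner ℝ w y) '' K) := by
  refine ⟨-(‖w‖ * R), ?_⟩
  rintro _ ⟨y, hy, rfl⟩
  have h1 := abs_le.1 (abs_real_inner_le_norm w y)
  have h2 := mul_le_mul_of_nonneg_left (hR y hy) (norm_nonneg w)
  exact (neg_le_neg h2).trans h1.1

theorem abs_sInf_inner_le (hne : K.Nonempty) (hR : ∀ y ∈ K, ‖y‖ ≤ R) (w : E) :
    |sInf ((fun y => inner ℝ w y) '' K)| ≤ ‖w‖ * R := by
  have hb : ∀ y ∈ K, |inner ℝ w y| ≤ ‖w‖ * R := fun y hy =>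
    (abs_real_inner_le_norm w y).trans (mul_le_mul_of_nonneg_left (hR y hy) (norm_nonneg w))
  rw [abs_le]
  constructor
  · refine le_csInf (hne.image _) ?_
    rintro _ ⟨y, hy, rfl⟩
    exact (abs_le.1 (hb y hy)).1
  · obtain ⟨y, hy⟩ := hne
    exact (csInf_le (bddBelow_inner_image hR w) (mem_image_of_mem _ hy)).trans
      (abs_le.1 (hb y hy)).2

/-- The support function of a bounded set is continuous. -/
theorem continuous_sInf_inner (hne : K.Nonempty) (hR : ∀ y ∈ K, ‖y‖ ≤ R) :
    Continuous fun w : E => sInf ((fun y => inner ℝ w y) '' K) := by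
  have hR0 : 0 ≤ R := by
    obtain ⟨y, hy⟩ := hne
    exact (norm_nonneg y).trans (hR y hy)
  refine (LipschitzWith.of_le_add_mul (Real.toNNReal R) fun w w' => ?_).continuous
  rw [Real.coe_toNNReal _ hR0, dist_eq_norm, ← sub_le_iff_le_add]
  refine le_csInf (hne.image _) ?_
  rintro _ ⟨y, hy, rfl⟩
  have h1 := csInf_le (bddBelow_inner_image hR w) (mem_image_of_mem _ hy)
  have h2 := real_inner_le_norm (w - w') y
  have h3 := mul_le_mul_of_nonneg_left (hR y hy) (norm_nonneg (w - w'))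
  rw [inner_sub_left] at h2
  linarith

end LinearOptimization

namespace Problem

variable {n p : ℕ} {M : Problem n p} {c : Constants} {t : ℕ}

theorem norm_posPart_globalConstraint_sq (t : ℕ) (x : Vec p) :
    ‖posPart (M.globalConstraint t x)‖ ^ 2 = ∑ j, M.viol j t x ^ 2 := by
  simp only [viol, norm_posPart_sq, Fintype.sum_sigma]
  rfl

theorem norm_posPart_globalConstraint_le (t : ℕ) (x : Vec p) :
    ‖posPart (M.globalConstraint t x)‖ ≤ ∑ j, M.viol j t x := by
  have h0 : ∀ j ∈ Finset.univ, 0 ≤ M.viol j t x := fun j _ => viol_nonneg _ _ _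
  rw [← pow_le_pow_iff_left₀ (norm_nonneg _) (Finset.sum_nonneg h0) two_ne_zero,
    norm_posPart_globalConstraint_sq]
  exact Finset.sum_sq_le_sq_sum_of_nonneg h0

theorem local_le_of_mem_feasible {T : ℕ} {y : Vec p} (hy : y ∈ M.feasible T) (ht : 1 ≤ t)
    (hT : t ≤ T) (i : Fin n) (k : Fin (M.m i)) : M.g i t y k ≤ 0 :=
  hy.2 t (Finset.mem_Icc.2 ⟨ht, hT⟩) ⟨i, k⟩

namespace Standing

theorem uniqueDiffOn (hM : M.Standing c) (hc : c.Valid) : UniqueDiffOn ℝ M.X := by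
  refine uniqueDiffOn_convex hM.convex ⟨0, ?_⟩
  exact interior_maximal (ball_subset_closedBall.trans hM.ball_subset) isOpen_ball
    (mem_ball_self hc.r_pos)

theorem inner_gradLoss (hM : M.Standing c) (hc : c.Valid) (ht : 1 ≤ t) {x : Vec p} (hx : x ∈ M.X)
    (d : Vec p) : inner ℝ (M.gradLoss t x) d =
      (1 / (n : ℝ)) * ∑ j, inner ℝ (gradientWithin (M.f j t) M.X x) d := by
  have hu := hM.uniqueDiffOn hc x hx
  have hd : ∀ j ∈ (Finset.univ : Finset (Fin n)), DifferentiableWithinAt ℝ (M.f j t) M.X x :=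
    fun j _ => hM.f_diff j t ht x hx
  have h1 : HasFDerivWithinAt (M.globalLoss t)
      ((1 / (n : ℝ)) • ∑ j, fderivWithin ℝ (M.f j t) M.X x) M.X x :=
    (HasFDerivWithinAt.fun_sum fun j hj => (hd j hj).hasFDerivWithinAt).const_mul _
  rw [gradLoss, inner_gradientWithin_left, h1.fderivWithin hu]
  simp [inner_gradientWithin_left]

theorem gradLoss_eq (hM : M.Standing c) (hc : c.Valid) (ht : 1 ≤ t) {x : Vec p} (hx : x ∈ M.X) :
    M.gradLoss t x = (1 / (n : ℝ)) • ∑ j, gradientWithin (M.f j t) M.X x := by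
  refine ext_inner_right ℝ fun d => ?_
  rw [hM.inner_gradLoss hc ht hx, real_inner_smul_left, sum_inner]

theorem norm_gradLoss_le (hM : M.Standing c) (hc : c.Valid) (hn : 0 < n) (ht : 1 ≤ t) {x : Vec p}
    (hx : x ∈ M.X) : ‖M.gradLoss t x‖ ≤ c.G₁ := by
  have hn' : (0 : ℝ) < n := by exact_mod_cast hn
  rw [hM.gradLoss_eq hc ht hx, norm_smul, Real.norm_of_nonneg (by positivity),
    one_div, inv_mul_le_iff₀ hn']
  refine (norm_sum_le _ _).trans ((Finset.sum_le_sum fun j _ => hM.f_grad_bound j t ht x hx).trans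
    (le_of_eq ?_))
  simp

theorem continuousOn_gradientWithin (hM : M.Standing c) (hc : c.Valid) (hn : 0 < n) (hp : 0 < p)
    (ht : 1 ≤ t) (j : Fin n) : ContinuousOn (gradientWithin (M.f j t) M.X) M.X := by
  refine (LipschitzOnWith.of_dist_le_mul (K := Real.toNNReal c.L) fun x hx y hy => ?_).continuousOn
  rw [Real.coe_toNNReal _ (hM.L_nonneg hc hn hp), dist_eq_norm, dist_eq_norm]
  exact hM.f_grad_lipschitz j t ht x hx y hy

theorem continuousOn_gradLoss (hM : M.Standing c) (hc : c.Valid) (hn : 0 < n) (hp : 0 < p)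
    (ht : 1 ≤ t) : ContinuousOn (M.gradLoss t) M.X := by
  refine ContinuousOn.congr (f := fun x => (1 / (n : ℝ)) • ∑ j, gradientWithin (M.f j t) M.X x)
    ?_ fun x hx => hM.gradLoss_eq hc ht hx
  exact ContinuousOn.const_smul (continuousOn_finsetSum _ fun j _ =>
    hM.continuousOn_gradientWithin hc hn hp ht j) (1 / (n : ℝ))

theorem continuousOn_viol (hM : M.Standing c) (hc : c.Valid) (hn : 0 < n) (ht : 1 ≤ t)
    (j : Fin n) : ContinuousOn (M.viol j t) M.X := by
  refine (LipschitzOnWith.of_le_add_mul (Real.toNNReal c.G₂) fun x hx y hy => ?_).continuousOn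
  rw [Real.coe_toNNReal _ (hM.G₂_nonneg hc hn), dist_eq_norm]
  exact hM.viol_le_add ht hx hy

theorem continuousOn_norm_posPart_globalConstraint (hM : M.Standing c) (hc : c.Valid) (hn : 0 < n)
    (ht : 1 ≤ t) : ContinuousOn (fun x => ‖posPart (M.globalConstraint t x)‖) M.X := by
  have e : (fun x => ‖posPart (M.globalConstraint t x)‖) =
      fun x => √(∑ j, M.viol j t x ^ 2) := by
    funext x
    rw [← norm_posPart_globalConstraint_sq, Real.sqrt_sq (norm_nonneg _)]
  rw [e]
  exact (continuousOn_finsetSum _ fun j _ => (hM.continuousOn_viol hc hn ht j).pow 2).sqrt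

theorem norm_le_of_mem_feasible (hM : M.Standing c) {T : ℕ} :
    ∀ y ∈ M.feasible T, ‖y‖ ≤ c.R := fun _ hy => hM.norm_le hy.1

/-- The linearized gap of agent `j` changes by a multiple of the disagreement when the local
gradient is taken at the decision of another agent. -/
theorem inner_gradient_le (hM : M.Standing c) (ht : 1 ≤ t)
    (j : Fin n) {x x' y : Vec p} (hx : x ∈ M.X) (hx' : x' ∈ M.X) (hy : y ∈ M.X) :
    inner ℝ (gradientWithin (M.f j t) M.X x) (x - y) ≤
      inner ℝ (gradientWithin (M.f j t) M.X x') (x' - y) + (c.G₁ + 2 * c.R * c.L) * ‖x - x'‖ := by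
  set g := gradientWithin (M.f j t) M.X x
  set g' := gradientWithin (M.f j t) M.X x'
  have e : inner ℝ g (x - y) = inner ℝ g' (x' - y) + inner ℝ g' (x - x') +
      inner ℝ (g - g') (x - y) := by
    simp only [inner_sub_left, inner_sub_right]
    ring
  have h1 : inner ℝ g' (x - x') ≤ c.G₁ * ‖x - x'‖ :=
    (real_inner_le_norm _ _).trans
      (mul_le_mul_of_nonneg_right (hM.f_grad_bound j t ht x' hx') (norm_nonneg _))
  have h2 : inner ℝ (g - g') (x - y) ≤ c.L * ‖x - x'‖ * (2 * c.R) :=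
    (real_inner_le_norm _ _).trans
      (mul_le_mul (hM.f_grad_lipschitz j t ht x hx x' hx') (IsRun.norm_sub_le hM hx hy)
        (norm_nonneg _) ((norm_nonneg _).trans (hM.f_grad_lipschitz j t ht x hx x' hx')))
  rw [e]
  linarith

/-- The network regret is at most the regret of the agents with respect to their own losses, plus
a multiple of their disagreement. -/
theorem netReg_le (hM : M.Standing c) (hc : c.Valid) (hn : 0 < n) (hp : 0 < p) {T : ℕ}
    (hT : 1 ≤ T) {x : ℕ → Fin n → Vec p} (hx : ∀ t, 1 ≤ t → t ≤ T → ∀ i, x t i ∈ M.X) {D : ℝ}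
    (hD : ∀ y ∈ M.feasible T, ∑ t ∈ Finset.Icc 1 T, ∑ j,
      inner ℝ (gradientWithin (M.f j t) M.X (x t j)) (x t j - y) ≤ D) :
    M.netReg T x ≤ (1 / (n : ℝ)) *
      (D + 2 * (c.G₁ + 2 * c.R * c.L) * ∑ t ∈ Finset.Icc 1 T, dev (x t)) := by
  have hn' : (0 : ℝ) < n := by exact_mod_cast hn
  have hκ : 0 ≤ c.G₁ + 2 * c.R * c.L :=
    add_nonneg (hM.G₁_nonneg hc hn)
      (mul_nonneg (mul_nonneg zero_le_two hc.R_pos.le) (hM.L_nonneg hc hn hp))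
  set κ := c.G₁ + 2 * c.R * c.L
  have hi : ∀ i, (∑ t ∈ Finset.Icc 1 T, inner ℝ (M.gradLoss t (x t i)) (x t i)) -
      sInf ((fun y => inner ℝ (∑ t ∈ Finset.Icc 1 T, M.gradLoss t (x t i)) y) '' M.feasible T) ≤
      (1 / (n : ℝ)) * (D + κ * ∑ t ∈ Finset.Icc 1 T, ∑ j, ‖x t i - x t j‖) := by
    intro i
    rw [sub_le_comm]
    refine le_csInf ((hM.feasible_nonempty T hT).image _) ?_
    rintro _ ⟨y, hy, rfl⟩
    have h1 : ∑ t ∈ Finset.Icc 1 T, inner ℝ (M.gradLoss t (x t i)) (x t i - y) ≤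
        (1 / (n : ℝ)) * ∑ t ∈ Finset.Icc 1 T, ∑ j,
          (inner ℝ (gradientWithin (M.f j t) M.X (x t j)) (x t j - y) +
            κ * ‖x t i - x t j‖) := by
      rw [Finset.mul_sum]
      refine Finset.sum_le_sum fun t ht => ?_
      obtain ⟨ht1, htT⟩ := Finset.mem_Icc.1 ht
      rw [hM.inner_gradLoss hc ht1 (hx t ht1 htT i)]
      gcongr with j
      exact hM.inner_gradient_le ht1 j (hx t ht1 htT i) (hx t ht1 htT j) hy.1
    simp only [Finset.sum_add_distrib, ← Finset.mul_sum, inner_sub_right,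
      Finset.sum_sub_distrib] at h1
    have h2 := hD y hy
    simp only [inner_sub_right, Finset.sum_sub_distrib] at h2
    have h3 : (1 / (n : ℝ)) * (D + κ * ∑ t ∈ Finset.Icc 1 T, ∑ j, ‖x t i - x t j‖) ≥ (1 / (n : ℝ)) *
        ((∑ t ∈ Finset.Icc 1 T, ∑ j, inner ℝ (gradientWithin (M.f j t) M.X (x t j)) (x t j)) -
          (∑ t ∈ Finset.Icc 1 T, ∑ j, inner ℝ (gradientWithin (M.f j t) M.X (x t j)) y) +
          κ * ∑ t ∈ Finset.Icc 1 T, ∑ j, ‖x t i - x t j‖) := by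
      gcongr
    simp only [sum_inner]
    linarith
  have hs := Finset.sum_le_sum fun i (_ : i ∈ Finset.univ) => hi i
  rw [netReg]
  gcongr
  refine hs.trans ?_
  rw [← Finset.mul_sum, Finset.sum_add_distrib, ← Finset.mul_sum, Finset.sum_comm]
  have h4 : ∑ t ∈ Finset.Icc 1 T, ∑ i, ∑ j, ‖x t i - x t j‖ ≤
      2 * n * ∑ t ∈ Finset.Icc 1 T, dev (x t) := by
    rw [Finset.mul_sum]
    exact Finset.sum_le_sum fun t _ => sum_norm_sub_le_dev _
  have h5 := mul_le_mul_of_nonneg_left h4 hκ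
  simp only [Finset.sum_const, Finset.card_univ, Fintype.card_fin, nsmul_eq_mul]
  rw [one_div, inv_mul_le_iff₀ hn']
  linarith

/-- The network violation is at most the violations of the agents with respect to their own
constraints, plus a multiple of their disagreement. -/
theorem netCCV_le (hM : M.Standing c) (hc : c.Valid) (hn : 0 < n) {T : ℕ}
    {x : ℕ → Fin n → Vec p} (hx : ∀ t, 1 ≤ t → t ≤ T → ∀ i, x t i ∈ M.X) :
    M.netCCV T x ≤ (∑ t ∈ Finset.Icc 1 T, ∑ j, M.viol j t (x t j)) +
      2 * c.G₂ * ∑ t ∈ Finset.Icc 1 T, dev (x t) := by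
  have hn' : (0 : ℝ) < n := by exact_mod_cast hn
  have hG := hM.G₂_nonneg hc hn
  rw [netCCV, one_div, inv_mul_le_iff₀ hn', Finset.sum_comm, Finset.mul_sum,
    ← Finset.sum_add_distrib, Finset.mul_sum]
  refine Finset.sum_le_sum fun t ht => ?_
  obtain ⟨ht1, htT⟩ := Finset.mem_Icc.1 ht
  have h1 : ∀ i, ‖posPart (M.globalConstraint t (x t i))‖ ≤
      (∑ j, M.viol j t (x t j)) + c.G₂ * ∑ j, ‖x t i - x t j‖ := by
    intro i
    refine (norm_posPart_globalConstraint_le _ _).trans ?_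
    rw [Finset.mul_sum, ← Finset.sum_add_distrib]
    exact Finset.sum_le_sum fun j _ => hM.viol_le_add ht1 (hx t ht1 htT i) (hx t ht1 htT j)
  refine (Finset.sum_le_sum fun i _ => h1 i).trans ?_
  have h2 := mul_le_mul_of_nonneg_left (sum_norm_sub_le_dev (x t)) hG
  simp only [Finset.sum_add_distrib, Finset.sum_const, Finset.card_univ, Fintype.card_fin,
    nsmul_eq_mul, ← Finset.mul_sum]
  linarith

end Standing

end Problem

namespace Execution

open Schedule.Admissible Problem

set_option linter.unusedSectionVars false

variable {n p : ℕ} {Ω : Type u} [MeasurableSpace Ω] {Z : Type v} [MeasurableSpace Z]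
  {M : Problem n p} {c : Constants} {S : Schedule} {P : Measure Ω} [IsProbabilityMeasure P]
  {ν : Measure Z} {Q : Vec p → Z → Vec p} {Y : Set (Vec p)} {u : ℕ → Fin n → Ω → Vec p}
  {ζ : ℕ → Fin n → Ω → Z} {x z zhat a : Ω → ℕ → Fin n → Vec p}
  {v : Ω → ℕ → (i : Fin n) → Vec (M.m i)} {t : ℕ} {i : Fin n}

theorem aemeasurable_comp_x (h : Execution M c S P ν Q Y u ζ x z zhat a v) (hM : M.Standing c)
    (hc : c.Valid) (hn : 0 < n) (hp : 0 < p) (ht : 1 ≤ t) (i : Fin n) {F : Type*}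
    [TopologicalSpace F] [MeasurableSpace F] [BorelSpace F] [Zero F] {f : Vec p → F}
    (hf : ContinuousOn f M.X) : AEMeasurable (fun ω => f (x ω t i)) P := by
  refine ((measurable_indicator_of_continuousOn hM.closed hf).comp_aemeasurable
    (h.aemeasurable_x hM hc hn ht i)).congr ?_
  filter_upwards [h.ae_x_mem hM hc hn hp ht i] with ω hω
  exact indicator_of_mem hω f

theorem depends_comp_x (h : Execution M c S P ν Q Y u ζ x z zhat a v) (hM : M.Standing c)
    (hc : c.Valid) (hn : 0 < n) (ht : 1 ≤ t) (i : Fin n) {y : Vec p} :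
    Depends P u ζ (past n t) (past n (t + 1)) fun ω => x ω t i - y :=
  (h.depends_x hM hc hn ht i).comp (measurable_id.sub_const y)

theorem ae_all_x_mem (h : Execution M c S P ν Q Y u ζ x z zhat a v) (hM : M.Standing c)
    (hc : c.Valid) (hn : 0 < n) (hp : 0 < p) :
    ∀ᵐ ω ∂P, ∀ t, 1 ≤ t → ∀ i, x ω t i ∈ M.X := by
  refine ae_all_iff.2 fun t => ?_
  by_cases ht : 1 ≤ t
  · filter_upwards [ae_all_iff.2 fun i => h.ae_x_mem hM hc hn hp ht i] with ω hω _
    exact hω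
  · exact ae_of_all _ fun ω h1 => absurd h1 ht

theorem integrable_viol (h : Execution M c S P ν Q Y u ζ x z zhat a v) (hM : M.Standing c)
    (hc : c.Valid) (hn : 0 < n) (hp : 0 < p) (ht : 1 ≤ t) (i : Fin n) :
    Integrable (fun ω => M.viol i t (x ω t i)) P := by
  refine Integrable.of_bound (C := c.F₂) (h.aemeasurable_comp_x hM hc hn hp ht i
    (hM.continuousOn_viol hc hn ht i)).aestronglyMeasurable ?_
  filter_upwards [h.ae_x_mem hM hc hn hp ht i] with ω hω
  rw [Real.norm_of_nonneg (viol_nonneg _ _ _)]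
  exact hM.viol_le ht hω

theorem integrable_viol_sq (h : Execution M c S P ν Q Y u ζ x z zhat a v) (hM : M.Standing c)
    (hc : c.Valid) (hn : 0 < n) (hp : 0 < p) (ht : 1 ≤ t) (i : Fin n) :
    Integrable (fun ω => M.viol i t (x ω t i) ^ 2) P := by
  refine Integrable.of_bound (C := c.F₂ ^ 2) (h.aemeasurable_comp_x hM hc hn hp ht i
    ((hM.continuousOn_viol hc hn ht i).pow 2)).aestronglyMeasurable ?_
  filter_upwards [h.ae_x_mem hM hc hn hp ht i] with ω hω
  rw [Real.norm_of_nonneg (sq_nonneg _)]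
  exact pow_le_pow_left₀ (viol_nonneg _ _ _) (hM.viol_le ht hω) 2

theorem integrable_dev (h : Execution M c S P ν Q Y u ζ x z zhat a v) (hM : M.Standing c)
    (hc : c.Valid) (hn : 0 < n) (hp : 0 < p) (ht : 1 ≤ t) :
    Integrable (fun ω => dev (x ω t)) P := by
  have hm : Measurable fun q : Fin n → Vec p => dev q := by
    unfold dev mean
    fun_prop
  refine Integrable.of_bound (C := 2 * n * c.R) (hm.comp_aemeasurable (aemeasurable_pi_lambda _
    fun i => h.aemeasurable_x hM hc hn ht i)).aestronglyMeasurable ?_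
  filter_upwards [h.ae_all_x_mem hM hc hn hp] with ω hω
  rw [Real.norm_of_nonneg (dev_nonneg _)]
  exact dev_le_of_norm_le fun i => hM.norm_le (hω t ht i)

theorem integrable_netCCV (h : Execution M c S P ν Q Y u ζ x z zhat a v) (hM : M.Standing c)
    (hc : c.Valid) (hn : 0 < n) (hp : 0 < p) (T : ℕ) :
    Integrable (fun ω => M.netCCV T (x ω)) P := by
  refine (integrable_finsetSum _ fun i _ => integrable_finsetSum _ fun t ht => ?_).const_mul _
  have ht1 := (Finset.mem_Icc.1 ht).1
  refine Integrable.of_bound (C := n * c.F₂) (h.aemeasurable_comp_x hM hc hn hp ht1 i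
    (hM.continuousOn_norm_posPart_globalConstraint hc hn ht1)).aestronglyMeasurable ?_
  filter_upwards [h.ae_x_mem hM hc hn hp ht1 i] with ω hω
  rw [norm_norm]
  refine (norm_posPart_globalConstraint_le _ _).trans
    ((Finset.sum_le_sum fun j _ => hM.viol_le ht1 hω).trans (le_of_eq ?_))
  simp

theorem integrable_netReg (h : Execution M c S P ν Q Y u ζ x z zhat a v) (hM : M.Standing c)
    (hc : c.Valid) (hn : 0 < n) (hp : 0 < p) {T : ℕ} (hT : 1 ≤ T) :
    Integrable (fun ω => M.netReg T (x ω)) P := by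
  have hg : ∀ t, 1 ≤ t → ∀ i, AEMeasurable (fun ω => M.gradLoss t (x ω t i)) P := fun t ht i =>
    h.aemeasurable_comp_x hM hc hn hp ht i (hM.continuousOn_gradLoss hc hn hp ht)
  have hgb : ∀ t, 1 ≤ t → ∀ i, ∀ᵐ ω ∂P, ‖M.gradLoss t (x ω t i)‖ ≤ c.G₁ := by
    intro t ht i
    filter_upwards [h.ae_x_mem hM hc hn hp ht i] with ω hω
    exact hM.norm_gradLoss_le hc hn ht hω
  refine (integrable_finsetSum _ fun i _ => Integrable.sub (integrable_finsetSum _ fun t ht => ?_)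
    ?_).const_mul _
  · have ht1 := (Finset.mem_Icc.1 ht).1
    refine integrable_inner_of_bound (A := c.G₁) (B := c.R) (hg t ht1 i)
      (h.aemeasurable_x hM hc hn ht1 i) (hgb t ht1 i) ?_
    filter_upwards [h.ae_x_mem hM hc hn hp ht1 i] with ω hω
    exact hM.norm_le hω
  · have hsum : AEMeasurable (fun ω => ∑ t ∈ Finset.Icc 1 T, M.gradLoss t (x ω t i)) P :=
      Finset.aemeasurable_fun_sum _ fun t ht => hg t (Finset.mem_Icc.1 ht).1 i
    have hne := hM.feasible_nonempty T hT
    have hb : ∀ᵐ ω ∂P, ∀ t ∈ Finset.Icc 1 T, ‖M.gradLoss t (x ω t i)‖ ≤ c.G₁ :=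
      (Finset.eventually_all _).2 fun t ht => hgb t (Finset.mem_Icc.1 ht).1 i
    refine Integrable.of_bound (C := (∑ _t ∈ Finset.Icc 1 T, c.G₁) * c.R)
      ((continuous_sInf_inner hne hM.norm_le_of_mem_feasible).measurable.comp_aemeasurable
        hsum).aestronglyMeasurable ?_
    filter_upwards [hb] with ω hω
    refine (abs_sInf_inner_le hne hM.norm_le_of_mem_feasible _).trans ?_
    have := hc.R_pos
    gcongr
    exact (norm_sum_le _ _).trans (Finset.sum_le_sum hω)

end Execution

end Performance

/-! ### Expected step and expected disagreement -/

section Expectation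

open Metric Set

/-- The smoothed slope of the squared violation at `x` in the direction of `y`. -/
def Problem.violSlope {n p : ℕ} (M : Problem n p) (c : Constants) (S : Schedule) (i : Fin n) (t : ℕ)
    (x y : Vec p) : ℝ :=
  (p : ℝ) / S.δ c.r t * ∫ u, M.viol i t (x + S.δ c.r t • u) ^ 2 * inner ℝ u (y - x)
    ∂(uniformSphere p)

/-- The energy step, with the estimate split into its average, to which `le_inner_meanEst` applies,
and its noise. -/
theorem IsRun.gap_step {n p : ℕ} {Z : Type v} {M : Problem n p} {c : Constants} {S : Schedule}
    {Q : Vec p → Z → Vec p} {u : ℕ → Fin n → Vec p} {ζ : ℕ → Fin n → Z}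
    {x z zhat a : ℕ → Fin n → Vec p} {v : ℕ → (i : Fin n) → Vec (M.m i)} {t : ℕ}
    (h : IsRun M c S Q u ζ x z zhat a v) (hM : M.Standing c) (hc : c.Valid) (hn : 0 < n)
    (hp : 0 < p) (hS : S.Admissible p c) (ht : 1 ≤ t)
    (hx : ∀ i, closedBall (x t i) (S.δ c.r t) ⊆ M.X) {y : Vec p} (hy : y ∈ M.X) {β : Fin n → ℝ}
    (hβ : ∀ i, M.violSlope c S i t (x t i) ((1 - S.ξ t) • y) ≤ β i) :
    2 * S.α t * ∑ i, (inner ℝ (gradientWithin (M.f i t) M.X (x t i)) (x t i - (1 - S.ξ t) • y) -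
        2 * p * c.L * c.R * S.δ c.r t - S.γ t * β i +
        inner ℝ (a (t + 1) i - M.meanEst c S i t (x t i)) (x t i - (1 - S.ξ t) • y)) ≤
      energy c S y z t - energy c S y z (t + 1) +
      (4 * c.R * compErr z zhat t + compErrSq z zhat t) +
      S.α t ^ 2 * ∑ i, ‖a (t + 1) i‖ ^ 2 := by
  refine le_trans ?_ (h.energy_step hM hc hS ht hy)
  have hα := hS.α_pos ht
  have hδ := Schedule.Admissible.δ_pos (S := S) hc ht
  refine mul_le_mul_of_nonneg_left (Finset.sum_le_sum fun i _ => ?_) (by positivity)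
  have h1 := hM.le_inner_meanEst hc hn hp hS ht (hx i) (hβ i)
  have h2 := IsRun.norm_sub_le hM (hx i (mem_closedBall_self hδ.le))
    (IsRun.smul_mem_X hM hc hS ht hy)
  have h3 : p * c.L * S.δ c.r t * ‖x t i - (1 - S.ξ t) • y‖ ≤
      p * c.L * S.δ c.r t * (2 * c.R) := by
    have := hM.L_nonneg hc hn hp
    gcongr
  rw [inner_sub_left (a (t + 1) i)]
  linarith

/-- Towards a shrunk feasible point the slope is at most minus the squared violation, up to errors
of the order of `ξ_t`. -/
theorem Problem.Standing.violSlope_le {n p : ℕ} {M : Problem n p} {c : Constants} {S : Schedule}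
    {i : Fin n} {t : ℕ} (hM : M.Standing c) (hc : c.Valid) (hn : 0 < n) (hp : 0 < p)
    (hS : S.Admissible p c) (ht : 1 ≤ t) {x y : Vec p} (hx : closedBall x (S.δ c.r t) ⊆ M.X)
    (hy : y ∈ M.X) (hf : ∀ k, M.g i t y k ≤ 0) :
    M.violSlope c S i t x ((1 - S.ξ t) • y) ≤
      S.ξ t ^ 2 * c.F₂ ^ 2 + 2 * c.F₂ * c.G₂ * S.δ c.r t - M.viol i t x ^ 2 := by
  have hξ := Schedule.Admissible.ξ_pos (S := S) ht
  have h1 := hS.ξ_le_one ht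
  refine hM.onePoint_viol_sq_le hc hn hp ht (Schedule.Admissible.δ_pos hc ht) hx ?_ ?_
  · rw [S.δ_eq]
    exact hM.closedBall_shrink_subset hy hξ h1
  · rw [S.δ_eq]
    exact fun w hw => hM.viol_sq_le_of_mem_shrink ht hy hf hξ h1 hw

/-- Towards a shrunk Slater point the slope is at most minus a multiple of the violation. Shrinkage
uses up at most half of the margin. -/
theorem Problem.Standing.violSlope_le_of_margin {n p : ℕ} {M : Problem n p} {c : Constants}
    {S : Schedule} {i : Fin n} {t : ℕ} (hM : M.Standing c) (hc : c.Valid) (hn : 0 < n) (hp : 0 < p)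
    (hS : S.Admissible p c) (ht : 1 ≤ t) {x y : Vec p} (hx : closedBall x (S.δ c.r t) ⊆ M.X)
    (hy : y ∈ M.X) {ς : ℝ} (hς : 0 < ς) (hf : ∀ k, M.g i t y k ≤ -ς)
    (hξς : S.ξ t ≤ ς / (2 * (ς + c.F₂))) :
    M.violSlope c S i t x ((1 - S.ξ t) • y) ≤
      -(ς * (M.viol i t x - c.G₂ * S.δ c.r t)) := by
  have hξ := Schedule.Admissible.ξ_pos (S := S) ht
  have h1 := hS.ξ_le_one ht
  have hF := hc.F₂_pos
  have h2 := hM.onePoint_viol_sq_le_of_margin (i := i) (σ := ς / 2) hc hn hp ht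
    (Schedule.Admissible.δ_pos (S := S) hc ht) (by positivity) hx (y := (1 - S.ξ t) • y) ?_ ?_
  · refine h2.trans (le_of_eq ?_)
    ring
  · rw [S.δ_eq]
    exact hM.closedBall_shrink_subset hy hξ h1
  · rw [S.δ_eq]
    intro w hw k
    have h3 := hM.margin_of_mem_shrink ht hy hf hξ h1 hw k
    rw [le_div_iff₀ (by positivity)] at hξς
    linarith

namespace Execution

open Schedule.Admissible Problem

set_option linter.unusedSectionVars false

variable {n p : ℕ} {Ω : Type u} [MeasurableSpace Ω] {Z : Type v} [MeasurableSpace Z]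
  {M : Problem n p} {c : Constants} {S : Schedule} {P : Measure Ω} [IsProbabilityMeasure P]
  {ν : Measure Z} {Q : Vec p → Z → Vec p} {Y : Set (Vec p)} {u : ℕ → Fin n → Ω → Vec p}
  {ζ : ℕ → Fin n → Ω → Z} {x z zhat a : Ω → ℕ → Fin n → Vec p}
  {v : Ω → ℕ → (i : Fin n) → Vec (M.m i)} {t : ℕ} {i : Fin n}

/-- The squared estimate in terms of the violation at the decision rather than at the query point.
-/
theorem ae_sq_norm_a_le (h : Execution M c S P ν Q Y u ζ x z zhat a v) (hM : M.Standing c)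
    (hc : c.Valid) (hn : 0 < n) (hp : 0 < p) {K : ℝ} (hK : S.VarianceBound p c K)
    (hS : S.Admissible p c) (ht : 1 ≤ t) (i : Fin n) :
    ∀ᵐ ω ∂P, S.α t * ‖a ω (t + 1) i‖ ^ 2 ≤ K * (S.α t / S.δ c.r t ^ 2) +
      S.γ t * (M.viol i t (x ω t i) ^ 2 + 2 * c.F₂ * c.G₂ * S.δ c.r t) := by
  filter_upwards [h.ae_a_eq ht i, h.ae_norm_direction t i, h.wellDef t ht i,
    h.ae_x_mem hM hc hn hp ht i] with ω h1 h2 h3 h4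
  have hα := hS.α_pos ht
  have hγ := hS.γ_pos ht
  have hδ := δ_pos (S := S) hc ht
  rw [h1]
  have h5 := mul_le_mul_of_nonneg_left (hM.sq_norm_gradEst_le (i := i) ht h2 h3.1) hα.le
  have h6 := hM.viol_sq_le_add (i := i) ht h3.1 h4
  rw [add_sub_cancel_left, norm_smul, h2, mul_one, Real.norm_of_nonneg hδ.le] at h6
  have h7 := hK t ht _ (sq_nonneg (M.viol i t (x ω t i + S.δ c.r t • u t i ω)))
    (pow_le_pow_left₀ (viol_nonneg _ _ _) (hM.viol_le ht h3.1) 2)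
  have h8 := mul_le_mul_of_nonneg_left h6 hγ.le
  linarith

theorem sum_integral_sq_a_le (h : Execution M c S P ν Q Y u ζ x z zhat a v) (hM : M.Standing c)
    (hc : c.Valid) (hn : 0 < n) (hp : 0 < p) {K : ℝ} (hK : S.VarianceBound p c K)
    (hS : S.Admissible p c) (ht : 1 ≤ t) :
    S.α t * ∑ i, ∫ ω, ‖a ω (t + 1) i‖ ^ 2 ∂P ≤
      n * (K * (S.α t / S.δ c.r t ^ 2) + 2 * c.F₂ * c.G₂ * (S.γ t * S.δ c.r t)) +
      S.γ t * ∑ i, ∫ ω, M.viol i t (x ω t i) ^ 2 ∂P := by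
  have hi : ∀ i, S.α t * ∫ ω, ‖a ω (t + 1) i‖ ^ 2 ∂P ≤
      (K * (S.α t / S.δ c.r t ^ 2) + 2 * c.F₂ * c.G₂ * (S.γ t * S.δ c.r t)) +
      S.γ t * ∫ ω, M.viol i t (x ω t i) ^ 2 ∂P := by
    intro i
    have hv := (h.integrable_viol_sq hM hc hn hp ht i).const_mul (S.γ t)
    rw [← integral_const_mul, ← integral_const_mul]
    have h1 := integral_mono_ae ((h.integrable_sq_a hM hc hn hS ht i).const_mul (S.α t))
      ((integrable_const (K * (S.α t / S.δ c.r t ^ 2) +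
        2 * c.F₂ * c.G₂ * (S.γ t * S.δ c.r t))).add hv) ?_
    · simp only [Pi.add_apply] at h1
      rw [integral_add (integrable_const _) hv] at h1
      simpa using h1
    · filter_upwards [h.ae_sq_norm_a_le hM hc hn hp hK hS ht i] with ω hω
      simp only [Pi.add_apply]
      linarith
  rw [Finset.mul_sum, Finset.mul_sum]
  refine (Finset.sum_le_sum fun i _ => hi i).trans (le_of_eq ?_)
  simp only [Finset.sum_add_distrib, Finset.sum_const, Finset.card_univ, Fintype.card_fin,
    nsmul_eq_mul]
  ring

theorem integrable_energy (h : Execution M c S P ν Q Y u ζ x z zhat a v) (hM : M.Standing c)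
    (hc : c.Valid) (hn : 0 < n) (hS : S.Admissible p c) (ht : 1 ≤ t) {y : Vec p} (hy : y ∈ M.X) :
    Integrable (fun ω => energy c S y (z ω) t) P := by
  have hm : Measurable fun q : Fin n → Vec p =>
      ∑ i, ‖q i - (1 - S.ξ t) • y‖ ^ 2 + 4 * n * c.R ^ 2 * S.ξ t := by fun_prop
  have hz := (h.depends_state hM hc hn ht).1.aemeasurable h.randomness
  refine Integrable.of_bound (C := 8 * n * c.R ^ 2)
    (hm.comp_aemeasurable hz).aestronglyMeasurable (ae_of_all _ fun ω => ?_)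
  change ‖energy c S y (z ω) t‖ ≤ _
  rw [Real.norm_of_nonneg (IsRun.energy_nonneg hc ht y)]
  exact (h.run ω).energy_le hM hc hS ht hy

/-- The error of one step of the method in expectation, divided by the stepsize; `K` is the constant
of the variance bound. The gap of the loss is bounded crudely here, by `2 * G₁ * R`. -/
def stepErr (n p : ℕ) (c : Constants) (S : Schedule) (K : ℝ) (t : ℕ) : ℝ :=
  n * (4 * c.G₁ * c.R + 4 * p * c.L * c.R * S.δ c.r t + K * (S.α t / S.δ c.r t ^ 2) +
    2 * c.F₂ * c.G₂ * (S.γ t * S.δ c.r t)) +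
  (4 * c.R * (n * (1 + c.C) * S.s t) + n * (S.s t ^ 2 * c.C)) / S.α t

/-- The expected step, for any upper bound `β` on the slope of the penalty. The squared step has
already been charged: it is the term `- viol²` on the left. -/
theorem integral_step_le (h : Execution M c S P ν Q Y u ζ x z zhat a v) (hM : M.Standing c)
    (hc : c.Valid) (hn : 0 < n) (hp : 0 < p) {K : ℝ} (hK : S.VarianceBound p c K)
    (hS : S.Admissible p c) (ht : 1 ≤ t) {y : Vec p} (hy : y ∈ M.X) {β : Fin n → Ω → ℝ}
    (hβi : ∀ i, Integrable (β i) P)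
    (hβ : ∀ᵐ ω ∂P, ∀ i, M.violSlope c S i t (x ω t i) ((1 - S.ξ t) • y) ≤ β i ω) :
    S.α t * S.γ t * ∑ i, (-(2 * ∫ ω, β i ω ∂P) - ∫ ω, M.viol i t (x ω t i) ^ 2 ∂P) ≤
      ∫ ω, energy c S y (z ω) t ∂P - ∫ ω, energy c S y (z ω) (t + 1) ∂P +
      S.α t * stepErr n p c S K t := by
  have hα := hS.α_pos ht
  have hδ := δ_pos (S := S) hc ht
  have hy' := IsRun.smul_mem_X hM hc hS ht hy
  set y' := (1 - S.ξ t) • y with hy'def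
  have hd : ∀ i, ∀ᵐ ω ∂P, ‖x ω t i - y'‖ ≤ 2 * c.R := by
    intro i
    filter_upwards [h.ae_x_mem hM hc hn hp ht i] with ω hω
    exact IsRun.norm_sub_le hM hω hy'
  have iN : ∀ i, Integrable (fun ω => inner ℝ (estNoise M c S x a t i ω) (x ω t i - y')) P :=
    fun i => integrable_inner_of_bound
      ((h.depends_estNoise hM hc hn hp ht i).aemeasurable h.randomness)
      ((h.depends_comp_x hM hc hn ht i).aemeasurable h.randomness)
      (h.ae_norm_estNoise_le hM hc hn hp hS ht i) (hd i)
  have zN : ∀ i, ∫ ω, inner ℝ (estNoise M c S x a t i ω) (x ω t i - y') ∂P = 0 := fun i =>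
    h.integral_inner_estNoise_eq_zero hM hc hn hp hS ht i (h.depends_comp_x hM hc hn ht i) (hd i)
  set κ := 2 * c.G₁ * c.R + 2 * p * c.L * c.R * S.δ c.r t with hκ
  -- the pathwise step, with the loss bounded crudely
  have hle : (fun ω => 2 * S.α t * ∑ i, (-κ - S.γ t * β i ω +
      inner ℝ (estNoise M c S x a t i ω) (x ω t i - y'))) ≤ᵐ[P] fun ω =>
      energy c S y (z ω) t - energy c S y (z ω) (t + 1) +
      (4 * c.R * compErr (z ω) (zhat ω) t + compErrSq (z ω) (zhat ω) t) +
      S.α t ^ 2 * ∑ i, ‖a ω (t + 1) i‖ ^ 2 := by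
    filter_upwards [hβ, ae_all_iff.2 fun i => h.ae_closedBall_subset hM hc hn hp ht i] with ω h1 h2
    refine le_trans ?_ ((h.run ω).gap_step hM hc hn hp hS ht h2 hy h1)
    refine mul_le_mul_of_nonneg_left (Finset.sum_le_sum fun i _ => ?_) (by positivity)
    have h3 := abs_le.1 (abs_real_inner_le_norm (gradientWithin (M.f i t) M.X (x ω t i))
      (x ω t i - y'))
    have h4 := h2 i (mem_closedBall_self hδ.le)
    have h5 : ‖gradientWithin (M.f i t) M.X (x ω t i)‖ * ‖x ω t i - y'‖ ≤ c.G₁ * (2 * c.R) :=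
      mul_le_mul (hM.f_grad_bound i t ht _ h4) (IsRun.norm_sub_le hM h4 hy') (norm_nonneg _)
        (hM.G₁_nonneg hc hn)
    rw [estNoise, hκ]
    linarith [h3.1]
  have ic := (h.integrable_compErr hM hc hn hS ht).const_mul (4 * c.R)
  have ic2 := h.integrable_compErrSq hM hc hn hS ht
  have icc : Integrable (fun ω => 4 * c.R * compErr (z ω) (zhat ω) t +
      compErrSq (z ω) (zhat ω) t) P := ic.add ic2
  have iE := h.integrable_energy hM hc hn hS ht hy
  have iE' := h.integrable_energy hM hc hn hS (show 1 ≤ t + 1 by omega) hy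
  have ia := fun i => h.integrable_sq_a hM hc hn hS ht i
  have iA : Integrable (fun ω => S.α t ^ 2 * ∑ i, ‖a ω (t + 1) i‖ ^ 2) P :=
    (integrable_finsetSum _ fun i _ => ia i).const_mul _
  have iβ : ∀ i, Integrable (fun ω => -κ - S.γ t * β i ω) P := fun i =>
    (integrable_const _).sub ((hβi i).const_mul _)
  have iβN : ∀ i, Integrable (fun ω => -κ - S.γ t * β i ω +
      inner ℝ (estNoise M c S x a t i ω) (x ω t i - y')) P := fun i => (iβ i).add (iN i)
  have h1 := integral_mono_ae ((integrable_finsetSum _ fun i _ => iβN i).const_mul (2 * S.α t))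
    (((iE.sub iE').add icc).add iA) hle
  simp only [Pi.add_apply, Pi.sub_apply] at h1
  rw [integral_const_mul, integral_finsetSum _ fun i _ => iβN i,
    integral_add (f := fun ω => energy c S y (z ω) t - energy c S y (z ω) (t + 1) +
      (4 * c.R * compErr (z ω) (zhat ω) t + compErrSq (z ω) (zhat ω) t))
      ((iE.sub iE').add icc) iA,
    integral_add (f := fun ω => energy c S y (z ω) t - energy c S y (z ω) (t + 1))
      (iE.sub iE') icc, integral_sub iE iE', integral_add ic ic2, integral_const_mul,
    integral_const_mul, integral_finsetSum _ fun i _ => ia i] at h1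
  have h2 : ∀ i, ∫ ω, (-κ - S.γ t * β i ω +
      inner ℝ (estNoise M c S x a t i ω) (x ω t i - y')) ∂P = -κ - S.γ t * ∫ ω, β i ω ∂P := by
    intro i
    rw [integral_add (iβ i) (iN i), zN i, integral_sub (integrable_const _)
      ((hβi i).const_mul _), integral_const_mul]
    simp
  simp only [h2] at h1
  have h3 := h.integral_compErr_le hM hc hn hS ht
  have h4 := h.integral_compErrSq_le hM hc hn hS ht
  have h5 := mul_le_mul_of_nonneg_left (h.sum_integral_sq_a_le hM hc hn hp hK hS ht) hα.le
  have h6 := mul_le_mul_of_nonneg_left h3 (show 0 ≤ 4 * c.R by linarith [hc.R_pos])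
  have h7 : S.α t * ((4 * c.R * (n * (1 + c.C) * S.s t) + n * (S.s t ^ 2 * c.C)) / S.α t) =
      4 * c.R * (n * (1 + c.C) * S.s t) + n * (S.s t ^ 2 * c.C) := mul_div_cancel₀ _ hα.ne'
  simp only [Finset.sum_sub_distrib, Finset.sum_neg_distrib, ← Finset.mul_sum, Finset.sum_const,
    Finset.card_univ, Fintype.card_fin, nsmul_eq_mul] at h1 ⊢
  rw [stepErr, mul_add, h7]
  rw [hκ] at h1
  linarith

/-- A bound on the expected total disagreement; `K` is the constant of the averaging dynamics. -/
def devBound (n p : ℕ) (c : Constants) (S : Schedule) (K : ℝ) (T : ℕ) : ℝ :=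
  K * (2 * (n * (1 + c.C) * S.s 1) +
    ∑ t ∈ Finset.Icc 1 T, (S.α t * (n * estBound p c S t) + 3 * (n * (1 + c.C) * S.s t)))

/-- The perturbations of the averaging are the steps of the method and the compression errors. -/
theorem integral_sum_dev_le (h : Execution M c S P ν Q Y u ζ x z zhat a v) (hM : M.Standing c)
    (hc : c.Valid) (hn : 0 < n) (hp : 0 < p) (hS : S.Admissible p c) {K : ℝ}
    (hK : AveragingBound n c.w c.B K) (T : ℕ) :
    ∫ ω, ∑ t ∈ Finset.Icc 1 T, dev (x ω t) ∂P ≤ devBound n p c S K T := by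
  have ha : ∀ᵐ ω ∂P, ∀ t ∈ Finset.Icc 1 T, ∀ i, ‖a ω (t + 1) i‖ ≤ estBound p c S t :=
    (Finset.eventually_all _).2 fun t ht =>
      ae_all_iff.2 fun i => h.ae_norm_a_le hM hc hn hS (Finset.mem_Icc.1 ht).1 i
  have hle : (fun ω => ∑ t ∈ Finset.Icc 1 T, dev (x ω t)) ≤ᵐ[P] fun ω =>
      K * (2 * compErr (z ω) (zhat ω) 1 + ∑ t ∈ Finset.Icc 1 T,
        (S.α t * (n * estBound p c S t) + (2 * compErr (z ω) (zhat ω) t +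
          compErr (z ω) (zhat ω) (t + 1)))) := by
    filter_upwards [ha] with ω hω
    refine (hK.sum_dev_le (Vec p) M.graph M.W (hM.mixingData hc) (x ω)
      (fun t i => zhat ω (t + 1) i - x ω t i) (fun t ht => (h.run ω).x_succ_eq ht) T).trans ?_
    refine mul_le_mul_of_nonneg_left (add_le_add ((h.run ω).dev_x_one_le hM hc)
      (Finset.sum_le_sum fun t ht => ?_)) hK.pos.le
    have ht1 := (Finset.mem_Icc.1 ht).1
    have h1 := (h.run ω).sum_norm_perturbation_le hM hc hS ht1
    have h2 : ∑ i, ‖a ω (t + 1) i‖ ≤ n * estBound p c S t :=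
      (Finset.sum_le_sum fun i _ => hω t ht i).trans (le_of_eq (by simp))
    have h3 := mul_le_mul_of_nonneg_left h2 (hS.α_pos ht1).le
    linarith
  have ic : ∀ t, 1 ≤ t → Integrable (fun ω => compErr (z ω) (zhat ω) t) P := fun t ht =>
    h.integrable_compErr hM hc hn hS ht
  have it : ∀ t ∈ Finset.Icc 1 T, Integrable (fun ω => S.α t * (n * estBound p c S t) +
      (2 * compErr (z ω) (zhat ω) t + compErr (z ω) (zhat ω) (t + 1))) P := fun t ht =>
    (integrable_const _).add (((ic t (Finset.mem_Icc.1 ht).1).const_mul 2).add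
      (ic (t + 1) (by omega)))
  have h1 := integral_mono_ae (integrable_finsetSum _ fun t ht =>
    h.integrable_dev hM hc hn hp (Finset.mem_Icc.1 ht).1)
    ((((ic 1 le_rfl).const_mul 2).add (integrable_finsetSum _ it)).const_mul K) hle
  simp only [Pi.add_apply] at h1
  refine h1.trans ?_
  rw [integral_const_mul, devBound]
  refine mul_le_mul_of_nonneg_left ?_ hK.pos.le
  rw [integral_add ((ic 1 le_rfl).const_mul 2) (integrable_finsetSum _ it), integral_const_mul,
    integral_finsetSum _ it]
  refine add_le_add (mul_le_mul_of_nonneg_left (h.integral_compErr_le hM hc hn hS le_rfl)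
    zero_le_two) (Finset.sum_le_sum fun t ht => ?_)
  have ht1 := (Finset.mem_Icc.1 ht).1
  have i2 : Integrable (fun ω => 2 * compErr (z ω) (zhat ω) t +
      compErr (z ω) (zhat ω) (t + 1)) P := ((ic t ht1).const_mul 2).add (ic (t + 1) (by omega))
  rw [integral_add (integrable_const _) i2,
    integral_add ((ic t ht1).const_mul 2) (ic (t + 1) (by omega)),
    integral_const_mul (2 : ℝ)]
  have h2 := h.integral_compErr_le hM hc hn hS ht1
  have h3 := h.integral_compErr_le hM hc hn hS (show 1 ≤ t + 1 by omega)
  have h4 : n * (1 + c.C) * S.s (t + 1) ≤ n * (1 + c.C) * S.s t := by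
    have := hc.C_nonneg
    have := hS.s_succ_le ht1
    gcongr
  simp only [integral_const, probReal_univ, one_smul]
  linarith

end Execution

end Expectation

/-! ### Bounds on regret and violation -/

section Bounds

open Metric Set

/-- Telescoping of a bounded energy, after division by nonincreasing stepsizes. -/
theorem sum_le_of_energy {A U w e : ℕ → ℝ} {D : ℝ} {T : ℕ} (hT : 1 ≤ T)
    (hw : ∀ t, 1 ≤ t → 0 < w t) (hmono : ∀ t, 1 ≤ t → (w t)⁻¹ ≤ (w (t + 1))⁻¹)
    (hU0 : ∀ t, 1 ≤ t → 0 ≤ U t) (hU : ∀ t, 1 ≤ t → U t ≤ D)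
    (h : ∀ t, 1 ≤ t → t ≤ T → w t * A t ≤ U t - U (t + 1) + e t) :
    ∑ t ∈ Finset.Icc 1 T, A t ≤ (w T)⁻¹ * D + ∑ t ∈ Finset.Icc 1 T, (w t)⁻¹ * e t := by
  have h1 := sum_mul_sub_succ_le hmono (fun t ht => (inv_pos.2 (hw t ht)).le) hU0 hU hT
  have h2 : ∑ t ∈ Finset.Icc 1 T, A t ≤
      ∑ t ∈ Finset.Icc 1 T, ((w t)⁻¹ * (U t - U (t + 1)) + (w t)⁻¹ * e t) := by
    refine Finset.sum_le_sum fun t ht => ?_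
    obtain ⟨ht1, htT⟩ := Finset.mem_Icc.1 ht
    rw [← mul_add, ← div_eq_inv_mul, le_div_iff₀ (hw t ht1), mul_comm]
    exact h t ht1 htT
  rw [Finset.sum_add_distrib] at h2
  linarith

/-- Twice the error in the slope of the penalty towards a shrunk feasible comparator, summed over
the agents: the violation around the comparator, and the effect of smoothing. -/
def violErr (n : ℕ) (c : Constants) (S : Schedule) (t : ℕ) : ℝ :=
  2 * n * (S.γ t * (S.ξ t ^ 2 * c.F₂ ^ 2 + 2 * c.F₂ * c.G₂ * S.δ c.r t))

/-- A bound on the expected total squared violation. -/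
def violSqBound (n p : ℕ) (c : Constants) (S : Schedule) (K : ℝ) (T : ℕ) : ℝ :=
  (S.α T * S.γ T)⁻¹ * (8 * n * c.R ^ 2) +
    ∑ t ∈ Finset.Icc 1 T, (S.γ t)⁻¹ * (Execution.stepErr n p c S K t + violErr n c S t)

/-- The bound on the expected constraint violation. The weight `T ^ (θ₂ / 2)` balances the squared
violation against the number of terms. -/
def ccvBound (n p : ℕ) (c : Constants) (S : Schedule) (K K' : ℝ) (T : ℕ) : ℝ :=
  1 / 2 * ((T : ℝ) ^ (S.θ₂ / 2) * violSqBound n p c S K T +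
    n * ((T : ℝ) ^ (-(S.θ₂ / 2)) * (T : ℝ) ^ (1 : ℝ))) +
  2 * c.G₂ * Execution.devBound n p c S K' T

/-- What remains of one step under Slater's condition, divided by the stepsize. The last term pays
for the times before `t₀`, at which the shrunk Slater point may have no margin. -/
def slaterErr (n p : ℕ) (c : Constants) (S : Schedule) (K ς : ℝ) (t₀ t : ℕ) : ℝ :=
  Execution.stepErr n p c S K t + violErr n c S t + n * ς * c.G₂ * (S.γ t * S.δ c.r t) +
    n * ς * c.F₂ * S.γ t₀

/-- The bound on the expected constraint violation under Slater's condition. -/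
def slaterBound (n p : ℕ) (c : Constants) (S : Schedule) (K K' ς : ℝ) (t₀ : ℕ) (T : ℕ) : ℝ :=
  ς⁻¹ * ((S.α T * S.γ T)⁻¹ * (8 * n * c.R ^ 2) +
    ∑ t ∈ Finset.Icc 1 T, (S.γ t)⁻¹ * slaterErr n p c S K ς t₀ t) +
  2 * c.G₂ * Execution.devBound n p c S K' T

/-- The expected contribution of one time to the regret. -/
def regretErr (n p : ℕ) (c : Constants) (S : Schedule) (K : ℝ) (t : ℕ) : ℝ :=
  (4 * c.R * (n * (1 + c.C) * S.s t) + n * (S.s t ^ 2 * c.C)) / (2 * S.α t) +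
  n * (2 * p * c.L * c.R * S.δ c.r t + c.G₁ * c.R * S.ξ t +
    S.γ t * (S.ξ t ^ 2 * c.F₂ ^ 2 + 2 * c.F₂ * c.G₂ * S.δ c.r t)) +
  n * (K * (S.α t / S.δ c.r t ^ 2) + 2 * c.F₂ * c.G₂ * (S.γ t * S.δ c.r t))

/-- The bound on the expected regret. -/
def regretBound (n p : ℕ) (c : Constants) (S : Schedule) (K K' : ℝ) (T : ℕ) : ℝ :=
  1 / (n : ℝ) * ((S.α T)⁻¹ * (9 / 2 * n * c.R ^ 2) + ∑ t ∈ Finset.Icc 1 T, regretErr n p c S K t +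
    2 * (c.G₁ + 2 * c.R * c.L) * Execution.devBound n p c S K' T)

/-- The random contribution of one time to the regret, apart from the correlation of the noise
with the comparator. -/
def stepGap {n p : ℕ} (M : Problem n p) (c : Constants) (S : Schedule)
    (x z zhat a : ℕ → Fin n → Vec p) (t : ℕ) : ℝ :=
  (4 * c.R * compErr z zhat t + compErrSq z zhat t) / (2 * S.α t) +
  S.α t / 2 * ∑ i, ‖a (t + 1) i‖ ^ 2 +
  n * (2 * p * c.L * c.R * S.δ c.r t + c.G₁ * c.R * S.ξ t +
    S.γ t * (S.ξ t ^ 2 * c.F₂ ^ 2 + 2 * c.F₂ * c.G₂ * S.δ c.r t)) -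
  S.γ t * ∑ i, M.viol i t (x t i) ^ 2 -
  ∑ i, inner ℝ (a (t + 1) i - M.meanEst c S i t (x t i)) (x t i)

/-- The regret against a fixed comparator, along one realization. The noise is split into its
correlation with the decisions, which has mean zero, and its correlation with the comparator, which
is controlled by the norm of the accumulated noise, uniformly in the comparator. -/
theorem IsRun.sum_gap_le {n p : ℕ} {Z : Type v} {M : Problem n p} {c : Constants} {S : Schedule}
    {Q : Vec p → Z → Vec p} {u : ℕ → Fin n → Vec p} {ζ : ℕ → Fin n → Z}
    {x z zhat a : ℕ → Fin n → Vec p} {v : ℕ → (i : Fin n) → Vec (M.m i)} {T : ℕ}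
    (h : IsRun M c S Q u ζ x z zhat a v) (hM : M.Standing c) (hc : c.Valid) (hn : 0 < n)
    (hp : 0 < p) (hS : S.Admissible p c) (hT : 1 ≤ T)
    (hx : ∀ t, 1 ≤ t → ∀ i, closedBall (x t i) (S.δ c.r t) ⊆ M.X) {y : Vec p}
    (hy : y ∈ M.feasible T) :
    ∑ t ∈ Finset.Icc 1 T, ∑ j, inner ℝ (gradientWithin (M.f j t) M.X (x t j)) (x t j - y) ≤
      (S.α T)⁻¹ * (9 / 2 * n * c.R ^ 2) + ∑ t ∈ Finset.Icc 1 T, stepGap M c S x z zhat a t +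
      S.α T / (2 * n) * ‖∑ t ∈ Finset.Icc 1 T, (1 - S.ξ t) •
        ∑ i, (a (t + 1) i - M.meanEst c S i t (x t i))‖ ^ 2 := by
  have hR := hc.R_pos
  have hn' : (0 : ℝ) < n := by exact_mod_cast hn
  set N : ℕ → Fin n → Vec p := fun t i => a (t + 1) i - M.meanEst c S i t (x t i) with hN
  set V := ∑ t ∈ Finset.Icc 1 T, (1 - S.ξ t) • ∑ i, N t i with hV
  have hstep : ∀ t, 1 ≤ t → t ≤ T → S.α t *
      ((∑ j, inner ℝ (gradientWithin (M.f j t) M.X (x t j)) (x t j - y)) -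
        inner ℝ ((1 - S.ξ t) • ∑ i, N t i) y) ≤
      energy c S y z t / 2 - energy c S y z (t + 1) / 2 + S.α t * stepGap M c S x z zhat a t := by
    intro t ht htT
    have hα := hS.α_pos ht
    have hδ := Schedule.Admissible.δ_pos (S := S) hc ht
    have hξ := Schedule.Admissible.ξ_pos (S := S) ht
    have h1 := h.gap_step hM hc hn hp hS ht (hx t ht) hy.1 fun i =>
      hM.violSlope_le (i := i) hc hn hp hS ht (hx t ht i) hy.1
        (Problem.local_le_of_mem_feasible hy ht htT i)
    have h2 : ∀ i, inner ℝ (gradientWithin (M.f i t) M.X (x t i)) (x t i - y) -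
        c.G₁ * c.R * S.ξ t ≤
        inner ℝ (gradientWithin (M.f i t) M.X (x t i)) (x t i - (1 - S.ξ t) • y) := by
      intro i
      have h3 := real_inner_le_norm (-gradientWithin (M.f i t) M.X (x t i)) y
      have h4 : ‖-gradientWithin (M.f i t) M.X (x t i)‖ * ‖y‖ ≤ c.G₁ * c.R := by
        rw [norm_neg]
        exact mul_le_mul (hM.f_grad_bound i t ht _ (hx t ht i (mem_closedBall_self hδ.le)))
          (hM.norm_le hy.1) (norm_nonneg _) (hM.G₁_nonneg hc hn)
      have h5 := mul_le_mul_of_nonneg_left (h3.trans h4) hξ.le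
      rw [inner_neg_left] at h5
      rw [inner_sub_right, inner_sub_right, inner_smul_right]
      linarith
    have h6 := Finset.sum_le_sum fun i (_ : i ∈ Finset.univ) => h2 i
    have h7 : ∑ i, inner ℝ (N t i) (x t i - (1 - S.ξ t) • y) =
        (∑ i, inner ℝ (N t i) (x t i)) - inner ℝ ((1 - S.ξ t) • ∑ i, N t i) y := by
      simp only [inner_sub_right, inner_smul_right, Finset.sum_sub_distrib, ← Finset.mul_sum,
        real_inner_smul_left, sum_inner]
    have e : S.α t * ((4 * c.R * compErr z zhat t + compErrSq z zhat t) / (2 * S.α t)) =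
        (4 * c.R * compErr z zhat t + compErrSq z zhat t) / 2 := by
      field_simp
    simp only [Finset.sum_add_distrib, Finset.sum_sub_distrib, ← Finset.mul_sum, Finset.sum_const,
      Finset.card_univ, Fintype.card_fin, nsmul_eq_mul] at h1 h6
    rw [h7] at h1
    have h8 := mul_le_mul_of_nonneg_left h6 hα.le
    unfold stepGap
    rw [mul_sub, mul_sub, mul_sub, mul_add, mul_add, e]
    simp only [N] at h1 ⊢
    linarith
  have h1 := sum_le_of_energy (D := 4 * n * c.R ^ 2) hT (fun t ht => hS.α_pos ht)
    (fun t ht => hS.inv_α_le_succ ht)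
    (fun t ht => div_nonneg (IsRun.energy_nonneg hc ht y) zero_le_two)
    (fun t ht => by linarith [h.energy_le hM hc hS ht hy.1]) hstep
  have h2 : ∑ t ∈ Finset.Icc 1 T, (S.α t)⁻¹ * (S.α t * stepGap M c S x z zhat a t) =
      ∑ t ∈ Finset.Icc 1 T, stepGap M c S x z zhat a t :=
    Finset.sum_congr rfl fun t ht => inv_mul_cancel_left₀ (hS.α_pos (Finset.mem_Icc.1 ht).1).ne' _
  rw [h2, Finset.sum_sub_distrib, ← sum_inner, ← hV] at h1
  have hα := hS.α_pos hT
  have h3 : inner ℝ V y ≤ ‖V‖ * c.R := (real_inner_le_norm _ _).trans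
    (mul_le_mul_of_nonneg_left (hM.norm_le hy.1) (norm_nonneg _))
  have h4 : ‖V‖ * c.R ≤ (S.α T)⁻¹ * (1 / 2 * n * c.R ^ 2) + S.α T / (2 * n) * ‖V‖ ^ 2 := by
    have h5 : 0 ≤ S.α T / (2 * n) * (‖V‖ - n * c.R / S.α T) ^ 2 := by positivity
    have e : S.α T / (2 * n) * (‖V‖ - n * c.R / S.α T) ^ 2 =
        (S.α T)⁻¹ * (1 / 2 * n * c.R ^ 2) + S.α T / (2 * n) * ‖V‖ ^ 2 - ‖V‖ * c.R := by
      field_simp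
      ring
    linarith
  linarith

namespace Execution

open Schedule.Admissible Problem

set_option linter.unusedSectionVars false

variable {n p : ℕ} {Ω : Type u} [MeasurableSpace Ω] {Z : Type v} [MeasurableSpace Z]
  {M : Problem n p} {c : Constants} {S : Schedule} {P : Measure Ω} [IsProbabilityMeasure P]
  {ν : Measure Z} {Q : Vec p → Z → Vec p} {Y : Set (Vec p)} {u : ℕ → Fin n → Ω → Vec p}
  {ζ : ℕ → Fin n → Ω → Z} {x z zhat a : Ω → ℕ → Fin n → Vec p}
  {v : Ω → ℕ → (i : Fin n) → Vec (M.m i)} {t : ℕ} {i : Fin n}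

theorem ae_all_closedBall_subset (h : Execution M c S P ν Q Y u ζ x z zhat a v) (hM : M.Standing c)
    (hc : c.Valid) (hn : 0 < n) (hp : 0 < p) :
    ∀ᵐ ω ∂P, ∀ t, 1 ≤ t → ∀ i, closedBall (x ω t i) (S.δ c.r t) ⊆ M.X := by
  refine ae_all_iff.2 fun t => ?_
  by_cases ht : 1 ≤ t
  · filter_upwards [ae_all_iff.2 fun i => h.ae_closedBall_subset hM hc hn hp ht i] with ω hω _
    exact hω
  · exact ae_of_all _ fun ω h1 => absurd h1 ht

/-- Towards a shrunk feasible comparator the slope contributes twice the squared violation, once of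
which pays for the squared step. -/
theorem integral_viol_sq_step (h : Execution M c S P ν Q Y u ζ x z zhat a v) (hM : M.Standing c)
    (hc : c.Valid) (hn : 0 < n) (hp : 0 < p) {K : ℝ} (hK : S.VarianceBound p c K)
    (hS : S.Admissible p c) (ht : 1 ≤ t) {y : Vec p} (hy : y ∈ M.X)
    (hf : ∀ i k, M.g i t y k ≤ 0) :
    S.α t * S.γ t * ∑ i, ∫ ω, M.viol i t (x ω t i) ^ 2 ∂P ≤
      ∫ ω, energy c S y (z ω) t ∂P - ∫ ω, energy c S y (z ω) (t + 1) ∂P +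
      S.α t * (stepErr n p c S K t + violErr n c S t) := by
  have iv := fun i => h.integrable_viol_sq hM hc hn hp ht i
  set b := S.ξ t ^ 2 * c.F₂ ^ 2 + 2 * c.F₂ * c.G₂ * S.δ c.r t with hb
  have h1 := h.integral_step_le hM hc hn hp hK hS ht hy
    (β := fun i ω => b - M.viol i t (x ω t i) ^ 2) (fun i => (integrable_const _).sub (iv i))
    (by
      filter_upwards [h.ae_all_closedBall_subset hM hc hn hp] with ω hω i
      exact hM.violSlope_le hc hn hp hS ht (hω t ht i) hy (hf i))
  have h2 : ∀ i, ∫ ω, (b - M.viol i t (x ω t i) ^ 2) ∂P =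
      b - ∫ ω, M.viol i t (x ω t i) ^ 2 ∂P := by
    intro i
    rw [integral_sub (integrable_const _) (iv i)]
    simp
  simp only [h2] at h1
  have h3 : ∑ i, (-(2 * (b - ∫ ω, M.viol i t (x ω t i) ^ 2 ∂P)) -
      ∫ ω, M.viol i t (x ω t i) ^ 2 ∂P) =
      (∑ i, ∫ ω, M.viol i t (x ω t i) ^ 2 ∂P) - 2 * n * b := by
    rw [← sub_eq_zero]
    simp only [Finset.sum_sub_distrib, Finset.sum_neg_distrib, ← Finset.mul_sum, Finset.sum_const,
      Finset.card_univ, Fintype.card_fin, nsmul_eq_mul]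
    ring
  rw [h3] at h1
  rw [violErr, ← hb]
  linarith

/-- The Slater point is feasible, so the average of the two slope bounds is a slope bound. One half
pays for the squared step, the other leaves a multiple of the violation itself. -/
theorem integral_viol_step_of_slater (h : Execution M c S P ν Q Y u ζ x z zhat a v)
    (hM : M.Standing c) (hc : c.Valid) (hn : 0 < n) (hp : 0 < p) {K : ℝ}
    (hK : S.VarianceBound p c K) (hS : S.Admissible p c) (ht : 1 ≤ t) {y : Vec p} (hy : y ∈ M.X)
    {ς : ℝ} (hς : 0 < ς) (hf : ∀ i k, M.g i t y k ≤ -ς) {t₀ : ℕ}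
    (ht₀ : ∀ t, t₀ ≤ t → S.ξ t ≤ ς / (2 * (ς + c.F₂))) :
    S.α t * S.γ t * (ς * ∑ i, ∫ ω, M.viol i t (x ω t i) ∂P) ≤
      ∫ ω, energy c S y (z ω) t ∂P - ∫ ω, energy c S y (z ω) (t + 1) ∂P +
      S.α t * slaterErr n p c S K ς t₀ t := by
  have hα := hS.α_pos ht
  have hγ := hS.γ_pos ht
  have hδ := δ_pos (S := S) hc ht
  have hF := hc.F₂_pos
  have hG := hM.G₂_nonneg hc hn
  have hγ₀ : 0 ≤ S.γ t₀ := by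
    have := hS.γ₀_mem.1
    unfold Schedule.γ
    positivity
  have hf0 : ∀ i k, M.g i t y k ≤ 0 := fun i k => (hf i k).trans (by linarith)
  have iv := fun i => h.integrable_viol_sq hM hc hn hp ht i
  have iv1 := fun i => h.integrable_viol hM hc hn hp ht i
  rcases le_total t₀ t with h0 | h0
  · set b := S.ξ t ^ 2 * c.F₂ ^ 2 + 2 * c.F₂ * c.G₂ * S.δ c.r t with hb
    have hb0 : 0 ≤ b := by positivity
    have h1 := h.integral_step_le hM hc hn hp hK hS ht hy
      (β := fun i ω => (1 / 2) * (b + ς * c.G₂ * S.δ c.r t) -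
        ((1 / 2) * M.viol i t (x ω t i) ^ 2 + ς / 2 * M.viol i t (x ω t i)))
      (fun i => (integrable_const _).sub (((iv i).const_mul _).add ((iv1 i).const_mul _)))
      (by
        filter_upwards [h.ae_all_closedBall_subset hM hc hn hp] with ω hω i
        have h2 := hM.violSlope_le hc hn hp hS ht (hω t ht i) hy (hf0 i)
        have h3 := hM.violSlope_le_of_margin hc hn hp hS ht (hω t ht i) hy hς (hf i) (ht₀ t h0)
        linarith)
    have h2 : ∀ i, ∫ ω, ((1 / 2) * (b + ς * c.G₂ * S.δ c.r t) -
        ((1 / 2) * M.viol i t (x ω t i) ^ 2 + ς / 2 * M.viol i t (x ω t i))) ∂P =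
        (1 / 2) * (b + ς * c.G₂ * S.δ c.r t) -
        ((1 / 2) * ∫ ω, M.viol i t (x ω t i) ^ 2 ∂P + ς / 2 * ∫ ω, M.viol i t (x ω t i) ∂P) := by
      intro i
      have i2 : Integrable (fun ω => (1 / 2) * M.viol i t (x ω t i) ^ 2 +
          ς / 2 * M.viol i t (x ω t i)) P := ((iv i).const_mul _).add ((iv1 i).const_mul _)
      rw [integral_sub (integrable_const _) i2,
        integral_add ((iv i).const_mul _) ((iv1 i).const_mul _)]
      simp only [integral_const, probReal_univ, one_smul, integral_const_mul]
    simp only [h2] at h1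
    have h3 : ∑ i, (-(2 * ((1 / 2) * (b + ς * c.G₂ * S.δ c.r t) -
        ((1 / 2) * ∫ ω, M.viol i t (x ω t i) ^ 2 ∂P + ς / 2 * ∫ ω, M.viol i t (x ω t i) ∂P))) -
        ∫ ω, M.viol i t (x ω t i) ^ 2 ∂P) =
        (ς * ∑ i, ∫ ω, M.viol i t (x ω t i) ∂P) - n * (b + ς * c.G₂ * S.δ c.r t) := by
      rw [← sub_eq_zero]
      simp only [Finset.sum_sub_distrib, Finset.sum_neg_distrib, Finset.sum_add_distrib,
        ← Finset.mul_sum, Finset.sum_const, Finset.card_univ, Fintype.card_fin, nsmul_eq_mul]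
      ring
    rw [h3] at h1
    have h4 : 0 ≤ S.α t * (n * (S.γ t * b) + n * ς * c.F₂ * S.γ t₀) := by positivity
    rw [slaterErr, violErr, ← hb]
    linarith
  · have h1 := h.integral_viol_sq_step hM hc hn hp hK hS ht hy hf0
    have h2 : 0 ≤ S.α t * S.γ t * ∑ i, ∫ ω, M.viol i t (x ω t i) ^ 2 ∂P := by
      have : 0 ≤ ∑ i, ∫ ω, M.viol i t (x ω t i) ^ 2 ∂P :=
        Finset.sum_nonneg fun i _ => integral_nonneg fun ω => sq_nonneg _
      positivity
    have h3 : ∑ i, ∫ ω, M.viol i t (x ω t i) ∂P ≤ n * c.F₂ := by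
      refine (Finset.sum_le_sum fun i _ => ?_).trans (le_of_eq (?_ : ∑ _i : Fin n, c.F₂ = _))
      · refine (integral_mono_ae (iv1 i) (integrable_const c.F₂) ?_).trans (by simp)
        filter_upwards [h.ae_x_mem hM hc hn hp ht i] with ω hω
        exact hM.viol_le ht hω
      · simp
    have h4 : S.γ t * (ς * ∑ i, ∫ ω, M.viol i t (x ω t i) ∂P) ≤ n * ς * c.F₂ * S.γ t₀ := by
      calc _ ≤ S.γ t₀ * (ς * (n * c.F₂)) := by
            refine mul_le_mul (hS.γ_monotone h0) (by gcongr) ?_ hγ₀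
            exact mul_nonneg hς.le (Finset.sum_nonneg fun i _ => integral_nonneg fun ω =>
              viol_nonneg _ _ _)
        _ = _ := by ring
    have h5 := mul_le_mul_of_nonneg_left h4 hα.le
    have h6 : 0 ≤ S.α t * (n * ς * c.G₂ * (S.γ t * S.δ c.r t)) := by positivity
    rw [slaterErr]
    linarith

theorem integral_energy_nonneg (hc : c.Valid) (ht : 1 ≤ t) (y : Vec p) :
    0 ≤ ∫ ω, energy c S y (z ω) t ∂P :=
  integral_nonneg fun _ => IsRun.energy_nonneg hc ht y

theorem integral_energy_le (h : Execution M c S P ν Q Y u ζ x z zhat a v) (hM : M.Standing c)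
    (hc : c.Valid) (hn : 0 < n) (hS : S.Admissible p c) (ht : 1 ≤ t) {y : Vec p} (hy : y ∈ M.X) :
    ∫ ω, energy c S y (z ω) t ∂P ≤ 8 * n * c.R ^ 2 :=
  (integral_mono (h.integrable_energy hM hc hn hS ht hy) (integrable_const _) fun ω =>
    (h.run ω).energy_le hM hc hS ht hy).trans (by simp)

theorem sum_integral_viol_sq_le (h : Execution M c S P ν Q Y u ζ x z zhat a v) (hM : M.Standing c)
    (hc : c.Valid) (hn : 0 < n) (hp : 0 < p) {K : ℝ} (hK : S.VarianceBound p c K)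
    (hS : S.Admissible p c) {T : ℕ} (hT : 1 ≤ T) :
    ∑ t ∈ Finset.Icc 1 T, ∑ i, ∫ ω, M.viol i t (x ω t i) ^ 2 ∂P ≤ violSqBound n p c S K T := by
  obtain ⟨y, hy⟩ := hM.feasible_nonempty T hT
  refine (sum_le_of_energy hT (fun t ht => mul_pos (hS.α_pos ht) (hS.γ_pos ht))
    (fun t ht => hS.inv_αγ_le_succ ht) (fun t ht => integral_energy_nonneg hc ht y)
    (fun t ht => h.integral_energy_le hM hc hn hS ht hy.1) fun t ht htT =>
      h.integral_viol_sq_step hM hc hn hp hK hS ht hy.1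
        (local_le_of_mem_feasible hy ht htT)).trans (le_of_eq ?_)
  rw [violSqBound]
  congr 1
  refine Finset.sum_congr rfl fun t ht => ?_
  have ht1 := (Finset.mem_Icc.1 ht).1
  have := hS.α_pos ht1
  rw [mul_inv, mul_mul_mul_comm, inv_mul_cancel₀ this.ne', one_mul]

theorem sum_integral_viol_le_of_slater (h : Execution M c S P ν Q Y u ζ x z zhat a v)
    (hM : M.Standing c) (hc : c.Valid) (hn : 0 < n) (hp : 0 < p) {K : ℝ}
    (hK : S.VarianceBound p c K) (hS : S.Admissible p c) {ς : ℝ} (hς : 0 < ς) (hs : M.Slater ς)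
    {t₀ : ℕ} (ht₀ : ∀ t, t₀ ≤ t → S.ξ t ≤ ς / (2 * (ς + c.F₂))) {T : ℕ} (hT : 1 ≤ T) :
    ∑ t ∈ Finset.Icc 1 T, ∑ i, ∫ ω, M.viol i t (x ω t i) ∂P ≤
      ς⁻¹ * ((S.α T * S.γ T)⁻¹ * (8 * n * c.R ^ 2) +
        ∑ t ∈ Finset.Icc 1 T, (S.γ t)⁻¹ * slaterErr n p c S K ς t₀ t) := by
  obtain ⟨y, hy, hf⟩ := hs
  rw [le_inv_mul_iff₀ hς, Finset.mul_sum]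
  refine (sum_le_of_energy hT (fun t ht => mul_pos (hS.α_pos ht) (hS.γ_pos ht))
    (fun t ht => hS.inv_αγ_le_succ ht) (fun t ht => integral_energy_nonneg hc ht y)
    (fun t ht => h.integral_energy_le hM hc hn hS ht hy) fun t ht htT =>
      h.integral_viol_step_of_slater hM hc hn hp hK hS ht hy hς (fun i k => hf t ht ⟨i, k⟩)
        ht₀).trans (le_of_eq ?_)
  congr 1
  refine Finset.sum_congr rfl fun t ht => ?_
  have ht1 := (Finset.mem_Icc.1 ht).1
  have := hS.α_pos ht1
  rw [mul_inv, mul_mul_mul_comm, inv_mul_cancel₀ this.ne', one_mul]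

theorem integral_netCCV_le (h : Execution M c S P ν Q Y u ζ x z zhat a v) (hM : M.Standing c)
    (hc : c.Valid) (hn : 0 < n) (hp : 0 < p) (hS : S.Admissible p c) {K' : ℝ}
    (hK' : AveragingBound n c.w c.B K') (T : ℕ) :
    ∫ ω, M.netCCV T (x ω) ∂P ≤ (∑ t ∈ Finset.Icc 1 T, ∑ i, ∫ ω, M.viol i t (x ω t i) ∂P) +
      2 * c.G₂ * devBound n p c S K' T := by
  have iv : ∀ t ∈ Finset.Icc 1 T, ∀ i ∈ (Finset.univ : Finset (Fin n)),
      Integrable (fun ω => M.viol i t (x ω t i)) P := fun t ht i _ =>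
    h.integrable_viol hM hc hn hp (Finset.mem_Icc.1 ht).1 i
  have iV := integrable_finsetSum _ fun t ht => integrable_finsetSum _ (iv t ht)
  have iD : Integrable (fun ω => ∑ t ∈ Finset.Icc 1 T, dev (x ω t)) P :=
    integrable_finsetSum _ fun t ht => h.integrable_dev hM hc hn hp (Finset.mem_Icc.1 ht).1
  have h1 := integral_mono_ae (h.integrable_netCCV hM hc hn hp T)
    (iV.add (iD.const_mul (2 * c.G₂))) (by
      filter_upwards [h.ae_all_x_mem hM hc hn hp] with ω hω
      exact hM.netCCV_le hc hn fun t ht _ => hω t ht)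
  simp only [Pi.add_apply] at h1
  rw [integral_add iV (iD.const_mul _), integral_const_mul, integral_finsetSum _ fun t ht =>
    integrable_finsetSum _ (iv t ht)] at h1
  have h2 := mul_le_mul_of_nonneg_left (h.integral_sum_dev_le hM hc hn hp hS hK' T)
    (show 0 ≤ 2 * c.G₂ by linarith [hM.G₂_nonneg hc hn])
  have h3 : ∑ t ∈ Finset.Icc 1 T, ∫ ω, ∑ i, M.viol i t (x ω t i) ∂P =
      ∑ t ∈ Finset.Icc 1 T, ∑ i, ∫ ω, M.viol i t (x ω t i) ∂P :=
    Finset.sum_congr rfl fun t ht => integral_finsetSum _ (iv t ht)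
  rw [h3] at h1
  linarith

/-- The violation is at most `(κ viol² + κ⁻¹) / 2` with `κ = T ^ (θ₂ / 2)`. -/
theorem integral_netCCV_le_ccvBound (h : Execution M c S P ν Q Y u ζ x z zhat a v)
    (hM : M.Standing c) (hc : c.Valid) (hn : 0 < n) (hp : 0 < p) {K K' : ℝ}
    (hK : S.VarianceBound p c K) (hS : S.Admissible p c) (hK' : AveragingBound n c.w c.B K') {T : ℕ}
    (hT : 1 ≤ T) : ∫ ω, M.netCCV T (x ω) ∂P ≤ ccvBound n p c S K K' T := by
  refine (h.integral_netCCV_le hM hc hn hp hS hK' T).trans ?_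
  have hT0 : (0 : ℝ) < T := by exact_mod_cast hT
  set κ := (T : ℝ) ^ (S.θ₂ / 2) with hκ
  have hκ0 : 0 < κ := by positivity
  have e : (T : ℝ) ^ (-(S.θ₂ / 2)) = κ⁻¹ := Real.rpow_neg hT0.le _
  have hi : ∀ t ∈ Finset.Icc 1 T, ∀ i : Fin n, ∫ ω, M.viol i t (x ω t i) ∂P ≤
      1 / 2 * κ * ∫ ω, M.viol i t (x ω t i) ^ 2 ∂P + 1 / 2 * κ⁻¹ := by
    intro t ht i
    have ht1 := (Finset.mem_Icc.1 ht).1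
    have i2 := (h.integrable_viol_sq hM hc hn hp ht1 i).const_mul (1 / 2 * κ)
    have h1 := integral_mono (h.integrable_viol hM hc hn hp ht1 i)
      (i2.add (integrable_const (1 / 2 * κ⁻¹))) fun ω => by
        have h2 : 0 ≤ 1 / 2 * κ * (M.viol i t (x ω t i) - κ⁻¹) ^ 2 := by positivity
        have e2 : 1 / 2 * κ * (M.viol i t (x ω t i) - κ⁻¹) ^ 2 =
            1 / 2 * κ * M.viol i t (x ω t i) ^ 2 + 1 / 2 * κ⁻¹ - M.viol i t (x ω t i) := by
          field_simp
          ring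
        simp only [Pi.add_apply]
        linarith
    simp only [Pi.add_apply] at h1
    rw [integral_add i2 (integrable_const _), integral_const_mul] at h1
    simpa using h1
  have h1 := Finset.sum_le_sum fun t ht => Finset.sum_le_sum fun i (_ : i ∈ Finset.univ) =>
    hi t ht i
  simp only [Finset.sum_add_distrib, ← Finset.mul_sum, Finset.sum_const, Finset.card_univ,
    Fintype.card_fin, nsmul_eq_mul, Nat.card_Icc, Nat.add_sub_cancel] at h1
  have h2 := mul_le_mul_of_nonneg_left (h.sum_integral_viol_sq_le hM hc hn hp hK hS hT) hκ0.le
  rw [ccvBound, ← hκ, e, Real.rpow_one]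
  linarith

theorem integral_netCCV_le_slaterBound (h : Execution M c S P ν Q Y u ζ x z zhat a v)
    (hM : M.Standing c) (hc : c.Valid) (hn : 0 < n) (hp : 0 < p) {K K' : ℝ}
    (hK : S.VarianceBound p c K) (hS : S.Admissible p c) (hK' : AveragingBound n c.w c.B K')
    {ς : ℝ} (hς : 0 < ς) (hs : M.Slater ς)
    {t₀ : ℕ} (ht₀ : ∀ t, t₀ ≤ t → S.ξ t ≤ ς / (2 * (ς + c.F₂))) {T : ℕ}
    (hT : 1 ≤ T) : ∫ ω, M.netCCV T (x ω) ∂P ≤ slaterBound n p c S K K' ς t₀ T := by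
  refine (h.integral_netCCV_le hM hc hn hp hS hK' T).trans ?_
  exact add_le_add_left
    (h.sum_integral_viol_le_of_slater hM hc hn hp hK hS hς hs ht₀ hT) _

theorem integrable_inner_estNoise (h : Execution M c S P ν Q Y u ζ x z zhat a v)
    (hM : M.Standing c) (hc : c.Valid) (hn : 0 < n) (hp : 0 < p) (hS : S.Admissible p c)
    (ht : 1 ≤ t) (i : Fin n) :
    Integrable (fun ω => inner ℝ (estNoise M c S x a t i ω) (x ω t i)) P ∧
      ∫ ω, inner ℝ (estNoise M c S x a t i ω) (x ω t i) ∂P = 0 := by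
  have hb : ∀ᵐ ω ∂P, ‖x ω t i‖ ≤ c.R := by
    filter_upwards [h.ae_x_mem hM hc hn hp ht i] with ω hω
    exact hM.norm_le hω
  exact ⟨integrable_inner_of_bound
    ((h.depends_estNoise hM hc hn hp ht i).aemeasurable h.randomness)
    (h.aemeasurable_x hM hc hn ht i) (h.ae_norm_estNoise_le hM hc hn hp hS ht i) hb,
    h.integral_inner_estNoise_eq_zero hM hc hn hp hS ht i (h.depends_x hM hc hn ht i) hb⟩

theorem integral_stepGap (h : Execution M c S P ν Q Y u ζ x z zhat a v)
    (hM : M.Standing c) (hc : c.Valid) (hn : 0 < n) (hp : 0 < p)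
    (hS : S.Admissible p c) (ht : 1 ≤ t) :
    Integrable (fun ω => stepGap M c S (x ω) (z ω) (zhat ω) (a ω) t) P ∧
    ∫ ω, stepGap M c S (x ω) (z ω) (zhat ω) (a ω) t ∂P ≤
      (4 * c.R * (n * (1 + c.C) * S.s t) + n * (S.s t ^ 2 * c.C)) / (2 * S.α t) +
      S.α t / 2 * ∑ i, ∫ ω, ‖a ω (t + 1) i‖ ^ 2 ∂P +
      n * (2 * p * c.L * c.R * S.δ c.r t + c.G₁ * c.R * S.ξ t +
        S.γ t * (S.ξ t ^ 2 * c.F₂ ^ 2 + 2 * c.F₂ * c.G₂ * S.δ c.r t)) -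
      S.γ t * ∑ i, ∫ ω, M.viol i t (x ω t i) ^ 2 ∂P := by
  have hα := hS.α_pos ht
  set κ := n * (2 * p * c.L * c.R * S.δ c.r t + c.G₁ * c.R * S.ξ t +
    S.γ t * (S.ξ t ^ 2 * c.F₂ ^ 2 + 2 * c.F₂ * c.G₂ * S.δ c.r t)) with hκ
  have ic := (h.integrable_compErr hM hc hn hS ht).const_mul (4 * c.R)
  have ic2 := h.integrable_compErrSq hM hc hn hS ht
  have i1 : Integrable (fun ω => (4 * c.R * compErr (z ω) (zhat ω) t +
      compErrSq (z ω) (zhat ω) t) / (2 * S.α t)) P := (ic.add ic2).div_const _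
  have ia := fun i => h.integrable_sq_a hM hc hn hS ht i
  have i2 : Integrable (fun ω => S.α t / 2 * ∑ i, ‖a ω (t + 1) i‖ ^ 2) P :=
    (integrable_finsetSum _ fun i _ => ia i).const_mul _
  have iv := fun i => h.integrable_viol_sq hM hc hn hp ht i
  have i3 : Integrable (fun ω => S.γ t * ∑ i, M.viol i t (x ω t i) ^ 2) P :=
    (integrable_finsetSum _ fun i _ => iv i).const_mul _
  have iN := fun i => (h.integrable_inner_estNoise hM hc hn hp hS ht i).1
  have i4 : Integrable (fun ω => ∑ i, inner ℝ (estNoise M c S x a t i ω) (x ω t i)) P :=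
    integrable_finsetSum _ fun i _ => iN i
  have i12 : Integrable (fun ω => (4 * c.R * compErr (z ω) (zhat ω) t +
      compErrSq (z ω) (zhat ω) t) / (2 * S.α t) + S.α t / 2 * ∑ i, ‖a ω (t + 1) i‖ ^ 2) P :=
    i1.add i2
  have i12c : Integrable (fun ω => (4 * c.R * compErr (z ω) (zhat ω) t +
      compErrSq (z ω) (zhat ω) t) / (2 * S.α t) + S.α t / 2 * ∑ i, ‖a ω (t + 1) i‖ ^ 2 + κ) P :=
    i12.add (integrable_const κ)
  have i123 : Integrable (fun ω => (4 * c.R * compErr (z ω) (zhat ω) t +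
      compErrSq (z ω) (zhat ω) t) / (2 * S.α t) + S.α t / 2 * ∑ i, ‖a ω (t + 1) i‖ ^ 2 + κ -
      S.γ t * ∑ i, M.viol i t (x ω t i) ^ 2) P := i12c.sub i3
  have e : (fun ω => stepGap M c S (x ω) (z ω) (zhat ω) (a ω) t) = fun ω =>
      (4 * c.R * compErr (z ω) (zhat ω) t +
      compErrSq (z ω) (zhat ω) t) / (2 * S.α t) + S.α t / 2 * ∑ i, ‖a ω (t + 1) i‖ ^ 2 + κ -
      S.γ t * ∑ i, M.viol i t (x ω t i) ^ 2 -
      ∑ i, inner ℝ (estNoise M c S x a t i ω) (x ω t i) := rfl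
  rw [e]
  refine ⟨i123.sub i4, ?_⟩
  rw [integral_sub i123 i4, integral_sub i12c i3, integral_add i12 (integrable_const _),
    integral_add i1 i2, integral_div, integral_add ic ic2, integral_const_mul (4 * c.R),
    integral_const_mul (S.α t / 2), integral_const_mul (S.γ t),
    integral_finsetSum _ fun i _ => ia i, integral_finsetSum _ fun i _ => iv i,
    integral_finsetSum _ fun i _ => iN i]
  simp only [fun i => (h.integrable_inner_estNoise hM hc hn hp hS ht i).2, Finset.sum_const_zero,
    integral_const, probReal_univ, one_smul, sub_zero]
  have h1 := h.integral_compErr_le hM hc hn hS ht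
  have h2 := h.integral_compErrSq_le hM hc hn hS ht
  have := hc.R_pos
  gcongr

/-- The squared steps enter the regret with weight `α_t / 2` through the energy, and once more with
the same weight through the noise correlated with the comparator. The total is what the term `- γ_t
viol²` of the penalty can pay for. -/
theorem integral_netReg_le (h : Execution M c S P ν Q Y u ζ x z zhat a v)
    (hM : M.Standing c) (hc : c.Valid) (hn : 0 < n) (hp : 0 < p) {K K' : ℝ}
    (hK : S.VarianceBound p c K) (hS : S.Admissible p c) (hK' : AveragingBound n c.w c.B K') {T : ℕ}
    (hT : 1 ≤ T) : ∫ ω, M.netReg T (x ω) ∂P ≤ regretBound n p c S K K' T := by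
  have hn' : (0 : ℝ) < n := by exact_mod_cast hn
  have hα := hS.α_pos hT
  set κ := 2 * (c.G₁ + 2 * c.R * c.L) with hκdef
  have hκ : 0 ≤ κ := mul_nonneg zero_le_two (add_nonneg (hM.G₁_nonneg hc hn)
    (mul_nonneg (mul_nonneg zero_le_two hc.R_pos.le) (hM.L_nonneg hc hn hp)))
  set D := (S.α T)⁻¹ * (9 / 2 * n * c.R ^ 2)
  have iD : Integrable (fun ω => ∑ t ∈ Finset.Icc 1 T, dev (x ω t)) P :=
    integrable_finsetSum _ fun t ht => h.integrable_dev hM hc hn hp (Finset.mem_Icc.1 ht).1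
  have iG : ∀ t ∈ Finset.Icc 1 T,
      Integrable (fun ω => stepGap M c S (x ω) (z ω) (zhat ω) (a ω) t) P := fun t ht =>
    (h.integral_stepGap hM hc hn hp hS (Finset.mem_Icc.1 ht).1).1
  obtain ⟨B, hB⟩ := h.exists_noiseSum_bound hM hc hn hp hS T
  have iS := (integrable_sq_norm_of_bound
    ((h.depends_noiseSum hM hc hn hp T).aemeasurable h.randomness) hB).const_mul (S.α T / (2 * n))
  have i1 : Integrable (fun ω => D + ∑ t ∈ Finset.Icc 1 T,
      stepGap M c S (x ω) (z ω) (zhat ω) (a ω) t) P :=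
    (integrable_const D).add (integrable_finsetSum _ iG)
  have i2 : Integrable (fun ω => D + ∑ t ∈ Finset.Icc 1 T,
      stepGap M c S (x ω) (z ω) (zhat ω) (a ω) t +
      S.α T / (2 * n) * ‖noiseSum M c S x a T ω‖ ^ 2) P := i1.add iS
  have h1 := integral_mono_ae (h.integrable_netReg hM hc hn hp hT)
    ((i2.add (iD.const_mul κ)).const_mul (1 / (n : ℝ))) (by
      filter_upwards [h.ae_all_closedBall_subset hM hc hn hp] with ω hω
      exact hM.netReg_le hc hn hp hT
        (fun t ht _ i => hω t ht i (mem_closedBall_self (δ_pos hc ht).le))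
        fun y hy => (h.run ω).sum_gap_le hM hc hn hp hS hT hω hy)
  refine h1.trans ?_
  simp only [Pi.add_apply]
  rw [integral_const_mul, integral_add i2 (iD.const_mul κ), integral_add i1 iS,
    integral_add (integrable_const D) (integrable_finsetSum _ iG), integral_finsetSum _ iG,
    integral_const_mul κ, integral_const_mul (S.α T / (2 * n)), regretBound]
  refine mul_le_mul_of_nonneg_left (add_le_add ?_ (mul_le_mul_of_nonneg_left
    (h.integral_sum_dev_le hM hc hn hp hS hK' T) hκ)) (by positivity)
  simp only [integral_const, probReal_univ, one_smul]
  rw [add_assoc]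
  refine add_le_add le_rfl ?_
  -- the noise correlated with the comparator costs as much as the squared steps themselves
  have h2 : S.α T / (2 * n) * ∫ ω, ‖noiseSum M c S x a T ω‖ ^ 2 ∂P ≤
      ∑ t ∈ Finset.Icc 1 T, S.α t / 2 * ∑ i, ∫ ω, ‖a ω (t + 1) i‖ ^ 2 ∂P := by
    refine (mul_le_mul_of_nonneg_left (h.integral_sq_noiseSum_le hM hc hn hp hS T)
      (by positivity)).trans ?_
    have e : ∀ A : ℝ, S.α T / (2 * n) * (n * A) = S.α T / 2 * A := fun A => by field_simp
    rw [e, Finset.mul_sum]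
    refine Finset.sum_le_sum fun t ht => ?_
    obtain ⟨ht1, htT⟩ := Finset.mem_Icc.1 ht
    have := hS.α_antitone ht1 htT
    have h0 : 0 ≤ ∑ i, ∫ ω, ‖a ω (t + 1) i‖ ^ 2 ∂P :=
      Finset.sum_nonneg fun i _ => integral_nonneg fun ω => sq_nonneg _
    gcongr
  refine (add_le_add le_rfl h2).trans ?_
  rw [← Finset.sum_add_distrib]
  refine Finset.sum_le_sum fun t ht => ?_
  have ht1 := (Finset.mem_Icc.1 ht).1
  have h3 := (h.integral_stepGap hM hc hn hp hS ht1).2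
  have h4 := h.sum_integral_sq_a_le hM hc hn hp hK hS ht1
  rw [regretErr]
  linarith

end Execution

end Bounds

/-! ### Exponents and conclusion -/

section Conclusion

section Exponents

variable {S : Schedule} {n p : ℕ} {c : Constants}

open Schedule Execution

/-- The exponent of the regret bound. -/
def regretExponent (S : Schedule) : ℝ :=
  max S.θ₁ (max (1 - S.θ₁ + 2 * S.θ₃) (1 + S.θ₂ - S.θ₃))

theorem Schedule.powerBounded_variance :
    PowerBounded (fun t => S.α t / S.δ c.r t ^ 2) (2 * S.θ₃ - S.θ₁) := by
  refine ((powerBounded_α.mul (powerBounded_inv_δ (c := c))).mul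
    (powerBounded_inv_δ (c := c))).mono (by linarith) |>.congr fun t _ => ?_
  rw [div_eq_mul_inv, sq, mul_inv, mul_assoc]

namespace Schedule.Admissible

variable (hS : S.Admissible p c)
include hS

theorem exponent_ineqs : 0 < S.θ₁ ∧ S.θ₁ < 1 ∧ 0 < S.θ₂ ∧ S.θ₂ < S.θ₃ ∧
    2 * S.θ₃ ≤ S.θ₁ - S.θ₂ := by
  have := hS.θ₃_mem.2
  exact ⟨hS.θ₁_mem.1, hS.θ₁_mem.2, hS.θ₂_mem.1, hS.θ₃_mem.1, by linarith⟩

theorem powerBounded_penalty :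
    PowerBounded (fun t => S.γ t * (S.ξ t ^ 2 * c.F₂ ^ 2 + 2 * c.F₂ * c.G₂ * S.δ c.r t))
      (S.θ₂ - S.θ₃) := by
  obtain ⟨h1, h2, h3, h4, h5⟩ := hS.exponent_ineqs
  refine (powerBounded_γ.mul ((((powerBounded_ξ.mul powerBounded_ξ).const_mul
    (c.F₂ ^ 2)).mono (b := -S.θ₃) (by linarith)).add ((powerBounded_δ (c := c)).const_mul
    (2 * c.F₂ * c.G₂)))).mono (by linarith) |>.congr fun t _ => ?_
  ring

theorem powerBounded_compression :
    PowerBounded (fun t => 4 * c.R * (n * (1 + c.C) * S.s t) + n * (S.s t ^ 2 * c.C)) (-1) := by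
  refine ((hS.powerBounded_s.const_mul (4 * c.R * (n * (1 + c.C)))).add
    (((hS.powerBounded_s.mul hS.powerBounded_s).const_mul (n * c.C)).mono (by norm_num))).congr
    fun t _ => ?_
  ring

theorem powerBounded_stepErr (K : ℝ) : PowerBounded (stepErr n p c S K) 0 := by
  obtain ⟨h1, h2, h3, h4, h5⟩ := hS.exponent_ineqs
  have p1 : PowerBounded (fun t => S.δ c.r t) 0 := powerBounded_δ.mono (by linarith)
  have p2 := (powerBounded_variance (c := c)).mono (b := 0) (by linarith)
  have p3 := (powerBounded_γ.mul (powerBounded_δ (c := c))).mono (b := 0) (by linarith)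
  have p4 := ((hS.powerBounded_compression (n := n)).mul powerBounded_inv_α).mono (b := 0)
    (by linarith)
  refine (((((PowerBounded.const (4 * c.G₁ * c.R)).add (p1.const_mul (4 * p * c.L * c.R))).add
    (p2.const_mul K)).add (p3.const_mul (2 * c.F₂ * c.G₂))).const_mul (n : ℝ)).add p4 |>.congr
    fun t _ => ?_
  rw [stepErr, div_eq_mul_inv (_ + _)]

theorem powerBounded_violErr : PowerBounded (violErr n c S) 0 := by
  obtain ⟨h1, h2, h3, h4, h5⟩ := hS.exponent_ineqs
  exact (hS.powerBounded_penalty.const_mul (2 * n)).mono (by linarith)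

theorem powerBounded_inv_αγ :
    PowerBounded (fun T => (S.α T * S.γ T)⁻¹ * (8 * n * c.R ^ 2)) (1 - S.θ₂) := by
  obtain ⟨h1, h2, h3, h4, h5⟩ := hS.exponent_ineqs
  refine (((powerBounded_inv_α.mul powerBounded_inv_γ).const_mul (8 * n * c.R ^ 2)).mono
    (by linarith)).congr fun t _ => ?_
  rw [mul_inv, mul_comm]

theorem powerBounded_violSqBound (K : ℝ) :
    PowerBounded (violSqBound n p c S K) (1 - S.θ₂) := by
  obtain ⟨h1, h2, h3, h4, h5⟩ := hS.exponent_ineqs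
  have p1 := (powerBounded_inv_γ.mul ((hS.powerBounded_stepErr (n := n) K).add
    (hS.powerBounded_violErr (n := n)))).sum (by linarith)
  exact hS.powerBounded_inv_αγ.add (p1.mono (by linarith))

theorem powerBounded_devBound (K : ℝ) : PowerBounded (devBound n p c S K) (1 - S.θ₃) := by
  obtain ⟨h1, h2, h3, h4, h5⟩ := hS.exponent_ineqs
  have p1 : PowerBounded (fun t => (n : ℝ) * Problem.estBound p c S t) (S.θ₃ + S.θ₂) := by
    refine PowerBounded.const_mul ?_ _
    refine (((powerBounded_inv_δ (c := c)).const_mul p).mul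
      (((PowerBounded.const c.F₁).mono h3.le).add (powerBounded_γ.const_mul (c.F₂ ^ 2)))).congr
      fun t _ => ?_
    rw [Problem.estBound]
    ring
  have p2 := (powerBounded_α.mul p1).mono (b := -S.θ₃) (by linarith)
  have p3 := ((hS.powerBounded_s.const_mul (n * (1 + c.C))).const_mul 3).mono (b := -S.θ₃)
    (by linarith)
  have p4 := (p2.add p3).sum (by linarith)
  exact (((PowerBounded.const (2 * (n * (1 + c.C) * S.s 1))).mono (by linarith)).add
    (p4.mono (by linarith))).const_mul K

theorem powerBounded_ccvBound (K K' : ℝ) :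
    PowerBounded (ccvBound n p c S K K') (1 - S.θ₂ / 2) := by
  obtain ⟨h1, h2, h3, h4, h5⟩ := hS.exponent_ineqs
  have p1 := ((PowerBounded.rpow (S.θ₂ / 2)).mul
    (hS.powerBounded_violSqBound (n := n) K)).mono (b := 1 - S.θ₂ / 2) (by linarith)
  have p2 := ((PowerBounded.rpow (-(S.θ₂ / 2))).mul (PowerBounded.rpow 1)).mono
    (b := 1 - S.θ₂ / 2) (by linarith)
  exact ((p1.add (p2.const_mul n)).const_mul (1 / 2)).add
    (((hS.powerBounded_devBound (n := n) K').mono (by linarith)).const_mul (2 * c.G₂))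

theorem powerBounded_slaterBound (K K' ς : ℝ) (t₀ : ℕ) :
    PowerBounded (slaterBound n p c S K K' ς t₀) (1 - S.θ₂) := by
  obtain ⟨h1, h2, h3, h4, h5⟩ := hS.exponent_ineqs
  have p1 := (powerBounded_γ.mul (powerBounded_δ (c := c))).mono (b := 0) (by linarith)
  have p2 : PowerBounded (slaterErr n p c S K ς t₀) 0 :=
    (((hS.powerBounded_stepErr K).add hS.powerBounded_violErr).add
      (p1.const_mul (n * ς * c.G₂))).add (PowerBounded.const _)
  have p3 := (powerBounded_inv_γ.mul p2).sum (by linarith)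
  exact ((hS.powerBounded_inv_αγ.add (p3.mono (by linarith))).const_mul ς⁻¹).add
    (((hS.powerBounded_devBound (n := n) K').mono (by linarith)).const_mul (2 * c.G₂))

theorem powerBounded_regretBound (K K' : ℝ) :
    PowerBounded (regretBound n p c S K K') (regretExponent S) := by
  obtain ⟨h1, h2, h3, h4, h5⟩ := hS.exponent_ineqs
  set e := regretExponent S with he
  have e1 : S.θ₁ ≤ e := le_max_left _ _
  have e2 : 1 - S.θ₁ + 2 * S.θ₃ ≤ e := (le_max_left _ _).trans (le_max_right _ _)
  have e3 : 1 + S.θ₂ - S.θ₃ ≤ e := (le_max_right _ _).trans (le_max_right _ _)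
  have p1 := (((hS.powerBounded_compression (n := n)).mul powerBounded_inv_α).const_mul
    (1 / 2)).mono (b := e - 1) (by linarith)
  have p2 : PowerBounded (fun t => S.δ c.r t) (e - 1) := powerBounded_δ.mono (by linarith)
  have p3 : PowerBounded (fun t => S.ξ t) (e - 1) := powerBounded_ξ.mono (by linarith)
  have p4 := hS.powerBounded_penalty.mono (b := e - 1) (by linarith)
  have p5 := (powerBounded_variance (c := c)).mono (b := e - 1) (by linarith)
  have p6 := (powerBounded_γ.mul (powerBounded_δ (c := c))).mono (b := e - 1) (by linarith)
  have p7 : PowerBounded (regretErr n p c S K) (e - 1) := by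
    refine ((p1.add ((((p2.const_mul (2 * p * c.L * c.R)).add (p3.const_mul (c.G₁ * c.R))).add
      p4).const_mul (n : ℝ))).add (((p5.const_mul K).add
      (p6.const_mul (2 * c.F₂ * c.G₂))).const_mul (n : ℝ))).congr fun t _ => ?_
    rw [regretErr, div_eq_mul_inv _ (2 * S.α t), mul_inv]
    ring
  have p8 := (powerBounded_inv_α (S := S)).const_mul (9 / 2 * n * c.R ^ 2)
  refine (((p8.mono e1).add ((p7.sum (by linarith)).mono (by linarith))).add
    (((hS.powerBounded_devBound (n := n) K').mono (b := e) (by linarith)).const_mul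
      (2 * (c.G₁ + 2 * c.R * c.L)))).const_mul (1 / (n : ℝ)) |>.congr fun t _ => ?_
  rw [regretBound, mul_comm (S.α t)⁻¹]

end Schedule.Admissible

end Exponents

/-- A bound that is uniform over all problems and executions and grows like a power of the horizon
gives the rate. -/
theorem expectedRate_of_powerBounded {n p : ℕ} {c : Constants} {S : Schedule}
    {Extra : Problem n p → Prop} {metric : Problem n p → ℕ → (ℕ → Fin n → Vec p) → ℝ} {e : ℝ}
    {bound : ℕ → ℝ} (hb : PowerBounded bound e)
    (H : ∀ (M : Problem n p), M.Standing c → Extra M →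
      ∀ (Ω : Type u) [MeasurableSpace Ω] (P : Measure Ω) [IsProbabilityMeasure P]
      (Z : Type v) [MeasurableSpace Z] (ν : Measure Z) (Q : Vec p → Z → Vec p) (Y : Set (Vec p))
      (u : ℕ → Fin n → Ω → Vec p) (ζ : ℕ → Fin n → Ω → Z)
      (x z zhat a : Ω → ℕ → Fin n → Vec p) (v : Ω → ℕ → (i : Fin n) → Vec (M.m i)),
      Execution M c S P ν Q Y u ζ x z zhat a v → ∀ T, 1 ≤ T →
      Integrable (fun ω => metric M T (x ω)) P ∧ ∫ ω, metric M T (x ω) ∂P ≤ bound T) :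
    ExpectedRate.{u, v} c S Extra metric e := by
  obtain ⟨K, hK0, hK⟩ := hb.exists_nonneg
  refine ⟨K + 1, by linarith, ?_⟩
  intro M hM hE Ω _ P _ Z _ ν Q Y u ζ x z zhat a v h1 h2 h3 h4 T hT
  obtain ⟨hi, hle⟩ := H M hM hE Ω P Z ν Q Y u ζ x z zhat a v ⟨h1, h2, h3, h4⟩ T hT
  refine ⟨hi, hle.trans ((le_abs_self _).trans ((hK T hT).trans ?_))⟩
  gcongr
  linarith

theorem expectedRate_of_admissible {n p : ℕ} (hn : 0 < n) (hp : 0 < p) {c : Constants}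
    (hc : c.Valid) {S : Schedule} (hS : S.Admissible p c) :
    ExpectedRate.{u, v} (n := n) (p := p) c S (fun _ => True) Problem.netReg (regretExponent S) ∧
    ExpectedRate.{u, v} (n := n) (p := p) c S (fun _ => True) Problem.netCCV (1 - S.θ₂ / 2) ∧
    ∀ ς : ℝ, 0 < ς →
      ExpectedRate.{u, v} (n := n) (p := p) c S (fun M => M.Slater ς) Problem.netCCV
        (1 - S.θ₂) := by
  obtain ⟨K, hK⟩ := hS.exists_varianceBound hc
  obtain ⟨K', hK'⟩ := exists_averagingBound n hc.w_mem.1 c.B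
  refine ⟨expectedRate_of_powerBounded (hS.powerBounded_regretBound (n := n) K K') ?_,
    expectedRate_of_powerBounded (hS.powerBounded_ccvBound (n := n) K K') ?_, fun ς hς => ?_⟩
  · intro M hM _ Ω _ P _ Z _ ν Q Y u ζ x z zhat a v h T hT
    exact ⟨h.integrable_netReg hM hc hn hp hT, h.integral_netReg_le hM hc hn hp hK hS hK' hT⟩
  · intro M hM _ Ω _ P _ Z _ ν Q Y u ζ x z zhat a v h T hT
    exact ⟨h.integrable_netCCV hM hc hn hp T,
      h.integral_netCCV_le_ccvBound hM hc hn hp hK hS hK' hT⟩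
  · have hF := hc.F₂_pos
    obtain ⟨t₀, ht₀⟩ := hS.eventually_ξ_le (show 0 < ς / (2 * (ς + c.F₂)) by positivity)
    refine expectedRate_of_powerBounded (hS.powerBounded_slaterBound (n := n) K K' ς t₀) ?_
    intro M hM hs Ω _ P _ Z _ ν Q Y u ζ x z zhat a v h T hT
    exact ⟨h.integrable_netCCV hM hc hn hp T,
      h.integral_netCCV_le_slaterBound hM hc hn hp hK hS hK' hς hs ht₀ hT⟩

end Conclusion

end BanditOpt
end

open BanditOpt in
theorem theorem1 (n p : ℕ) (hn : 0 < n) (hp : 0 < p) (c : Constants) (hc : c.Valid) :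
    (∀ S : Schedule, S.Admissible p c →
      ExpectedRate.{u, v} (n := n) (p := p) c S (fun _ => True) Problem.netReg
        (max S.θ₁ (max (1 - S.θ₁ + 2 * S.θ₃) (1 + S.θ₂ - S.θ₃))) ∧
      ExpectedRate.{u, v} (n := n) (p := p) c S (fun _ => True) Problem.netCCV
        (1 - S.θ₂ / 2) ∧
      ∀ ς : ℝ, 0 < ς →
        ExpectedRate.{u, v} (n := n) (p := p) c S (fun M => M.Slater ς) Problem.netCCV
          (1 - S.θ₂)) ∧
    (∀ α₀ γ₀ s₀ θ₁ θ₄ : ℝ, 0 < α₀ →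
      γ₀ ∈ Set.Ioc (0 : ℝ) (c.r ^ 2 / (2 * (p : ℝ) ^ 2 * c.F₂ ^ 2)) →
      0 < s₀ → θ₁ ∈ Set.Ioc (3 / 4 : ℝ) (5 / 6) → 1 ≤ θ₄ →
      (θ₁ = 5 / 6 → α₀ * γ₀ ≤ c.r ^ 2 / (2 * (p : ℝ) ^ 2 * c.F₂ ^ 2)) →
      ∀ S : Schedule, S = ⟨α₀, γ₀, s₀, θ₁, 2 * θ₁ - 3 / 2, θ₁ - 1 / 2, θ₄⟩ →
        ExpectedRate.{u, v} (n := n) (p := p) c S (fun _ => True) Problem.netReg θ₁ ∧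
        ExpectedRate.{u, v} (n := n) (p := p) c S (fun _ => True) Problem.netCCV (7 / 4 - θ₁) ∧
        ∀ ς : ℝ, 0 < ς →
          ExpectedRate.{u, v} (n := n) (p := p) c S (fun M => M.Slater ς) Problem.netCCV
            (5 / 2 - 2 * θ₁)) := by
  refine ⟨fun S hS => expectedRate_of_admissible hn hp hc hS, ?_⟩
  rintro α₀ γ₀ s₀ θ₁ θ₄ hα hγ hs ⟨h1, h2⟩ h4 hb S rfl
  have hS : Schedule.Admissible ⟨α₀, γ₀, s₀, θ₁, 2 * θ₁ - 3 / 2, θ₁ - 1 / 2, θ₄⟩ p c :=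
    { α₀_pos := hα
      θ₁_mem := ⟨by linarith, by linarith⟩
      γ₀_mem := hγ
      θ₂_mem := ⟨by dsimp only; linarith, by dsimp only; linarith⟩
      θ₃_mem := ⟨by dsimp only; linarith, by dsimp only; linarith⟩
      s₀_pos := hs
      θ₄_ge := h4
      borderline := fun h => hb (by dsimp only at h; linarith) }
  obtain ⟨r1, r2, r3⟩ := expectedRate_of_admissible.{u, v} (n := n) hn hp hc hS
  have e1 : regretExponent ⟨α₀, γ₀, s₀, θ₁, 2 * θ₁ - 3 / 2, θ₁ - 1 / 2, θ₄⟩ = θ₁ := by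
    simp only [regretExponent]
    rw [show 1 - θ₁ + 2 * (θ₁ - 1 / 2) = θ₁ by ring,
      show 1 + (2 * θ₁ - 3 / 2) - (θ₁ - 1 / 2) = θ₁ by ring, max_self, max_self]
  rw [e1] at r1
  refine ⟨r1, ?_, fun ς hς => ?_⟩
  · convert r2 using 1
    ring
  · convert r3 ς hς using 1
    ring
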